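/- **Theorem (Law of large numbers for the largest eigenvalue).** Let $d\ge 3$ be a fixed integer, let $\mathbb T_d=(V,E)$ be the infinite $d$-regular tree ($E$ being its set of undirected edges), and for $\alpha>2$ put $$h_d(\alpha)=2\cdot\sup_{\substack{\mathbf u=(u_i)_{i\in V}\in\mathbb R^V\\ \sum_i|u_i|=1}}\Big(\sum_{\{i,j\}\in E}|u_iu_j|^{\frac{\alpha}{2(\alpha-1)}}\Big)^{\frac{\alpha-1}{\alpha}}.$$ Then $h_d$ is a continuous function from $(2,\infty)$ to $(1,\infty)$ (in particular the supremum is finite), with $$\lim_{\alpha\downarrow2}h_d(\alpha)=1,\qquad \lim_{\alpha\to\infty}h_d(\alpha)=2\sqrt{d-1}.$$ Moreover, let $\alpha>0$ and let $\mu$ be a probability law on $\mathbb R$ that is Weibull with shape parameter $\alpha$, in the sense that there are constants $C_1,C_2>0$ such that for all $t\ge1$ $$\tfrac{C_1}{2}e^{-t^\alpha}\le\mu([t,\infty))\le\tfrac{C_2}{2}e^{-t^\alpha},\qquad \tfrac{C_1}{2}e^{-t^\alpha}\le\mu((-\infty,-t])\le\tfrac{C_2}{2}e^{-t^\alpha}.$$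 For every $n>d$ with $nd$ even, let $A=A^{(n)}$ be the adjacency matrix of a uniformly random simple $d$-regular graph on $n$ labelled vertices, let $W=W^{(n)}$ be a random real symmetric $n\times n$ matrix, independent of $A$, whose entries $W_{ij}$, $i<j$, are i.i.d. with law $\mu$, let $X=A\odot W$ be the entrywise product, $X_{ij}=A_{ij}W_{ij}$, and let $\lambda_1(X)$ be its largest eigenvalue. Then, as $n\to\infty$ through the integers with $nd$ even, $$\frac{\lambda_1(X)}{(\log n)^{1/\alpha}}\longrightarrow\begin{cases}1,&0<\alpha\le2,\\ h_d(\alpha),&\alpha>2,\end{cases}\qquad\text{in probability.}$$ -/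

import Mathlib

open MeasureTheory ProbabilityTheory Filter Topology
open scoped ENNReal Matrix

noncomputable section

namespace WeightedRegularGraph

/-! ### The infinite `d`-regular tree -/

/-- Vertices of the infinite `d`-regular tree: finite words over `d` letters in which no two
consecutive letters agree (the reduced words of the free product of `d` copies of `ℤ/2`). -/
abbrev TreeVertex (d : ℕ) : Type := {l : List (Fin d) // l.IsChain (· ≠ ·)}

/-- The infinite `d`-regular tree: two words are adjacent when one of them arises from the other
by prepending a letter. The root is the empty word. -/
def regularTree (d : ℕ) : SimpleGraph (TreeVertex d) where
  Adj u v := (∃ a, v.1 = a :: u.1) ∨ (∃ a, u.1 = a :: v.1)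
  symm := ⟨fun _ _ h => h.symm⟩
  loopless := ⟨fun u h => by
    rcases h with ⟨a, h⟩ | ⟨a, h⟩ <;> simpa using congrArg List.length h⟩

/-- `regularTree d` is a tree. -/
theorem regularTree_isTree (d : ℕ) : (regularTree d).IsTree := by
  rw [SimpleGraph.isTree_iff]
  constructor
  · have key : ∀ (l : List (Fin d)) (h : l.IsChain (· ≠ ·)),
        (regularTree d).Reachable ⟨l, h⟩ ⟨[], .nil⟩ := by
      intro l
      induction l with
      | nil => intro h; exact SimpleGraph.Reachable.refl _
      | cons a l ih =>
        intro h
        refine SimpleGraph.Reachable.trans (SimpleGraph.Adj.reachable ?_) (ih h.tail)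
        exact Or.inr ⟨a, rfl⟩
    have : Nonempty (TreeVertex d) := ⟨⟨[], .nil⟩⟩
    exact SimpleGraph.Connected.mk fun u v => (key u.1 u.2).trans (key v.1 v.2).symm
  · rw [SimpleGraph.isAcyclic_iff_forall_adj_isBridge]
    have main : ∀ u v : TreeVertex d, (∃ a, v.1 = a :: u.1) →
        ¬ ((regularTree d).deleteEdges {s(u, v)}).Reachable v u := by
      rintro u v ⟨a, hv⟩ ⟨p⟩
      have inv : ∀ x y : TreeVertex d, ((regularTree d).deleteEdges {s(u, v)}).Walk x y →
          v.1 <:+ x.1 → v.1 <:+ y.1 := by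
        intro x y p
        induction p with
        | nil => exact id
        | @cons x y z h p ih =>
          intro hx
          apply ih
          rw [SimpleGraph.deleteEdges_adj] at h
          obtain ⟨⟨b, hb⟩ | ⟨b, hb⟩, hne⟩ := h
          · rw [hb]; exact hx.trans (List.suffix_cons b _)
          · rw [hb, List.suffix_cons_iff] at hx
            rcases hx with hx | hx
            · exfalso
              apply hne
              have h1 : v = x := Subtype.ext (hx.trans hb.symm)
              have h2 : u = y := by
                apply Subtype.ext
                rw [hv] at hx
                exact (List.cons.inj hx).2
              rw [h1, h2]
              exact Sym2.eq_swap
            · exact hx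
      have := (inv v u p (List.suffix_refl _)).length_le
      rw [hv] at this
      simp at this
    intro u v h
    rw [SimpleGraph.isBridge_iff]
    rcases h with h | h
    · exact fun hr => main u v h hr.symm
    · intro hr
      rw [Sym2.eq_swap] at hr
      exact main v u h hr

/-- Every vertex of `regularTree d` has exactly `d` neighbours. -/
theorem regularTree_ncard_neighborSet (d : ℕ) (v : TreeVertex d) :
    ((regularTree d).neighborSet v).ncard = d := by
  obtain ⟨l, hl⟩ := v
  cases l with
  | nil =>
    let f : Fin d → TreeVertex d := fun a => ⟨[a], List.isChain_singleton a⟩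
    have hf : Function.Injective f := fun a b h => by
      simpa [f] using congrArg Subtype.val h
    have hr : (regularTree d).neighborSet ⟨[], hl⟩ = Set.range f := by
      ext ⟨w, hw⟩
      simp only [SimpleGraph.mem_neighborSet, regularTree, Set.mem_range, f, Subtype.mk.injEq]
      constructor
      · rintro (⟨a, h⟩ | ⟨a, h⟩)
        · exact ⟨a, h.symm⟩
        · simp at h
      · rintro ⟨a, h⟩
        exact Or.inl ⟨a, h.symm⟩
    rw [hr, Set.ncard_range_of_injective hf, Nat.card_eq_fintype_card, Fintype.card_fin]
  | cons b l =>
    have hl' : l.IsChain (· ≠ ·) := hl.tail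
    let f : Fin d → TreeVertex d := fun a =>
      if h : a = b then ⟨l, hl'⟩ else ⟨a :: b :: l, List.isChain_cons_cons.2 ⟨h, hl⟩⟩
    have hf : Function.Injective f := by
      intro a c h
      by_cases ha : a = b <;> by_cases hc : c = b
      · rw [ha, hc]
      · have := congrArg List.length (congrArg Subtype.val h)
        simp [f, ha, hc] at this
        omega
      · have := congrArg List.length (congrArg Subtype.val h)
        simp [f, ha, hc] at this
        omega
      · have := congrArg Subtype.val h
        simpa [f, ha, hc] using this
    have hr : (regularTree d).neighborSet ⟨b :: l, hl⟩ = Set.range f := by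
      ext ⟨w, hw⟩
      simp only [SimpleGraph.mem_neighborSet, regularTree, Set.mem_range, f]
      constructor
      · rintro (⟨a, h⟩ | ⟨a, h⟩)
        · change w = a :: b :: l at h
          subst h
          have hab := (List.isChain_cons_cons.1 hw).1
          exact ⟨a, by simp [hab]⟩
        · refine ⟨b, ?_⟩
          have := (List.cons.inj h).2
          simp [this]
      · rintro ⟨a, h⟩
        by_cases ha : a = b
        · have := congrArg Subtype.val h
          simp [ha] at this
          exact Or.inr ⟨b, by rw [this]⟩
        · have := congrArg Subtype.val h
          simp [ha] at this
          exact Or.inl ⟨a, this.symm⟩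
    rw [hr, Set.ncard_range_of_injective hf, Nat.card_eq_fintype_card, Fintype.card_fin]

/-! ### The variational problem -/

/-- `∑_{(i,j) ∈ E} |u_i u_j| ^ γ`, where `E` is the set of undirected edges of the `d`-regular
tree (each edge is counted once), as an element of `[0, ∞]`. -/
def treeEnergy (d : ℕ) (γ : ℝ) (u : TreeVertex d → ℝ) : ℝ≥0∞ :=
  ∑' e : (regularTree d).edgeSet, ENNReal.ofReal (|(Sym2.map u e.1).mul| ^ γ)

/-- The variational problem
`2 · sup_{‖u‖₁ = 1} (∑_{(i,j) ∈ E} |u_i u_j| ^ (α / (2(α-1)))) ^ ((α-1)/α)`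
with its value in `[0, ∞]`. -/
def hConstENN (d : ℕ) (α : ℝ) : ℝ≥0∞ :=
  2 * ⨆ u ∈ {u : TreeVertex d → ℝ | HasSum (fun i => |u i|) 1},
    treeEnergy d (α / (2 * (α - 1))) u ^ ((α - 1) / α)

/-- The constant `h_d(α)` as a real number. An infinite supremum would give the value `0`. -/
def hConst (d : ℕ) (α : ℝ) : ℝ := (hConstENN d α).toReal

/-! ### The random matrix -/

/-- The law `μ` on `ℝ` is Weibull with shape parameter `α`: both tails are comparable to
`exp (-t ^ α) / 2` for `t ≥ 1`. -/
def IsWeibull (μ : Measure ℝ) (α : ℝ) : Prop :=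
  ∃ C₁ C₂ : ℝ, 0 < C₁ ∧ 0 < C₂ ∧ ∀ t : ℝ, 1 ≤ t →
    (C₁ * Real.exp (-t ^ α) / 2 ≤ μ.real (Set.Ici t) ∧
      μ.real (Set.Ici t) ≤ C₂ * Real.exp (-t ^ α) / 2) ∧
    (C₁ * Real.exp (-t ^ α) / 2 ≤ μ.real (Set.Iic (-t)) ∧
      μ.real (Set.Iic (-t)) ≤ C₂ * Real.exp (-t ^ α) / 2)

open Classical in
/-- The set of simple `d`-regular graphs on the vertex set `Fin n`. -/
def regularGraphs (n d : ℕ) : Set (SimpleGraph (Fin n)) := {G | G.IsRegularOfDegree d}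

/-- `A` is a uniform random `d`-regular graph on `n` vertices and `W` is a random symmetric
matrix, independent of `A`, whose entries above the diagonal are i.i.d. with law `μ`. -/
structure IsModel {Ω : Type*} [MeasurableSpace Ω] (P : Measure Ω) (n d : ℕ) (μ : Measure ℝ)
    (A : Ω → SimpleGraph (Fin n)) (W : Ω → Matrix (Fin n) (Fin n) ℝ) : Prop where
  /-- `A` is uniform on the `d`-regular graphs. -/
  graph_law : HasLaw A (uniformOn (regularGraphs n d)) P
  /-- `W` is symmetric. -/
  weight_symm : ∀ ω, (W ω).IsSymm
  /-- The entries `W i j` with `i < j` have law `μ`. -/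
  weight_law : ∀ i j : Fin n, i < j → HasLaw (fun ω => W ω i j) μ P
  /-- The entries `W i j` with `i < j` are independent. -/
  weight_indep : iIndepFun
    (fun (p : {p : Fin n × Fin n // p.1 < p.2}) (ω : Ω) => W ω p.1.1 p.1.2) P
  /-- The weights are independent of the graph. -/
  graph_weight_indep : IndepFun A
    (fun (ω : Ω) (p : {p : Fin n × Fin n // p.1 < p.2}) => W ω p.1.1 p.1.2) P

open Classical in
/-- The weighted adjacency matrix `X = A ⊙ W`. -/
def weightedMatrix {n : ℕ} (A : SimpleGraph (Fin n)) (W : Matrix (Fin n) (Fin n) ℝ) :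
    Matrix (Fin n) (Fin n) ℝ :=
  A.adjMatrix ℝ ⊙ W

/-- The largest (real) eigenvalue of a matrix. -/
def largestEigenvalue {n : ℕ} (X : Matrix (Fin n) (Fin n) ℝ) : ℝ := sSup (spectrum ℝ X)

/-- The numbers `n` of vertices with `n ≥ d + 1` and `n d` even, i.e. those for which `d`-regular
simple graphs on `n` vertices exist. -/
def admissible (d : ℕ) : Set ℕ := {n | d < n ∧ Even (n * d)}

end WeightedRegularGraph

end

open WeightedRegularGraph

/-!
The constant. With `s = (α - 1) / α`, which runs from `1/2` to `1` as `α` runs from `2` to `∞`, the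
constant `h_d(α)` is twice the supremum (`treeNorm`) over `u` of the `ℓ^{1/s}` norms of the families
`|u_i u_j| ^ (1/2)` indexed by the edges of the tree. Such a norm increases with `s`, and by Hölder's
inequality it is log-convex in `s`; both properties pass to the supremum
(`treeNorm_mono`, `treeNorm_interpolate`). At `s = 1/2` the value of `2 * treeNorm` is at most `1`,
since the tree is bipartite and `p q ≤ (p + q) ^ 2 / 4` for the masses `p`, `q` of the two classes;
at `s = 1` it is at most the norm `2 √(d - 1)` of the adjacency operator. Hence the supremum is
finite, a log-convex finite function is continuous, and interpolation between the two endpoints gives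
the limit `1` at `α = 2`. The limit at infinity follows from monotonicity and from truncated radial
eigenfunctions as test vectors, and a path with two edges shows that `h_d > 1`.

The tree. If nonnegative weights `w` on the edges of a finite piece of the tree have cost
`∑ w ^ α ≤ 1`, then the largest eigenvalue of the weighted piece is at most `h_d(α)` for `α > 2`, by
Hölder's inequality, and at most `1` for `α ≤ 2`, by the inequality of Cauchy and Schwarz and
bipartiteness; these values cannot be improved (`TreeUpperBound`, `TreeLowerBound`).

The random graph. Every `d`-regular graph is covered by the tree, and a vertex near which there is no
short cycle is tree-like: the covering is injective on a large ball. A switching argument bounds the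
expected number of cycles of fixed length by a constant (`sum_card_cycleTuples_le`), so that all but a
bounded expected number of vertices are tree-like (`sum_card_not_isTreeLike_le`).

The weights. Independent Weibull weights exceed prescribed levels `w (log n) ^ (1/α)` on a fixed
number of edges with probability at least a constant times `n ^ (- ∑ w ^ α)`.

* Upper bound (`largestEigenvalue_weightedMatrix_le`). Weights below `ρ (log n) ^ (1/α)` move the
  eigenvalue by at most `d ρ (log n) ^ (1/α)`. By Chernoff's bound, no ball of fixed radius carries
  cost above `(1 + δ) log n`, and no ball around one of the few vertices that are not tree-like
  contains a heavy edge. Hence every component of the graph of heavy edges is a single vertex or a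
  piece of the tree with cost at most `(1 + δ) log n`.
* Lower bound (`le_largestEigenvalue_weightedMatrix`). There are order `n` disjoint tree-like balls.
  A nearly optimal weighted piece of the tree with cost less than `log n` appears in each of them
  independently with probability at least a constant times `n ^ (-σ)` for some `σ < 1`; with
  overwhelming probability it appears in one of them.
-/

namespace WeightedRegularGraph

/-! ### Coverings of regular graphs by the regular tree -/

section Covering

variable {d : ℕ} {V : Type*}

/-- The root of `regularTree d`. -/
def treeRoot (d : ℕ) : TreeVertex d := ⟨[], .nil⟩

/-- The neighbour of `t` along the edge labelled `a`: delete the first letter if it is `a`, and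
prepend `a` otherwise. -/
def treeNbr (t : TreeVertex d) (a : Fin d) : TreeVertex d :=
  ⟨if t.1.head? = some a then t.1.tail else a :: t.1, by
    obtain ⟨l, hl⟩ := t
    split_ifs with h
    · exact hl.tail
    · cases l with
      | nil => simp
      | cons b l =>
        refine List.isChain_cons_cons.2 ⟨?_, hl⟩
        rintro rfl
        simp at h⟩

theorem regularTree_adj_iff_exists_treeNbr {s t : TreeVertex d} :
    (regularTree d).Adj s t ↔ ∃ a, t = treeNbr s a := by
  obtain ⟨l, hl⟩ := s
  obtain ⟨m, hm⟩ := t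
  simp only [regularTree, treeNbr, Subtype.mk.injEq]
  constructor
  · rintro (⟨a, rfl⟩ | ⟨a, rfl⟩)
    · refine ⟨a, ?_⟩
      rw [if_neg]
      cases l with
      | nil => simp
      | cons b l => simpa using (List.isChain_cons_cons.1 hm).1.symm
    · exact ⟨a, by simp⟩
  · rintro ⟨a, h⟩
    split_ifs at h with h'
    · cases l with
      | nil => simp at h'
      | cons b l => exact Or.inr ⟨b, by simp [h]⟩
    · exact Or.inl ⟨a, h⟩

theorem length_le_of_adj {s t : TreeVertex d} (h : (regularTree d).Adj s t) :
    t.1.length ≤ s.1.length + 1 := by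
  rcases h with ⟨a, h⟩ | ⟨a, h⟩
  · simp [h]
  · simp [h]
    omega

/-- A covering of the graph `G` by the `d`-regular tree: a map that sends the neighbours of every
tree vertex `s` bijectively onto the neighbours of the image of `s`. -/
structure IsCovering (G : SimpleGraph V) (φ : TreeVertex d → V) : Prop where
  adj : ∀ ⦃s t⦄, (regularTree d).Adj s t → G.Adj (φ s) (φ t)
  inj : ∀ ⦃s t t'⦄, (regularTree d).Adj s t → (regularTree d).Adj s t' → φ t = φ t' → t = t'
  surj : ∀ ⦃s w⦄, G.Adj (φ s) w → ∃ t, (regularTree d).Adj s t ∧ φ t = w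

/-- The covering is built along the words. At each tree vertex one keeps its image `c` and a
labelling of the neighbours of `c` by the `d` letters; after a step along the letter `a` the
labelling at the new vertex is chosen such that the letter `a` leads back. -/
theorem exists_isCovering [Finite V] {G : SimpleGraph V} (hG : ∀ v, (G.neighborSet v).ncard = d)
    (v : V) : ∃ φ : TreeVertex d → V, IsCovering G φ ∧ φ (treeRoot d) = v := by
  have e : ∀ v, Fin d ≃ G.neighborSet v := fun v =>
    (Finite.equivFinOfCardEq (by rw [← hG v]; rfl)).symm
  let step : (Σ v, Fin d ≃ G.neighborSet v) → Fin d → (Σ v, Fin d ≃ G.neighborSet v) :=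
    fun st a => ⟨(st.2 a).1, (Equiv.swap a ((e (st.2 a).1).symm ⟨st.1, (st.2 a).2.symm⟩)).trans
      (e (st.2 a).1)⟩
  let run : List (Fin d) → (Σ v, Fin d ≃ G.neighborSet v) :=
    fun l => l.foldr (fun a st => step st a) ⟨v, e v⟩
  have hrun : ∀ a l, run (a :: l) = step (run l) a := fun a l => rfl
  have key : ∀ (t : TreeVertex d) a, (run (treeNbr t a).1).1 = ((run t.1).2 a).1 := by
    rintro ⟨l, hl⟩ a
    simp only [treeNbr]
    split_ifs with h
    · cases l with
      | nil => simp at h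
      | cons b l =>
        have hb : b = a := by simpa using h
        subst hb
        rw [hrun]
        simp [step]
    · rw [hrun]
  refine ⟨fun t => (run t.1).1, ⟨?_, ?_, ?_⟩, rfl⟩
  · intro s t h
    obtain ⟨a, rfl⟩ := regularTree_adj_iff_exists_treeNbr.1 h
    simp only [key]
    exact ((run s.1).2 a).2
  · intro s t t' h h' heq
    obtain ⟨a, rfl⟩ := regularTree_adj_iff_exists_treeNbr.1 h
    obtain ⟨b, rfl⟩ := regularTree_adj_iff_exists_treeNbr.1 h'
    simp only [key] at heq
    rw [(run s.1).2.injective (Subtype.ext heq)]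
  · intro s w h
    refine ⟨treeNbr s ((run s.1).2.symm ⟨w, h⟩), regularTree_adj_iff_exists_treeNbr.2 ⟨_, rfl⟩, ?_⟩
    simp only [key]
    simp

open Classical in
/-- The ball of radius `k` around `v` in the graph distance. -/
noncomputable def graphBall [Fintype V] (G : SimpleGraph V) (v : V) (k : ℕ) : Finset V :=
  {w | ∃ p : G.Walk v w, p.length ≤ k}

theorem mem_graphBall [Fintype V] {G : SimpleGraph V} {v w : V} {k : ℕ} :
    w ∈ graphBall G v k ↔ ∃ p : G.Walk v w, p.length ≤ k := by
  simp [graphBall]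

theorem mem_graphBall_comm [Fintype V] {G : SimpleGraph V} {v w : V} {k : ℕ} :
    w ∈ graphBall G v k ↔ v ∈ graphBall G w k := by
  simp only [mem_graphBall]
  constructor <;> rintro ⟨p, hp⟩ <;> exact ⟨p.reverse, by simpa using hp⟩

theorem graphBall_trans [Fintype V] {G : SimpleGraph V} {u v w : V} {k l : ℕ}
    (h : v ∈ graphBall G u k) (h' : w ∈ graphBall G v l) : w ∈ graphBall G u (k + l) := by
  rw [mem_graphBall] at *
  obtain ⟨p, hp⟩ := h
  obtain ⟨q, hq⟩ := h'
  exact ⟨p.append q, by rw [SimpleGraph.Walk.length_append]; omega⟩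

theorem graphBall_mono [Fintype V] {G : SimpleGraph V} {v : V} {k l : ℕ} (h : k ≤ l) :
    graphBall G v k ⊆ graphBall G v l := by
  intro w hw
  rw [mem_graphBall] at *
  obtain ⟨p, hp⟩ := hw
  exact ⟨p, hp.trans h⟩

theorem card_graphBall_le [Fintype V] {G : SimpleGraph V}
    (hG : ∀ v, (G.neighborSet v).ncard = d) (v : V) (k : ℕ) :
    (graphBall G v k).card ≤ (d + 1) ^ k := by
  classical
  induction k generalizing v with
  | zero =>
    have : graphBall G v 0 ⊆ {v} := by
      intro w hw
      obtain ⟨p, hp⟩ := mem_graphBall.1 hw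
      have := SimpleGraph.Walk.eq_of_length_eq_zero (Nat.le_zero.1 hp)
      simp [this]
    simpa using Finset.card_le_card this
  | succ k ih =>
    have hsub : graphBall G v (k + 1) ⊆
        (insert v (G.neighborFinset v)).biUnion (fun u => graphBall G u k) := by
      intro w hw
      obtain ⟨p, hp⟩ := mem_graphBall.1 hw
      rw [Finset.mem_biUnion]
      cases p with
      | nil => exact ⟨v, by simp, mem_graphBall.2 ⟨.nil, by simp⟩⟩
      | cons h q => exact ⟨_, by simp [h], mem_graphBall.2 ⟨q, by simpa using hp⟩⟩
    have hdeg : (insert v (G.neighborFinset v)).card ≤ d + 1 := by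
      refine (Finset.card_insert_le _ _).trans ?_
      rw [← hG v, Set.ncard_eq_toFinset_card', SimpleGraph.neighborFinset]
    calc (graphBall G v (k + 1)).card ≤ _ := Finset.card_le_card hsub
      _ ≤ (insert v (G.neighborFinset v)).card * (d + 1) ^ k :=
          Finset.card_biUnion_le_card_mul _ _ _ fun u _ => ih u
      _ ≤ (d + 1) * (d + 1) ^ k := Nat.mul_le_mul_right _ hdeg
      _ = (d + 1) ^ (k + 1) := by ring

/-- A walk in the tree from the root to `s` along the suffixes of the word `s`. -/
theorem exists_walk_root (s : TreeVertex d) :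
    ∃ p : (regularTree d).Walk (treeRoot d) s, p.length = s.1.length := by
  obtain ⟨l, hl⟩ := s
  induction l with
  | nil => exact ⟨.nil, rfl⟩
  | cons a l ih =>
    have hl' : l.IsChain (· ≠ ·) := hl.tail
    obtain ⟨p, hp⟩ := ih hl'
    have h : (regularTree d).Adj ⟨l, hl'⟩ ⟨a :: l, hl⟩ := Or.inl ⟨a, rfl⟩
    exact ⟨p.concat h, by simp [SimpleGraph.Walk.length_concat, hp]⟩

theorem length_le_of_walk {s t : TreeVertex d} (p : (regularTree d).Walk s t) :
    t.1.length ≤ s.1.length + p.length := by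
  induction p with
  | nil => simp
  | cons h p ih =>
    have := length_le_of_adj h
    rw [SimpleGraph.Walk.length_cons]
    omega

theorem IsCovering.mem_graphBall [Fintype V] {G : SimpleGraph V} {φ : TreeVertex d → V}
    (hφ : IsCovering G φ) {s : TreeVertex d} {k : ℕ} (hs : s.1.length ≤ k) :
    φ s ∈ graphBall G (φ (treeRoot d)) k := by
  obtain ⟨p, hp⟩ := exists_walk_root s
  let f : regularTree d →g G := ⟨φ, fun h => hφ.adj h⟩
  exact WeightedRegularGraph.mem_graphBall.2 ⟨p.map f, by simp [hp, hs]⟩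

theorem IsCovering.exists_of_walk {G : SimpleGraph V} {φ : TreeVertex d → V}
    (hφ : IsCovering G φ) {v w : V} (p : G.Walk v w) (s : TreeVertex d) (hs : φ s = v) :
    ∃ t : TreeVertex d, t.1.length ≤ s.1.length + p.length ∧ φ t = w := by
  induction p generalizing s with
  | nil => exact ⟨s, by simp, hs⟩
  | cons h p ih =>
    subst hs
    obtain ⟨t, ht, rfl⟩ := hφ.surj h
    obtain ⟨r, hr, hr'⟩ := ih t rfl
    have := length_le_of_adj ht
    exact ⟨r, by rw [SimpleGraph.Walk.length_cons]; omega, hr'⟩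

theorem IsCovering.exists_of_mem_graphBall [Fintype V] {G : SimpleGraph V} {φ : TreeVertex d → V}
    (hφ : IsCovering G φ) {w : V} {k : ℕ} (hw : w ∈ graphBall G (φ (treeRoot d)) k) :
    ∃ t : TreeVertex d, t.1.length ≤ k ∧ φ t = w := by
  obtain ⟨p, hp⟩ := WeightedRegularGraph.mem_graphBall.1 hw
  obtain ⟨t, ht, htw⟩ := hφ.exists_of_walk p (treeRoot d) rfl
  exact ⟨t, by simpa [treeRoot] using ht.trans (Nat.add_le_add_left hp _), htw⟩

/-- The vertex `v` is tree-like to depth `R`: some covering based at `v` is injective on the words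
of length at most `R`, so that the ball of radius `R` around `v` is a ball of the regular tree
(possibly with additional edges on its boundary). -/
def IsTreeLike (d : ℕ) (G : SimpleGraph V) (v : V) (R : ℕ) : Prop :=
  ∃ φ : TreeVertex d → V, IsCovering G φ ∧ φ (treeRoot d) = v ∧
    Set.InjOn φ {s | s.1.length ≤ R}

open Classical in
/-- The cycles of length `m + 1` of `G`, with a base point and an orientation. -/
noncomputable def cycleTuples [Fintype V] (G : SimpleGraph V) (m : ℕ) : Finset (Fin (m + 1) → V) :=
  {c | Function.Injective c ∧ (∀ i : Fin m, G.Adj (c i.castSucc) (c i.succ)) ∧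
    G.Adj (c (Fin.last m)) (c 0)}

theorem exists_walk_getVert {G : SimpleGraph V} {u v : V} (p : G.Walk u v) {i j : ℕ}
    (hij : i ≤ j) (hj : j ≤ p.length) :
    ∃ q : G.Walk (p.getVert i) (p.getVert j), q.length = j - i := by
  induction j, hij using Nat.le_induction with
  | base => exact ⟨.nil, by simp⟩
  | succ j hij ih =>
    obtain ⟨q, hq⟩ := ih (by omega)
    refine ⟨q.concat (p.adj_getVert_succ (by omega)), ?_⟩
    rw [SimpleGraph.Walk.length_concat]
    omega

/-- If the covering based at `v` identifies two words of length at most `R`, then a shortest tree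
walk between two identified words projects to a cycle near `v`. -/
theorem exists_cycle_of_not_isTreeLike [Fintype V] {G : SimpleGraph V}
    (hG : ∀ v, (G.neighborSet v).ncard = d) {v : V} {R : ℕ} (hv : ¬ IsTreeLike d G v R) :
    ∃ m, 2 ≤ m ∧ m ≤ 2 * R ∧ ∃ c ∈ cycleTuples G m, v ∈ graphBall G (c 0) (3 * R) := by
  classical
  obtain ⟨φ, hφ, rfl⟩ := exists_isCovering hG v
  have hinj : ¬ Set.InjOn φ {s | s.1.length ≤ R} := fun h => hv ⟨φ, hφ, rfl, h⟩
  simp only [Set.InjOn, Set.mem_ofPred_eq] at hinj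
  push Not at hinj
  obtain ⟨s₀, hs₀, t₀, ht₀, heq₀, hne₀⟩ := hinj
  -- Among all walks between identified words take a shortest one; the condition on `|s| + n` keeps it
  -- near the root and is inherited by subwalks.
  let Q : ℕ → Prop := fun n => ∃ (s t : TreeVertex d) (p : (regularTree d).Walk s t),
    s ≠ t ∧ φ s = φ t ∧ p.length = n ∧ s.1.length + n ≤ 3 * R
  obtain ⟨p₁, hp₁⟩ := exists_walk_root s₀
  obtain ⟨p₂, hp₂⟩ := exists_walk_root t₀
  have hQ₀ : Q (s₀.1.length + t₀.1.length) :=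
    ⟨s₀, t₀, p₁.reverse.append p₂, hne₀, heq₀, by simp [hp₁, hp₂], by omega⟩
  have hQ : ∃ n, Q n := ⟨_, hQ₀⟩
  have hn2 : Nat.find hQ ≤ 2 * R := (Nat.find_min' hQ hQ₀).trans (by omega)
  have hmin : ∀ k, k < Nat.find hQ → ¬ Q k := fun k hk => Nat.find_min hQ hk
  obtain ⟨s, t, p, hne, heq, hlen, hR⟩ := Nat.find_spec hQ
  generalize Nat.find hQ = n at hmin hlen hR hn2
  have hlenv : ∀ i ≤ n, (p.getVert i).1.length ≤ s.1.length + i := by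
    intro i hi
    obtain ⟨q, hq⟩ := exists_walk_getVert p (Nat.zero_le i) (hlen ▸ hi)
    have := length_le_of_walk q
    rw [hq, p.getVert_zero] at this
    simpa using this
  -- By minimality the images are distinct: a repeated image gives a shorter walk of the same kind,
  -- either the part between the two times or, if the words agree, the walk without that part.
  have hdist : ∀ i j, i < j → j ≤ n → j - i < n → φ (p.getVert i) ≠ φ (p.getVert j) := by
    intro i j hij hj hlt h
    obtain ⟨q, hq⟩ := exists_walk_getVert p hij.le (hlen ▸ hj)
    by_cases hv : p.getVert i = p.getVert j
    · obtain ⟨q₁, hq₁⟩ := exists_walk_getVert p (Nat.zero_le i) (by omega)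
      obtain ⟨q₂, hq₂⟩ := exists_walk_getVert p (hlen ▸ hj) le_rfl
      refine hmin (i + (n - j)) (by omega) ⟨s, t, ((q₁.copy p.getVert_zero hv).append
        (q₂.copy rfl p.getVert_length)), hne, heq, ?_, by omega⟩
      simp [hq₁, hq₂, hlen]
    · have := hlenv i (by omega)
      exact hmin (j - i) hlt ⟨_, _, q, hv, h, hq, by omega⟩
  have hadj : ∀ i < n, (regularTree d).Adj (p.getVert i) (p.getVert (i + 1)) :=
    fun i hi => p.adj_getVert_succ (hlen ▸ hi)
  have h0 : p.getVert 0 = s := p.getVert_zero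
  have hn : p.getVert n = t := by rw [← hlen]; exact p.getVert_length
  -- The image is not a degenerate closed walk: `G` has no loops, and a covering cannot backtrack.
  have hn3 : 3 ≤ n := by
    by_contra hlt
    have : n = 0 ∨ n = 1 ∨ n = 2 := by omega
    rcases this with rfl | rfl | rfl
    · exact hne (h0.symm.trans hn)
    · have := hφ.adj (hadj 0 (by omega))
      rw [h0, hn, heq] at this
      exact G.loopless.irrefl _ this
    · have h1 := hadj 0 (by omega)
      have h2 := hadj 1 (by omega)
      rw [h0] at h1
      rw [hn] at h2
      exact hne (hφ.inj h1.symm h2 heq)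
  obtain ⟨m, rfl⟩ : ∃ m, n = m + 1 := ⟨n - 1, by omega⟩
  refine ⟨m, by omega, by omega, fun i => φ (p.getVert i), ?_, ?_⟩
  · simp only [cycleTuples, Finset.mem_filter_univ]
    refine ⟨?_, ?_, ?_⟩
    · intro i j hij
      by_contra hne'
      rcases lt_or_gt_of_ne (Fin.val_ne_of_ne hne') with h | h
      · exact hdist i j h (by omega) (by omega) hij
      · exact hdist j i h (by omega) (by omega) hij.symm
    · intro i
      exact hφ.adj (hadj i (by omega))
    · have := hφ.adj (hadj m (by omega))
      rw [hn, ← heq] at this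
      simpa [h0] using this
  · rw [mem_graphBall_comm]
    exact hφ.mem_graphBall (by simp [h0]; omega)

end Covering

/-! ### Short cycles in uniform random regular graphs -/

section Switching

variable {d : ℕ} {V : Type*}

/-- Replace the edges `uv` and `xy` of `G` by `ux` and `vy`. -/
def switchGraph (G : SimpleGraph V) (u v x y : V) : SimpleGraph V :=
  SimpleGraph.fromEdgeSet ((G.edgeSet \ {s(u, v), s(x, y)}) ∪ {s(u, x), s(v, y)})

theorem switchGraph_adj {G : SimpleGraph V} {u v x y a b : V} :
    (switchGraph G u v x y).Adj a b ↔
      ((G.Adj a b ∧ s(a, b) ≠ s(u, v) ∧ s(a, b) ≠ s(x, y)) ∨ s(a, b) = s(u, x) ∨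
        s(a, b) = s(v, y)) ∧ a ≠ b := by
  simp only [switchGraph, SimpleGraph.fromEdgeSet_adj, Set.mem_union, Set.mem_sdiff,
    SimpleGraph.mem_edgeSet, Set.mem_insert_iff, Set.mem_singleton_iff, not_or, ne_eq]

theorem switchGraph_symm (G : SimpleGraph V) (u v x y : V) :
    switchGraph G v u y x = switchGraph G u v x y := by
  unfold switchGraph
  rw [Sym2.eq_swap (a := v), Sym2.eq_swap (a := y), Set.pair_comm s(v, y)]

theorem switchGraph_symm' (G : SimpleGraph V) (u v x y : V) :
    switchGraph G x y u v = switchGraph G u v x y := by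
  unfold switchGraph
  rw [Sym2.eq_swap (a := x) (b := u), Sym2.eq_swap (a := y) (b := v), Set.pair_comm s(x, y)]

theorem ncard_neighborSet_switchGraph_left [Finite V] {G : SimpleGraph V} {u v x y : V}
    (huv : G.Adj u v) (hux : ¬ G.Adj u x) (h₁ : u ≠ x) (h₂ : u ≠ y) (h₃ : v ≠ x) :
    ((switchGraph G u v x y).neighborSet u).ncard = (G.neighborSet u).ncard := by
  have hne := huv.ne
  have : (switchGraph G u v x y).neighborSet u = insert x (G.neighborSet u \ {v}) := by
    ext b
    simp only [SimpleGraph.mem_neighborSet, switchGraph_adj, Set.mem_insert_iff, Set.mem_sdiff,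
      Set.mem_singleton_iff, Sym2.eq_iff]
    constructor
    · grind
    · rintro (rfl | ⟨h, h'⟩)
      · simp [h₁]
      · have := h.ne
        grind
  rw [this]
  exact Set.ncard_exchange hux huv

theorem ncard_neighborSet_switchGraph [Finite V] {G : SimpleGraph V} {u v x y : V}
    (huv : G.Adj u v) (hxy : G.Adj x y) (hux : ¬ G.Adj u x) (hvy : ¬ G.Adj v y)
    (h₁ : u ≠ x) (h₂ : u ≠ y) (h₃ : v ≠ x) (h₄ : v ≠ y) (w : V) :
    ((switchGraph G u v x y).neighborSet w).ncard = (G.neighborSet w).ncard := by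
  by_cases hu : w = u
  · subst hu
    exact ncard_neighborSet_switchGraph_left huv hux h₁ h₂ h₃
  by_cases hv : w = v
  · subst hv
    rw [← switchGraph_symm]
    exact ncard_neighborSet_switchGraph_left huv.symm hvy h₄ h₃ h₂
  by_cases hx : w = x
  · subst hx
    rw [← switchGraph_symm']
    exact ncard_neighborSet_switchGraph_left hxy (fun h => hux h.symm) h₁.symm h₃.symm h₂.symm
  by_cases hy : w = y
  · subst hy
    rw [← switchGraph_symm', ← switchGraph_symm]
    exact ncard_neighborSet_switchGraph_left hxy.symm (fun h => hvy h.symm) h₄.symm h₂.symm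
      h₃.symm
  congr 1
  ext b
  simp only [SimpleGraph.mem_neighborSet, switchGraph_adj, Sym2.eq_iff]
  constructor
  · grind
  · intro h
    have := h.ne
    grind

/-- The original graph is recovered from the switched one. -/
theorem eq_of_switchGraph_eq {G G' : SimpleGraph V} {u v x y : V}
    (huv : G.Adj u v) (hxy : G.Adj x y) (hux : ¬ G.Adj u x) (hvy : ¬ G.Adj v y)
    (huv' : G'.Adj u v) (hxy' : G'.Adj x y) (hux' : ¬ G'.Adj u x) (hvy' : ¬ G'.Adj v y)
    (h : switchGraph G u v x y = switchGraph G' u v x y) : G = G' := by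
  ext a b
  by_cases hab : a = b
  · subst hab
    simp
  have := congrArg (fun H => H.Adj a b) h
  simp only [switchGraph_adj, eq_iff_iff, Sym2.eq_iff] at this
  have s1 := huv.symm
  have s2 := hxy.symm
  have s3 := huv'.symm
  have s4 := hxy'.symm
  have s5 : ¬ G.Adj x u := fun h => hux h.symm
  have s6 : ¬ G.Adj y v := fun h => hvy h.symm
  have s7 : ¬ G'.Adj x u := fun h => hux' h.symm
  have s8 : ¬ G'.Adj y v := fun h => hvy' h.symm
  grind

open Classical in
/-- The `d`-regular graphs on `V`. -/
noncomputable def regularGraphFinset (V : Type*) [Fintype V] (d : ℕ) : Finset (SimpleGraph V) :=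
  {G | ∀ v, (G.neighborSet v).ncard = d}

open Classical in
/-- The walks with `m` steps in `G`, as tuples of vertices. -/
noncomputable def walkTuples [Fintype V] (G : SimpleGraph V) (m : ℕ) : Finset (Fin (m + 1) → V) :=
  {c | ∀ i : Fin m, G.Adj (c i.castSucc) (c i.succ)}

open Classical in
theorem card_neighbor_filter [Fintype V] {G : SimpleGraph V}
    (hG : ∀ v, (G.neighborSet v).ncard = d) (v : V) :
    (Finset.univ.filter fun w => G.Adj v w).card = d := by
  rw [← hG v, ← Set.ncard_coe_finset]
  congr 1
  ext w
  simp

theorem card_walkTuples_le [Fintype V] {G : SimpleGraph V}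
    (hG : ∀ v, (G.neighborSet v).ncard = d) (m : ℕ) :
    (walkTuples G m).card ≤ Fintype.card V * d ^ m := by
  classical
  induction m with
  | zero => simp [walkTuples]
  | succ m ih =>
    have hsub : walkTuples G (m + 1) ⊆ ((walkTuples G m).sigma
        (fun c => Finset.univ.filter fun w => G.Adj (c (Fin.last m)) w)).image
          (fun p => (Fin.snoc p.1 p.2 : Fin (m + 2) → V)) := by
      intro c hc
      simp only [walkTuples, Finset.mem_filter_univ] at hc
      rw [Finset.mem_image]
      refine ⟨⟨Fin.init c, c (Fin.last (m + 1))⟩, ?_, Fin.snoc_init_self c⟩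
      simp only [walkTuples, Finset.mem_sigma, Finset.mem_filter_univ]
      exact ⟨fun i => by simpa [Fin.init] using hc i.castSucc,
        by simpa [Fin.init] using hc (Fin.last m)⟩
    calc (walkTuples G (m + 1)).card ≤ _ := Finset.card_le_card hsub
      _ ≤ _ := Finset.card_image_le
      _ = (walkTuples G m).card * d := by
          rw [Finset.card_sigma, Finset.sum_congr rfl fun c _ => card_neighbor_filter hG _]
          simp
      _ ≤ Fintype.card V * d ^ m * d := Nat.mul_le_mul_right _ ih
      _ = Fintype.card V * d ^ (m + 1) := by ring

open Classical in
theorem card_darts_from [Fintype V] {G : SimpleGraph V}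
    (hG : ∀ v, (G.neighborSet v).ncard = d) (S : Finset V) :
    (Finset.univ.filter fun p : V × V => p.1 ∈ S ∧ G.Adj p.1 p.2).card = S.card * d := by
  have : (Finset.univ.filter fun p : V × V => p.1 ∈ S ∧ G.Adj p.1 p.2) =
      (S.sigma fun v => Finset.univ.filter fun w => G.Adj v w).map
        (Equiv.sigmaEquivProd V V).toEmbedding := by
    ext ⟨a, b⟩
    simp [Equiv.sigmaEquivProd]
  rw [this, Finset.card_map, Finset.card_sigma,
    Finset.sum_congr rfl fun c _ => card_neighbor_filter hG _]
  simp

open Classical in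
theorem card_darts_to [Fintype V] {G : SimpleGraph V}
    (hG : ∀ v, (G.neighborSet v).ncard = d) (S : Finset V) :
    (Finset.univ.filter fun p : V × V => p.2 ∈ S ∧ G.Adj p.1 p.2).card = S.card * d := by
  rw [← card_darts_from hG S]
  refine Finset.card_bij (fun p _ => p.swap) ?_ ?_ ?_
  · rintro ⟨a, b⟩ h
    simpa [G.adj_comm] using h
  · intro p _ q _ h
    exact Prod.swap_injective h
  · rintro ⟨a, b⟩ h
    exact ⟨(b, a), by simpa [G.adj_comm] using h, rfl⟩

open Classical in
/-- The oriented edges `xy` for which the last edge of the cycle `c` can be switched with `xy`. -/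
noncomputable def switchPairs [Fintype V] (G : SimpleGraph V) {m : ℕ} (c : Fin (m + 1) → V) :
    Finset (V × V) :=
  {p | G.Adj p.1 p.2 ∧ p.1 ∉ Set.range c ∧ p.2 ∉ Set.range c ∧ ¬ G.Adj (c 0) p.1 ∧
    ¬ G.Adj (c (Fin.last m)) p.2}

theorem le_card_switchPairs [Fintype V] {G : SimpleGraph V}
    (hG : ∀ v, (G.neighborSet v).ncard = d) {m : ℕ} (c : Fin (m + 1) → V) :
    Fintype.card V * d ≤ (switchPairs G c).card + (2 * (m + 1) * d + 2 * (d * d)) := by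
  classical
  let S : Finset V := Finset.univ.image c
  have hS : S.card ≤ m + 1 := Finset.card_image_le.trans (by simp)
  let N₀ : Finset V := Finset.univ.filter fun w => G.Adj (c 0) w
  let N₁ : Finset V := Finset.univ.filter fun w => G.Adj (c (Fin.last m)) w
  have hN₀ : N₀.card = d := card_neighbor_filter hG _
  have hN₁ : N₁.card = d := card_neighbor_filter hG _
  have hsub : (Finset.univ.filter fun p : V × V => p.1 ∈ Finset.univ ∧ G.Adj p.1 p.2) ⊆
      switchPairs G c ∪
        (((Finset.univ.filter fun p : V × V => p.1 ∈ S ∧ G.Adj p.1 p.2) ∪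
          (Finset.univ.filter fun p : V × V => p.2 ∈ S ∧ G.Adj p.1 p.2)) ∪
        ((Finset.univ.filter fun p : V × V => p.1 ∈ N₀ ∧ G.Adj p.1 p.2) ∪
          (Finset.univ.filter fun p : V × V => p.2 ∈ N₁ ∧ G.Adj p.1 p.2))) := by
    rintro ⟨a, b⟩ h
    simp only [Finset.mem_univ, true_and, Finset.mem_filter_univ] at h
    simp only [switchPairs, Finset.mem_union, Finset.mem_filter_univ, S, N₀, N₁, Finset.mem_image,
      Finset.mem_univ, true_and, Set.mem_range]
    tauto
  have := Finset.card_le_card hsub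
  rw [card_darts_from hG, Finset.card_univ] at this
  refine this.trans ((Finset.card_union_le _ _).trans (Nat.add_le_add_left ?_ _))
  refine (Finset.card_union_le _ _).trans ?_
  refine (Nat.add_le_add (Finset.card_union_le _ _) (Finset.card_union_le _ _)).trans ?_
  rw [card_darts_from hG, card_darts_from hG, card_darts_to hG, card_darts_to hG, hN₀, hN₁]
  have := Nat.mul_le_mul_right d hS
  nlinarith

/-- **Expected number of cycles.** Switching the last edge of a cycle with any of the roughly
`n d` other oriented edges maps the pairs (graph, cycle) to pairs (graph, path), and there are at
most `n d ^ m` paths in each graph. -/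
theorem sum_card_cycleTuples_le [Fintype V] (hd : 2 ≤ d) {m : ℕ} (hm : 2 ≤ m)
    (hn : 2 * (m + 1) * d + 2 * (d * d) < Fintype.card V) :
    ∑ G ∈ regularGraphFinset V d, (cycleTuples G m).card ≤
      (regularGraphFinset V d).card * d ^ (m + 2) := by
  classical
  let D : Finset (Σ _ : SimpleGraph V, Σ _ : Fin (m + 1) → V, V × V) :=
    (regularGraphFinset V d).sigma fun G => (cycleTuples G m).sigma fun c => switchPairs G c
  let T : Finset (Σ _ : SimpleGraph V, Σ _ : Fin (m + 1) → V, V × V) :=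
    (regularGraphFinset V d).sigma fun G => (walkTuples G m).sigma fun c =>
      (Finset.univ.filter fun w => G.Adj (c 0) w) ×ˢ
        (Finset.univ.filter fun w => G.Adj (c (Fin.last m)) w)
  let f : (Σ _ : SimpleGraph V, Σ _ : Fin (m + 1) → V, V × V) →
      (Σ _ : SimpleGraph V, Σ _ : Fin (m + 1) → V, V × V) := fun p =>
    ⟨switchGraph p.1 (p.2.1 0) (p.2.1 (Fin.last m)) p.2.2.1 p.2.2.2, p.2⟩
  have hlast : (0 : Fin (m + 1)) ≠ Fin.last m := by
    intro h
    have := congrArg Fin.val h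
    simp at this
    omega
  have hmaps : Set.MapsTo f D T := by
    rintro ⟨G, c, x, y⟩ h
    simp only [D, T, f, Finset.coe_sigma, Set.mem_sigma_iff, Finset.mem_coe, regularGraphFinset,
      cycleTuples, switchPairs, walkTuples, Finset.mem_filter_univ, Finset.mem_product] at h ⊢
    obtain ⟨hG, ⟨hinj, hpath, hclose⟩, hxy, hx, hy, hux, hvy⟩ := h
    have hne : ∀ i, c i ≠ x := fun i h => hx ⟨i, h⟩
    have hne' : ∀ i, c i ≠ y := fun i h => hy ⟨i, h⟩
    refine ⟨fun v => ?_, fun i => ?_, ?_, ?_⟩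
    · rw [ncard_neighborSet_switchGraph hclose.symm hxy hux hvy (hne _) (hne' _) (hne _) (hne' _)]
      exact hG v
    · rw [switchGraph_adj]
      refine ⟨Or.inl ⟨hpath i, ?_, ?_⟩, (hpath i).ne⟩
      · rw [Ne, Sym2.eq_iff]
        rintro (⟨h1, h2⟩ | ⟨h1, h2⟩)
        · have e1 := congrArg Fin.val (hinj h1)
          have e2 := congrArg Fin.val (hinj h2)
          simp at e1 e2
          omega
        · have e2 := hinj h2
          exact Fin.succ_ne_zero i e2
      · rw [Ne, Sym2.eq_iff]
        rintro (⟨h1, _⟩ | ⟨h1, _⟩)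
        · exact hne _ h1
        · exact hne' _ h1
    · rw [switchGraph_adj]
      exact ⟨Or.inr (Or.inl rfl), hne _⟩
    · rw [switchGraph_adj]
      exact ⟨Or.inr (Or.inr rfl), hne' _⟩
  have hinj : Set.InjOn f D := by
    rintro ⟨G, c, x, y⟩ h ⟨G', c', x', y'⟩ h' heq
    simp only [f, Sigma.mk.injEq, heq_eq_eq] at heq
    obtain ⟨heq, hc⟩ := heq
    simp only [Prod.mk.injEq] at hc
    obtain ⟨rfl, rfl, rfl⟩ := hc
    simp only [D, Finset.coe_sigma, Set.mem_sigma_iff, Finset.mem_coe, regularGraphFinset,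
      cycleTuples, switchPairs, Finset.mem_filter_univ] at h h'
    obtain ⟨-, ⟨-, -, hclose⟩, hxy, -, -, hux, hvy⟩ := h
    obtain ⟨-, ⟨-, -, hclose'⟩, hxy', -, -, hux', hvy'⟩ := h'
    have := eq_of_switchGraph_eq hclose.symm hxy hux hvy hclose'.symm hxy' hux' hvy' heq
    subst this
    rfl
  -- Both sides are counted: a cycle has at least `n` admissible oriented edges, and a path has
  -- `d * d` choices for the two new neighbours of its ends.
  have hcard : D.card ≤ T.card := Finset.card_le_card_of_injOn f hmaps hinj
  have hD : (∑ G ∈ regularGraphFinset V d, (cycleTuples G m).card) * Fintype.card V ≤ D.card := by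
    simp only [D, Finset.card_sigma]
    rw [Finset.sum_mul]
    refine Finset.sum_le_sum fun G hG => ?_
    rw [← smul_eq_mul]
    refine Finset.card_nsmul_le_sum _ _ _ fun c _ => ?_
    have := le_card_switchPairs (d := d) (by simpa [regularGraphFinset] using hG) c
    nlinarith
  have hT : T.card ≤ (regularGraphFinset V d).card * d ^ (m + 2) * Fintype.card V := by
    simp only [T, Finset.card_sigma, Finset.card_product]
    rw [mul_assoc, ← smul_eq_mul]
    refine Finset.sum_le_card_nsmul _ _ _ fun G hG => ?_
    have hG' : ∀ v, (G.neighborSet v).ncard = d := by simpa [regularGraphFinset] using hG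
    rw [Finset.sum_congr rfl fun c _ => by
      rw [card_neighbor_filter hG', card_neighbor_filter hG'], Finset.sum_const, smul_eq_mul]
    calc _ ≤ (Fintype.card V * d ^ m) * (d * d) :=
          Nat.mul_le_mul_right _ (card_walkTuples_le hG' m)
      _ = _ := by ring
  exact Nat.le_of_mul_le_mul_right (hD.trans (hcard.trans hT)) (by omega)

open Classical in
/-- The expected number of vertices that are not tree-like to depth `R` is bounded. -/
theorem sum_card_not_isTreeLike_le [Fintype V] (hd : 2 ≤ d) (R : ℕ)
    (hn : 2 * (2 * R + 1) * d + 2 * (d * d) < Fintype.card V) :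
    ∑ G ∈ regularGraphFinset V d, (Finset.univ.filter fun v => ¬ IsTreeLike d G v R).card ≤
      (regularGraphFinset V d).card *
        (∑ m ∈ Finset.Icc 2 (2 * R), d ^ (m + 2) * (d + 1) ^ (3 * R)) := by
  have hle : ∀ G ∈ regularGraphFinset V d,
      (Finset.univ.filter fun v => ¬ IsTreeLike d G v R).card ≤
        ∑ m ∈ Finset.Icc 2 (2 * R), (cycleTuples G m).card * (d + 1) ^ (3 * R) := by
    intro G hG
    have hG' : ∀ v, (G.neighborSet v).ncard = d := by simpa [regularGraphFinset] using hG
    have hsub : (Finset.univ.filter fun v => ¬ IsTreeLike d G v R) ⊆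
        (Finset.Icc 2 (2 * R)).biUnion fun m => (cycleTuples G m).biUnion fun c =>
          graphBall G (c 0) (3 * R) := by
      intro v hv
      obtain ⟨m, hm, hm', c, hc, hv'⟩ :=
        exists_cycle_of_not_isTreeLike hG' (by simpa using hv)
      simp only [Finset.mem_biUnion, Finset.mem_Icc]
      exact ⟨m, ⟨hm, hm'⟩, c, hc, hv'⟩
    refine (Finset.card_le_card hsub).trans (Finset.card_biUnion_le.trans ?_)
    refine Finset.sum_le_sum fun m _ => ?_
    exact Finset.card_biUnion_le_card_mul _ _ _ fun c _ => card_graphBall_le hG' _ _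
  refine (Finset.sum_le_sum hle).trans ?_
  rw [Finset.sum_comm, Finset.mul_sum]
  refine Finset.sum_le_sum fun m hm => ?_
  rw [Finset.mem_Icc] at hm
  rw [← Finset.sum_mul, ← mul_assoc]
  refine Nat.mul_le_mul_right _ (sum_card_cycleTuples_le hd hm.1 ?_)
  have := Nat.mul_le_mul_right d (Nat.mul_le_mul_left 2 (Nat.succ_le_succ hm.2))
  simp only [Nat.succ_eq_add_one] at this
  omega

end Switching

/-! ### The largest eigenvalue as a quadratic form -/

/-- The supremum of the real spectrum is the maximum of the Rayleigh quotient: the matrix `c - X`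
with `c` this supremum is positive semidefinite. -/
theorem dotProduct_mulVec_le_largestEigenvalue {n : ℕ} {X : Matrix (Fin n) (Fin n) ℝ}
    (hX : X.IsSymm) (x : Fin n → ℝ) :
    x ⬝ᵥ X *ᵥ x ≤ largestEigenvalue X * (x ⬝ᵥ x) := by
  have hX' : X.IsHermitian := by
    rw [Matrix.IsHermitian, Matrix.conjTranspose_eq_transpose_of_trivial]
    exact hX
  set c := largestEigenvalue X with hc
  have hA : (c • (1 : Matrix (Fin n) (Fin n) ℝ) - X).IsHermitian := by
    refine Matrix.IsHermitian.sub ?_ hX'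
    rw [Matrix.IsHermitian, Matrix.conjTranspose_smul, Matrix.conjTranspose_one, star_trivial]
  have hpos : (c • (1 : Matrix (Fin n) (Fin n) ℝ) - X).PosSemidef := by
    rw [hA.posSemidef_iff_eigenvalues_nonneg]
    intro i
    have h1 := hA.eigenvalues_mem_spectrum_real i
    generalize hA.eigenvalues i = e at h1 ⊢
    have h2 : c - e ∈ spectrum ℝ X := by
      have h3 : c • (1 : Matrix (Fin n) (Fin n) ℝ) = algebraMap ℝ _ c :=
        (Algebra.algebraMap_eq_smul_one c).symm
      rw [h3, ← spectrum.singleton_sub_eq, Set.mem_sub] at h1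
      obtain ⟨a, ha, b, hb, hab⟩ := h1
      rw [Set.mem_singleton_iff] at ha
      subst ha
      rw [← hab]
      simpa using hb
    have h4 : c - e ≤ c := by
      have hfin : (spectrum ℝ X).Finite := by
        rw [hX'.spectrum_real_eq_range_eigenvalues]
        exact Set.finite_range _
      exact le_csSup hfin.bddAbove h2
    simpa using h4
  have := hpos.dotProduct_mulVec_nonneg x
  rw [Matrix.sub_mulVec, Matrix.smul_mulVec, Matrix.one_mulVec, dotProduct_sub,
    dotProduct_smul, star_trivial, smul_eq_mul] at this
  linarith

theorem largestEigenvalue_le {n : ℕ} (hn : 0 < n) {X : Matrix (Fin n) (Fin n) ℝ}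
    (hX : X.IsSymm) {c : ℝ} (h : ∀ x : Fin n → ℝ, x ⬝ᵥ X *ᵥ x ≤ c * (x ⬝ᵥ x)) :
    largestEigenvalue X ≤ c := by
  have hX' : X.IsHermitian := by
    rw [Matrix.IsHermitian, Matrix.conjTranspose_eq_transpose_of_trivial]
    exact hX
  have : Nonempty (Fin n) := ⟨⟨0, hn⟩⟩
  rw [largestEigenvalue, hX'.spectrum_real_eq_range_eigenvalues]
  refine csSup_le (Set.range_nonempty _) ?_
  rintro _ ⟨i, rfl⟩
  have h1 := h (hX'.eigenvectorBasis i).ofLp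
  have h2 := hX'.mulVec_eigenvectorBasis i
  rw [h2, dotProduct_smul, smul_eq_mul] at h1
  refine le_of_mul_le_mul_right h1 ?_
  have h3 : (hX'.eigenvectorBasis i).ofLp ≠ 0 := by
    intro h0
    have := hX'.eigenvectorBasis.orthonormal.ne_zero i
    exact this (by ext j; simpa using congrFun h0 j)
  exact lt_of_le_of_ne (by
    rw [dotProduct]
    exact Finset.sum_nonneg fun j _ => mul_self_nonneg _)
      fun h0 => h3 (dotProduct_self_eq_zero.1 h0.symm)

theorem weightedMatrix_isSymm {n : ℕ} (A : SimpleGraph (Fin n)) {W : Matrix (Fin n) (Fin n) ℝ}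
    (hW : W.IsSymm) : (weightedMatrix A W).IsSymm := by
  classical
  ext i j
  simp only [weightedMatrix, Matrix.transpose_apply, Matrix.hadamard_apply,
    SimpleGraph.adjMatrix_apply, A.adj_comm j i]
  rw [← hW.apply i j]

open Classical in
theorem dotProduct_weightedMatrix {n : ℕ} (A : SimpleGraph (Fin n)) (W : Matrix (Fin n) (Fin n) ℝ)
    (x : Fin n → ℝ) : x ⬝ᵥ weightedMatrix A W *ᵥ x =
      ∑ i, ∑ j, if A.Adj i j then W i j * (x i * x j) else 0 := by
  simp only [dotProduct, Matrix.mulVec, Finset.mul_sum, weightedMatrix, Matrix.hadamard_apply,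
    SimpleGraph.adjMatrix_apply]
  refine Finset.sum_congr rfl fun i _ => Finset.sum_congr rfl fun j _ => ?_
  split_ifs
  · ring
  · ring

/-! ### Weighted trees and the largest eigenvalue -/

section Deterministic

variable {d : ℕ}

/-- The words of length at most `k`. -/
noncomputable def treeBall (d k : ℕ) : Finset (TreeVertex d) :=
  Set.Finite.toFinset (s := {s : TreeVertex d | s.1.length ≤ k})
    ((List.finite_length_le (Fin d) k).preimage Subtype.val_injective.injOn)

theorem mem_treeBall {k : ℕ} {s : TreeVertex d} : s ∈ treeBall d k ↔ s.1.length ≤ k := by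
  simp [treeBall]

open Classical in
/-- `∑ w s t`, over the ordered pairs `(s, t)` of adjacent vertices of the tree in `B`; every
undirected edge contributes twice. -/
noncomputable def treeSum (B : Finset (TreeVertex d)) (w : TreeVertex d → TreeVertex d → ℝ) : ℝ :=
  ∑ s ∈ B, ∑ t ∈ B, if (regularTree d).Adj s t then w s t else 0

/-- Every weighted finite piece of the tree whose edge weights satisfy `∑ w ^ α ≤ 1` has largest
eigenvalue at most `H` (in homogeneous form). -/
def TreeUpperBound (d : ℕ) (α H : ℝ) : Prop :=
  ∀ (B : Finset (TreeVertex d)) (w : TreeVertex d → TreeVertex d → ℝ) (x : TreeVertex d → ℝ),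
    (∀ s t, 0 ≤ w s t) → (∀ s t, w s t = w t s) → (∀ s, 0 ≤ x s) →
    treeSum B (fun s t => w s t * (x s * x t)) ≤
      H * (treeSum B (fun s t => w s t ^ α) / 2) ^ (1 / α) * ∑ s ∈ B, x s ^ 2

/-- The value `H` is approached by the largest eigenvalues of weighted finite pieces of the tree
whose edge weights satisfy `∑ w ^ α < 1`. -/
def TreeLowerBound (d : ℕ) (α H : ℝ) : Prop :=
  ∀ c, 0 ≤ c → c < H → ∃ (B : Finset (TreeVertex d)) (w : TreeVertex d → TreeVertex d → ℝ)
    (x : TreeVertex d → ℝ), (∀ s t, 0 ≤ w s t) ∧ (∀ s t, w s t = w t s) ∧ (∀ s, 0 ≤ x s) ∧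
    ∑ s ∈ B, x s ^ 2 ≤ 1 ∧ treeSum B (fun s t => w s t ^ α) / 2 < 1 ∧
    c < treeSum B (fun s t => w s t * (x s * x t))

theorem IsCovering.adj_iff_of_injOn {V : Type*} {G : SimpleGraph V} {φ : TreeVertex d → V}
    (hφ : IsCovering G φ) {R : ℕ} (hinj : Set.InjOn φ {s | s.1.length ≤ R + 1})
    {s t : TreeVertex d} (hs : s.1.length ≤ R) (ht : t.1.length ≤ R) :
    G.Adj (φ s) (φ t) ↔ (regularTree d).Adj s t := by
  refine ⟨fun h => ?_, fun h => hφ.adj h⟩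
  obtain ⟨t', h', ht'⟩ := hφ.surj h
  have h1 := length_le_of_adj h'
  have : t' = t := hinj (show t'.1.length ≤ R + 1 by omega) (show t.1.length ≤ R + 1 by omega) ht'
  rwa [← this]

open Classical in
/-- `∑ |W i j| ^ α` over the ordered pairs of adjacent vertices of `G` in the set `S`. -/
noncomputable def graphPowerSum {n : ℕ} (G : SimpleGraph (Fin n)) (W : Matrix (Fin n) (Fin n) ℝ)
    (α : ℝ) (S : Finset (Fin n)) : ℝ :=
  ∑ i ∈ S, ∑ j ∈ S, if G.Adj i j then |W i j| ^ α else 0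

open Classical in
theorem graphPowerSum_mono {n : ℕ} (G : SimpleGraph (Fin n)) (W : Matrix (Fin n) (Fin n) ℝ)
    (α : ℝ) {S T : Finset (Fin n)} (h : S ⊆ T) : graphPowerSum G W α S ≤ graphPowerSum G W α T := by
  have h0 : ∀ i j, 0 ≤ if G.Adj i j then |W i j| ^ α else 0 := by
    intro i j
    split_ifs <;> positivity
  exact (Finset.sum_le_sum fun i _ =>
    Finset.sum_le_sum_of_subset_of_nonneg h fun j _ _ => h0 i j).trans
    (Finset.sum_le_sum_of_subset_of_nonneg h fun i _ _ => Finset.sum_nonneg fun j _ => h0 i j)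

/-- The graph of the edges of `G` with weight larger than `τ` in modulus. -/
def heavyGraph {n : ℕ} (G : SimpleGraph (Fin n)) (W : Matrix (Fin n) (Fin n) ℝ) (hW : W.IsSymm)
    (τ : ℝ) : SimpleGraph (Fin n) where
  Adj i j := G.Adj i j ∧ τ < |W i j|
  symm := ⟨fun i j h => ⟨h.1.symm, by rw [hW.apply]; exact h.2⟩⟩
  loopless := ⟨fun i h => G.loopless.irrefl i h.1⟩

/-- A component of the heavy graph cannot leave the ball of radius `K`: a path of `K` heavy edges
inside the ball would exceed the bound on the sum of the powers of the weights. -/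
theorem mem_graphBall_of_heavyGraph_reachable {n : ℕ} {G : SimpleGraph (Fin n)}
    {W : Matrix (Fin n) (Fin n) ℝ} (hW : W.IsSymm) {α τ S : ℝ} {K : ℕ} (hα : 0 < α) (hτ : 0 ≤ τ)
    {v : Fin n} (hsum : graphPowerSum G W α (graphBall G v K) ≤ 2 * S) (hK : 2 * S < K * τ ^ α)
    {w : Fin n} (h : (heavyGraph G W hW τ).Reachable v w) : w ∈ graphBall G v K := by
  classical
  obtain ⟨p, hp⟩ := h.exists_isPath
  let f : heavyGraph G W hW τ →g G := ⟨id, fun h => h.1⟩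
  have hmem : ∀ i ≤ p.length, p.getVert i ∈ graphBall G v i := by
    intro i hi
    obtain ⟨q, hq⟩ := exists_walk_getVert p (Nat.zero_le i) hi
    refine mem_graphBall.2 ⟨((q.copy p.getVert_zero rfl).map f), ?_⟩
    simp [hq]
  by_cases hlen : p.length ≤ K
  · have := hmem p.length le_rfl
    rw [p.getVert_length] at this
    exact graphBall_mono hlen this
  exfalso
  push Not at hlen
  set B := graphBall G v K with hB
  let F : Fin n × Fin n → ℝ := fun q => if G.Adj q.1 q.2 then |W q.1 q.2| ^ α else 0
  let g : ℕ → Fin n × Fin n := fun i => (p.getVert i, p.getVert (i + 1))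
  have hginj : Set.InjOn g (Finset.range K) := by
    intro i hi j hj hij
    simp only [Finset.coe_range, Set.mem_Iio] at hi hj
    have h1 : p.getVert i = p.getVert j := congrArg Prod.fst hij
    exact hp.getVert_injOn (show i ≤ p.length by omega) (show j ≤ p.length by omega) h1
  have h1 : ∑ q ∈ B ×ˢ B, F q = graphPowerSum G W α B := by
    rw [Finset.sum_product]
    rfl
  have h2 : ∑ i ∈ Finset.range K, F (g i) ≤ ∑ q ∈ B ×ˢ B, F q := by
    rw [← Finset.sum_image (f := F) hginj]
    refine Finset.sum_le_sum_of_subset_of_nonneg ?_ ?_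
    · intro q hq
      obtain ⟨i, hi, rfl⟩ := Finset.mem_image.1 hq
      rw [Finset.mem_range] at hi
      exact Finset.mem_product.2 ⟨graphBall_mono (by omega) (hmem i (by omega)),
        graphBall_mono (by omega) (hmem (i + 1) (by omega))⟩
    · intro q _ _
      simp only [F]
      split_ifs <;> positivity
  have h3 : (K : ℝ) * τ ^ α ≤ ∑ i ∈ Finset.range K, F (g i) := by
    have : ∑ _i ∈ Finset.range K, τ ^ α = K * τ ^ α := by simp
    rw [← this]
    refine Finset.sum_le_sum fun i hi => ?_
    rw [Finset.mem_range] at hi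
    have hadj : (heavyGraph G W hW τ).Adj (p.getVert i) (p.getVert (i + 1)) :=
      p.adj_getVert_succ (by omega)
    simp only [F, g, if_pos hadj.1]
    exact Real.rpow_le_rpow hτ hadj.2.le hα.le
  linarith

open Classical in
theorem sum_sum_adj_mul_le {n : ℕ} {G : SimpleGraph (Fin n)}
    (hG : ∀ v, (G.neighborSet v).ncard = d) (x : Fin n → ℝ) :
    ∑ i, ∑ j, (if G.Adj i j then |x i| * |x j| else 0) ≤ d * ∑ i, x i ^ 2 := by
  have h1 : ∀ i, ∑ j, (if G.Adj i j then x i ^ 2 else 0) = d * x i ^ 2 := by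
    intro i
    rw [← Finset.sum_filter, Finset.sum_const, card_neighbor_filter hG, nsmul_eq_mul]
  have h2 : ∑ i, ∑ j, (if G.Adj i j then x i ^ 2 else 0) = d * ∑ i, x i ^ 2 := by
    rw [Finset.mul_sum]
    exact Finset.sum_congr rfl fun i _ => h1 i
  have h3 : ∑ i, ∑ j, (if G.Adj i j then x j ^ 2 else 0) = d * ∑ i, x i ^ 2 := by
    rw [← h2, Finset.sum_comm]
    simp only [G.adj_comm]
  have h4 : ∑ i, ∑ j, (if G.Adj i j then |x i| * |x j| else 0) ≤
      ∑ i, ∑ j, ((if G.Adj i j then x i ^ 2 else 0) + (if G.Adj i j then x j ^ 2 else 0)) / 2 := by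
    refine Finset.sum_le_sum fun i _ => Finset.sum_le_sum fun j _ => ?_
    split_ifs
    · nlinarith [sq_nonneg (|x i| - |x j|), sq_abs (x i), sq_abs (x j)]
    · simp
  refine h4.trans (le_of_eq ?_)
  simp only [← Finset.sum_div, Finset.sum_add_distrib, h2, h3]
  ring

open Classical in
/-- The contribution of a connected component of the heavy graph to the quadratic form. -/
theorem sum_component_le {n : ℕ} {G : SimpleGraph (Fin n)}
    {W : Matrix (Fin n) (Fin n) ℝ} (hW : W.IsSymm) {α τ S H : ℝ} {K : ℕ} (hα : 0 < α)
    (hH : 0 ≤ H) (hτ : 0 ≤ τ) (hS : 0 ≤ S) (hbound : TreeUpperBound d α H)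
    (hsum : ∀ v, graphPowerSum G W α (graphBall G v K) ≤ 2 * S) (hK : 2 * S < K * τ ^ α)
    (hbad : ∀ v, ¬ IsTreeLike d G v (K + 1) → ∀ j, G.Adj v j → |W v j| ≤ τ) (x : Fin n → ℝ)
    (C : Finset (Fin n)) (v : Fin n)
    (hC : ∀ i, i ∈ C ↔ (heavyGraph G W hW τ).Reachable v i) :
    ∑ i ∈ C, ∑ j ∈ C, (if (heavyGraph G W hW τ).Adj i j then |W i j| * (|x i| * |x j|) else 0) ≤
      H * S ^ (1 / α) * ∑ i ∈ C, x i ^ 2 := by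
  have hCball : C ⊆ graphBall G v K := fun i hi =>
    mem_graphBall_of_heavyGraph_reachable hW hα hτ (hsum v) hK ((hC i).1 hi)
  -- If `v` is tree-like, the component is the injective image of a finite set `B` of words.
  by_cases htree : IsTreeLike d G v (K + 1)
  · obtain ⟨φ, hφ, rfl, hinj⟩ := htree
    let B : Finset (TreeVertex d) := (treeBall d K).filter fun s => φ s ∈ C
    have hBlen : ∀ s ∈ B, s.1.length ≤ K := fun s hs => mem_treeBall.1 (Finset.mem_filter.1 hs).1
    have hBinj : Set.InjOn φ B := hinj.mono fun s hs => (hBlen s hs).trans (Nat.le_succ K)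
    have hBC : B.image φ = C := by
      ext i
      rw [Finset.mem_image]
      constructor
      · rintro ⟨s, hs, rfl⟩
        exact (Finset.mem_filter.1 hs).2
      · intro hi
        obtain ⟨t, ht, rfl⟩ := hφ.exists_of_mem_graphBall (hCball hi)
        exact ⟨t, Finset.mem_filter.2 ⟨mem_treeBall.2 ht, hi⟩, rfl⟩
    have hsumC : ∀ f : Fin n → ℝ, ∑ i ∈ C, f i = ∑ s ∈ B, f (φ s) := by
      intro f
      rw [← hBC, Finset.sum_image hBinj]
    have hadj : ∀ s ∈ B, ∀ t ∈ B, (G.Adj (φ s) (φ t) ↔ (regularTree d).Adj s t) :=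
      fun s hs t ht => hφ.adj_iff_of_injOn hinj (hBlen s hs) (hBlen t ht)
    have h1 : ∑ i ∈ C, ∑ j ∈ C,
        (if (heavyGraph G W hW τ).Adj i j then |W i j| * (|x i| * |x j|) else 0) ≤
        treeSum B (fun s t => |W (φ s) (φ t)| * (|x (φ s)| * |x (φ t)|)) := by
      simp only [hsumC, treeSum]
      refine Finset.sum_le_sum fun s hs => Finset.sum_le_sum fun t ht => ?_
      split_ifs with h h'
      · rfl
      · exact absurd ((hadj s hs t ht).1 h.1) h'
      · positivity
      · rfl
    have h2 : treeSum B (fun s t => |W (φ s) (φ t)| ^ α) = graphPowerSum G W α C := by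
      simp only [graphPowerSum, hsumC, treeSum]
      refine Finset.sum_congr rfl fun s hs => Finset.sum_congr rfl fun t ht => ?_
      simp only [hadj s hs t ht]
    have h3 : graphPowerSum G W α C ≤ 2 * S := (graphPowerSum_mono G W α hCball).trans (hsum _)
    have h4 := hbound B (fun s t => |W (φ s) (φ t)|) (fun s => |x (φ s)|)
      (fun _ _ => abs_nonneg _) (fun s t => by rw [hW.apply]) (fun _ => abs_nonneg _)
    refine h1.trans (h4.trans ?_)
    rw [h2, hsumC]
    simp only [sq_abs]
    have h0 : 0 ≤ graphPowerSum G W α C := by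
      rw [← h2]
      exact Finset.sum_nonneg fun s _ => Finset.sum_nonneg fun t _ => by split_ifs <;> positivity
    have : (graphPowerSum G W α C / 2) ^ (1 / α) ≤ S ^ (1 / α) :=
      Real.rpow_le_rpow (by positivity) (by linarith) (by positivity)
    gcongr
  -- Otherwise no edge at `v` is heavy, and the component is a single vertex.
  · have hCv : ∀ i ∈ C, i = v := by
      intro i hi
      obtain ⟨p⟩ := (hC i).1 hi
      cases p with
      | nil => rfl
      | cons h p => exact absurd h.2 (not_lt.2 (hbad v htree _ h.1))
    have : ∑ i ∈ C, ∑ j ∈ C,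
        (if (heavyGraph G W hW τ).Adj i j then |W i j| * (|x i| * |x j|) else 0) = 0 := by
      refine Finset.sum_eq_zero fun i hi => Finset.sum_eq_zero fun j hj => ?_
      rw [hCv i hi, hCv j hj, if_neg]
      exact (heavyGraph G W hW τ).loopless.irrefl v
    rw [this]
    have := Finset.sum_nonneg fun i (_ : i ∈ C) => sq_nonneg (x i)
    positivity

/-- **Deterministic upper bound.** The light edges contribute at most `d τ`. The heavy edges form
components which lie inside tree-like balls, so that the bound for weighted trees applies. -/
theorem largestEigenvalue_weightedMatrix_le {n : ℕ} (hn : 0 < n) {G : SimpleGraph (Fin n)}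
    (hG : ∀ v, (G.neighborSet v).ncard = d)
    {W : Matrix (Fin n) (Fin n) ℝ} (hW : W.IsSymm) {α τ S H : ℝ} {K : ℕ} (hα : 0 < α)
    (hH : 0 ≤ H) (hτ : 0 ≤ τ) (hS : 0 ≤ S) (hbound : TreeUpperBound d α H)
    (hsum : ∀ v, graphPowerSum G W α (graphBall G v K) ≤ 2 * S) (hK : 2 * S < K * τ ^ α)
    (hbad : ∀ v, ¬ IsTreeLike d G v (K + 1) → ∀ j, G.Adj v j → |W v j| ≤ τ) :
    largestEigenvalue (weightedMatrix G W) ≤ d * τ + H * S ^ (1 / α) := by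
  classical
  refine largestEigenvalue_le hn (weightedMatrix_isSymm G hW) fun x => ?_
  rw [dotProduct_weightedMatrix]
  have hxx : x ⬝ᵥ x = ∑ i, x i ^ 2 := by
    rw [dotProduct]
    exact Finset.sum_congr rfl fun i _ => (sq (x i)).symm
  rw [hxx]
  set D := heavyGraph G W hW τ with hD
  let f : Fin n → Fin n → ℝ := fun i j => if D.Adj i j then |W i j| * (|x i| * |x j|) else 0
  have h1 : ∑ i, ∑ j, (if G.Adj i j then W i j * (x i * x j) else 0) ≤
      ∑ i, ∑ j, (τ * (if G.Adj i j then |x i| * |x j| else 0) + f i j) := by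
    refine Finset.sum_le_sum fun i _ => Finset.sum_le_sum fun j _ => ?_
    by_cases h : G.Adj i j
    · have h0 : 0 ≤ |x i| * |x j| := by positivity
      have hle : W i j * (x i * x j) ≤ |W i j| * (|x i| * |x j|) := by
        rw [← abs_mul, ← abs_mul]
        exact le_abs_self _
      by_cases hD' : D.Adj i j
      · simp only [f, if_pos h, if_pos hD']
        nlinarith
      · have hle' : |W i j| ≤ τ := not_lt.1 fun hlt => hD' ⟨h, hlt⟩
        simp only [f, if_pos h, if_neg hD']
        nlinarith
    · have hD' : ¬ D.Adj i j := fun h' => h h'.1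
      simp [f, h, hD']
  have h2 : ∑ i, ∑ j, f i j ≤ H * S ^ (1 / α) * ∑ i, x i ^ 2 := by
    let comp : Fin n → D.ConnectedComponent := D.connectedComponentMk
    have hfib : ∀ g : Fin n → ℝ, ∑ i, g i =
        ∑ c ∈ Finset.univ.image comp, ∑ i with comp i = c, g i := fun g =>
      (Finset.sum_fiberwise_of_maps_to (fun i _ => Finset.mem_image_of_mem _ (Finset.mem_univ i))
        g).symm
    rw [hfib, hfib fun i => x i ^ 2, Finset.mul_sum]
    refine Finset.sum_le_sum fun c hc => ?_
    obtain ⟨v, -, rfl⟩ := Finset.mem_image.1 hc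
    have hinner : ∀ i ∈ (Finset.univ.filter fun i => comp i = comp v), ∑ j, f i j =
        ∑ j with comp j = comp v, f i j := by
      intro i hi
      rw [Finset.mem_filter_univ] at hi
      refine (Finset.sum_filter_of_ne fun j _ hj => ?_).symm
      have : D.Adj i j := by
        by_contra h
        exact hj (if_neg h)
      rw [← hi]
      exact SimpleGraph.ConnectedComponent.sound this.symm.reachable
    rw [Finset.sum_congr rfl hinner]
    refine sum_component_le hW hα hH hτ hS hbound hsum hK hbad x _ v fun i => ?_
    rw [Finset.mem_filter_univ, SimpleGraph.reachable_comm]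
    exact SimpleGraph.ConnectedComponent.eq
  have h3 := sum_sum_adj_mul_le hG x
  refine h1.trans ?_
  simp only [Finset.sum_add_distrib, ← Finset.mul_sum]
  nlinarith

/-- **Deterministic lower bound.** A test vector on the tree is transported to a tree-like ball on
which the weights are at least the prescribed ones. -/
theorem le_largestEigenvalue_weightedMatrix {n : ℕ} {G : SimpleGraph (Fin n)}
    {W : Matrix (Fin n) (Fin n) ℝ} (hW : W.IsSymm) {φ : TreeVertex d → Fin n}
    (hφ : IsCovering G φ) {R : ℕ} (hinj : Set.InjOn φ {s | s.1.length ≤ R + 1})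
    {B : Finset (TreeVertex d)} (hB : ∀ s ∈ B, s.1.length ≤ R) {w : TreeVertex d → TreeVertex d → ℝ}
    {x : TreeVertex d → ℝ} {c L : ℝ} (hx : ∀ s, 0 ≤ x s) (hx1 : ∑ s ∈ B, x s ^ 2 ≤ 1)
    (hc : 0 ≤ c) (hcx : c < treeSum B (fun s t => w s t * (x s * x t))) (hL : 0 < L)
    (hWw : ∀ s ∈ B, ∀ t ∈ B, (regularTree d).Adj s t → w s t * L ≤ W (φ s) (φ t)) :
    c * L ≤ largestEigenvalue (weightedMatrix G W) := by
  classical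
  let y : Fin n → ℝ := fun i => ∑ s ∈ B, if φ s = i then x s else 0
  have hBinj : Set.InjOn φ B := hinj.mono fun s hs => (hB s hs).trans (Nat.le_succ R)
  have hy : ∀ s ∈ B, y (φ s) = x s := by
    intro s hs
    simp only [y]
    rw [Finset.sum_eq_single_of_mem s hs, if_pos rfl]
    intro t ht hne
    exact if_neg fun h => hne (hBinj ht hs h)
  have hy0 : ∀ i, i ∉ B.image φ → y i = 0 := by
    intro i hi
    refine Finset.sum_eq_zero fun s hs => if_neg fun h => hi ?_
    exact h ▸ Finset.mem_image_of_mem φ hs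
  have hsum : ∀ g : Fin n → ℝ, (∀ i, y i = 0 → g i = 0) → ∑ i, g i = ∑ s ∈ B, g (φ s) := by
    intro g hg
    rw [← Finset.sum_image (f := g) hBinj]
    exact (Finset.sum_subset (Finset.subset_univ _) fun i _ hi => hg i (hy0 i hi)).symm
  have h1 : y ⬝ᵥ y = ∑ s ∈ B, x s ^ 2 := by
    rw [dotProduct, hsum _ fun i hi => by rw [hi, zero_mul]]
    exact Finset.sum_congr rfl fun s hs => by rw [hy s hs, sq]
  have h2 : y ⬝ᵥ weightedMatrix G W *ᵥ y =
      treeSum B (fun s t => W (φ s) (φ t) * (x s * x t)) := by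
    rw [dotProduct_weightedMatrix, treeSum, hsum _ fun i hi => by simp [hi]]
    refine Finset.sum_congr rfl fun s hs => ?_
    rw [hsum _ fun i hi => by simp [hi]]
    refine Finset.sum_congr rfl fun t ht => ?_
    rw [hy s hs, hy t ht]
    simp only [hφ.adj_iff_of_injOn hinj (hB s hs) (hB t ht)]
  have h3 : c * L < treeSum B (fun s t => W (φ s) (φ t) * (x s * x t)) := by
    have h4 : treeSum B (fun s t => w s t * (x s * x t)) * L ≤
        treeSum B (fun s t => W (φ s) (φ t) * (x s * x t)) := by
      simp only [treeSum, Finset.sum_mul]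
      refine Finset.sum_le_sum fun s hs => Finset.sum_le_sum fun t ht => ?_
      split_ifs with h
      · have := mul_le_mul_of_nonneg_right (hWw s hs t ht h) (mul_nonneg (hx s) (hx t))
        linarith
      · simp
    have := mul_lt_mul_of_pos_right hcx hL
    linarith
  have h5 := dotProduct_mulVec_le_largestEigenvalue (weightedMatrix_isSymm G hW) y
  rw [h1, h2] at h5
  have h6 : 0 ≤ ∑ s ∈ B, x s ^ 2 := Finset.sum_nonneg fun s _ => sq_nonneg _
  have h7 : 0 < largestEigenvalue (weightedMatrix G W) := by
    have : 0 ≤ c * L := by positivity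
    by_contra h
    push Not at h
    nlinarith [mul_nonneg (neg_nonneg.2 h) h6]
  nlinarith

end Deterministic

/-! ### Energies on the tree as sums over ordered pairs -/

section TreeEnergy

variable {d : ℕ}

open Classical in
/-- Every edge of a graph is the image of exactly two ordered pairs. -/
theorem two_mul_tsum_edgeSet {V : Type*} (G : SimpleGraph V) (g : Sym2 V → ℝ≥0∞) :
    2 * ∑' e : G.edgeSet, g e = ∑' p : V × V, if G.Adj p.1 p.2 then g s(p.1, p.2) else 0 := by
  have h1 : (∑' p : V × V, if G.Adj p.1 p.2 then g s(p.1, p.2) else 0) =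
      ∑' p : {p : V × V | G.Adj p.1 p.2}, g s(p.1.1, p.1.2) := by
    rw [tsum_subtype {p : V × V | G.Adj p.1 p.2} fun p => g s(p.1, p.2)]
    rfl
  let f : {p : V × V | G.Adj p.1 p.2} → G.edgeSet := fun p => ⟨s(p.1.1, p.1.2), p.2⟩
  rw [h1, ← (Equiv.sigmaFiberEquiv f).tsum_eq, ENNReal.tsum_sigma', ← ENNReal.tsum_mul_left]
  refine tsum_congr fun e => ?_
  have h2 : ∀ p : {p // f p = e}, g s(((Equiv.sigmaFiberEquiv f) ⟨e, p⟩).1.1,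
      ((Equiv.sigmaFiberEquiv f) ⟨e, p⟩).1.2) = g e := by
    rintro ⟨p, rfl⟩
    rfl
  rw [tsum_congr h2, ENNReal.tsum_const]
  congr 1
  obtain ⟨e, he⟩ := e
  induction e using Sym2.ind with
  | h a b =>
    have hab : G.Adj a b := he
    have : {p // f p = ⟨s(a, b), he⟩} ≃ ({(a, b), (b, a)} : Set (V × V)) :=
      { toFun := fun p => ⟨p.1.1, by
          have := congrArg Subtype.val p.2
          simp only [f, Sym2.eq_iff] at this
          simp only [Set.mem_insert_iff, Set.mem_singleton_iff, Prod.ext_iff]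
          tauto⟩
        invFun := fun p => ⟨⟨p.1, by
          rcases p.2 with h | h <;> rw [h]
          · exact hab
          · exact hab.symm⟩, by
          apply Subtype.ext
          simp only [f]
          rcases p.2 with h | h <;> rw [h]
          exact Sym2.eq_swap⟩
        left_inv := fun p => rfl
        right_inv := fun p => rfl }
    rw [ENat.card_congr this]
    have hne : (a, b) ≠ (b, a) := fun h => hab.ne (congrArg Prod.fst h)
    have : ENat.card ({(a, b), (b, a)} : Set (V × V)) = 2 := by
      rw [← Set.encard, Set.encard_pair hne]
    rw [this]
    rfl

theorem treeSum_nonneg {B : Finset (TreeVertex d)} {w : TreeVertex d → TreeVertex d → ℝ}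
    (hw : ∀ s t, 0 ≤ w s t) : 0 ≤ treeSum B w :=
  Finset.sum_nonneg fun s _ => Finset.sum_nonneg fun t _ => by
    split_ifs
    · exact hw s t
    · rfl

theorem treeSum_le_treeSum {B : Finset (TreeVertex d)} {w w' : TreeVertex d → TreeVertex d → ℝ}
    (h : ∀ s ∈ B, ∀ t ∈ B, (regularTree d).Adj s t → w s t ≤ w' s t) :
    treeSum B w ≤ treeSum B w' :=
  Finset.sum_le_sum fun s hs => Finset.sum_le_sum fun t ht => by
    split_ifs with h'
    · exact h s hs t ht h'
    · rfl

theorem treeSum_congr {B : Finset (TreeVertex d)} {w w' : TreeVertex d → TreeVertex d → ℝ}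
    (h : ∀ s ∈ B, ∀ t ∈ B, (regularTree d).Adj s t → w s t = w' s t) :
    treeSum B w = treeSum B w' :=
  le_antisymm (treeSum_le_treeSum fun s hs t ht h' => (h s hs t ht h').le)
    (treeSum_le_treeSum fun s hs t ht h' => (h s hs t ht h').ge)

theorem treeSum_mul_left (B : Finset (TreeVertex d)) (w : TreeVertex d → TreeVertex d → ℝ)
    (c : ℝ) : treeSum B (fun s t => c * w s t) = c * treeSum B w := by
  simp only [treeSum, Finset.mul_sum, mul_ite, mul_zero]

open Classical in
theorem treeSum_eq_sum_filter (B : Finset (TreeVertex d))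
    (w : TreeVertex d → TreeVertex d → ℝ) :
    treeSum B w = ∑ p ∈ (B ×ˢ B).filter fun p => (regularTree d).Adj p.1 p.2, w p.1 p.2 := by
  rw [Finset.sum_filter, Finset.sum_product]
  rfl

/-- The energy of `u` is half the supremum of its finite sums over ordered pairs. -/
theorem two_mul_treeEnergy (γ : ℝ) (u : TreeVertex d → ℝ) :
    2 * treeEnergy d γ u =
      ⨆ B : Finset (TreeVertex d), ENNReal.ofReal (treeSum B fun s t => |u s * u t| ^ γ) := by
  classical
  have h1 : 2 * treeEnergy d γ u = ∑' p : TreeVertex d × TreeVertex d,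
      if (regularTree d).Adj p.1 p.2 then ENNReal.ofReal (|u p.1 * u p.2| ^ γ) else 0 := by
    rw [treeEnergy, two_mul_tsum_edgeSet (regularTree d) fun e =>
      ENNReal.ofReal (|(Sym2.map u e).mul| ^ γ)]
    simp only [Sym2.map_mk, Sym2.mul_mk]
  have h2 : ∀ B : Finset (TreeVertex d), ENNReal.ofReal (treeSum B fun s t => |u s * u t| ^ γ) =
      ∑ p ∈ B ×ˢ B, if (regularTree d).Adj p.1 p.2 then
        ENNReal.ofReal (|u p.1 * u p.2| ^ γ) else 0 := by
    intro B
    rw [treeSum_eq_sum_filter, ENNReal.ofReal_sum_of_nonneg fun p _ => by positivity,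
      Finset.sum_filter]
  rw [h1]
  apply le_antisymm
  · rw [ENNReal.tsum_eq_iSup_sum]
    refine iSup_le fun P => ?_
    refine le_iSup_of_le (P.image Prod.fst ∪ P.image Prod.snd) ?_
    rw [h2]
    refine Finset.sum_le_sum_of_subset fun p hp => ?_
    rw [Finset.mem_product]
    exact ⟨Finset.mem_union_left _ (Finset.mem_image_of_mem _ hp),
      Finset.mem_union_right _ (Finset.mem_image_of_mem _ hp)⟩
  · refine iSup_le fun B => ?_
    rw [h2]
    exact ENNReal.sum_le_tsum _

theorem ofReal_treeSum_le (γ : ℝ) (u : TreeVertex d → ℝ) (B : Finset (TreeVertex d)) :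
    ENNReal.ofReal (treeSum B fun s t => |u s * u t| ^ γ) ≤ 2 * treeEnergy d γ u := by
  rw [two_mul_treeEnergy]
  exact le_iSup (fun B : Finset (TreeVertex d) =>
    ENNReal.ofReal (treeSum B fun s t => |u s * u t| ^ γ)) B

theorem treeEnergy_le_ofReal {γ : ℝ} {u : TreeVertex d → ℝ} {C : ℝ}
    (h : ∀ B : Finset (TreeVertex d), treeSum B (fun s t => |u s * u t| ^ γ) ≤ 2 * C) :
    treeEnergy d γ u ≤ ENNReal.ofReal C := by
  have h1 : 2 * treeEnergy d γ u ≤ 2 * ENNReal.ofReal C := by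
    rw [two_mul_treeEnergy]
    refine iSup_le fun B => (ENNReal.ofReal_le_ofReal (h B)).trans ?_
    rw [ENNReal.ofReal_mul (by norm_num)]
    simp
  exact (ENNReal.mul_le_mul_iff_right (by norm_num) (by norm_num)).1 h1

theorem even_length_iff_of_adj {s t : TreeVertex d} (h : (regularTree d).Adj s t) :
    Even s.1.length ↔ ¬ Even t.1.length := by
  rcases h with ⟨a, h⟩ | ⟨a, h⟩ <;> simp [h, Nat.even_add_one]

/-- The tree is bipartite, whence its edges carry at most a quarter of the squared total mass. -/
theorem treeSum_mul_le_sq (B : Finset (TreeVertex d)) {y : TreeVertex d → ℝ} (hy : ∀ s, 0 ≤ y s) :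
    treeSum B (fun s t => y s * y t) ≤ (∑ s ∈ B, y s) ^ 2 / 2 := by
  classical
  let e : TreeVertex d → ℝ := fun s => if Even s.1.length then y s else 0
  let o : TreeVertex d → ℝ := fun s => if Even s.1.length then 0 else y s
  have h1 : treeSum B (fun s t => y s * y t) ≤ ∑ s ∈ B, ∑ t ∈ B, (e s * o t + o s * e t) := by
    refine Finset.sum_le_sum fun s _ => Finset.sum_le_sum fun t _ => ?_
    split_ifs with h
    · have := even_length_iff_of_adj h
      by_cases hs : Even s.1.length
      · simp [e, o, hs, this.1 hs]
      · have ht : Even t.1.length := by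
          by_contra h'
          exact hs (this.2 h')
        simp [e, o, hs, ht]
    · have he : ∀ s, 0 ≤ e s := fun s => by simp only [e]; split_ifs <;> simp [hy]
      have ho : ∀ s, 0 ≤ o s := fun s => by simp only [o]; split_ifs <;> simp [hy]
      have := mul_nonneg (he s) (ho t)
      have := mul_nonneg (ho s) (he t)
      linarith
  have h2 : ∑ s ∈ B, ∑ t ∈ B, (e s * o t + o s * e t) = 2 * ((∑ s ∈ B, e s) * ∑ s ∈ B, o s) := by
    simp only [Finset.sum_add_distrib, ← Finset.mul_sum, ← Finset.sum_mul]
    ring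
  have h3 : ∑ s ∈ B, y s = ∑ s ∈ B, e s + ∑ s ∈ B, o s := by
    rw [← Finset.sum_add_distrib]
    refine Finset.sum_congr rfl fun s _ => ?_
    simp only [e, o]
    split_ifs <;> simp
  rw [h3]
  nlinarith [sq_nonneg (∑ s ∈ B, e s - ∑ s ∈ B, o s)]

theorem treeNbr_injective (s : TreeVertex d) : Function.Injective (treeNbr s) := by
  obtain ⟨l, hl⟩ := s
  intro a b h
  have h := congrArg Subtype.val h
  simp only [treeNbr] at h
  split_ifs at h with ha hb hb
  · exact Option.some.inj (ha.symm.trans hb)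
  · have := congrArg List.length h
    simp at this
  · have := congrArg List.length h
    simp at this
    omega
  · exact (List.cons.inj h).1

theorem length_treeNbr_lt_iff {s : TreeVertex d} {a : Fin d} :
    (treeNbr s a).1.length < s.1.length ↔ s.1.head? = some a := by
  obtain ⟨l, hl⟩ := s
  simp only [treeNbr]
  split_ifs with h
  · cases l with
    | nil => simp at h
    | cons b l => simpa using h
  · simpa using h

open Classical in
theorem sum_adj_eq_sum_filter_treeNbr (B : Finset (TreeVertex d)) (s : TreeVertex d)
    (g : TreeVertex d → ℝ) : (∑ t ∈ B, if (regularTree d).Adj s t then g t else 0) =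
      ∑ a with treeNbr s a ∈ B, g (treeNbr s a) := by
  rw [← Finset.sum_filter, ← Finset.sum_image (f := g) (treeNbr_injective s).injOn]
  refine Finset.sum_congr ?_ fun _ _ => rfl
  ext t
  simp only [Finset.mem_filter, Finset.mem_image, Finset.mem_univ, true_and,
    regularTree_adj_iff_exists_treeNbr]
  constructor
  · rintro ⟨h, a, rfl⟩
    exact ⟨a, h, rfl⟩
  · rintro ⟨a, h, rfl⟩
    exact ⟨h, a, rfl⟩

theorem sum_head_eq (s : TreeVertex d) (p q : ℝ) :
    ∑ a : Fin d, (if s.1.head? = some a then p else q) =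
      if s.1 = [] then d * q else p + (d - 1) * q := by
  obtain ⟨l, hl⟩ := s
  cases l with
  | nil => simp
  | cons b l =>
    have : ∀ a, (if (b :: l).head? = some a then p else q) = q + if b = a then p - q else 0 := by
      intro a
      simp only [List.head?_cons, Option.some.injEq]
      split_ifs <;> ring
    simp only [this, Finset.sum_add_distrib]
    simp
    ring

/-- The adjacency operator of the tree has norm at most `2 √(d - 1)`: on each edge the inequality
of arithmetic and geometric means is used with weight `√(d - 1)` at the child. -/
theorem treeSum_mul_le_sqrt (hd : 2 ≤ d) (B : Finset (TreeVertex d)) (x : TreeVertex d → ℝ) :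
    treeSum B (fun s t => x s * x t) ≤ 2 * √((d : ℝ) - 1) * ∑ s ∈ B, x s ^ 2 := by
  classical
  set r := √((d : ℝ) - 1) with hr
  have hd' : (2 : ℝ) ≤ d := by exact_mod_cast hd
  have hr2 : r ^ 2 = d - 1 := Real.sq_sqrt (by linarith)
  have hr0 : 0 < r := Real.sqrt_pos.2 (by linarith)
  -- `s` enters with weight `√(d - 1)` on the edge to its parent and with its inverse on the edges to
  -- its children; the weights at `s` add up to at most `2 √(d - 1)`, with equality off the root.
  let c : TreeVertex d → TreeVertex d → ℝ := fun s t =>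
    if t.1.length < s.1.length then r else r⁻¹
  have hc0 : ∀ s t, 0 ≤ c s t := fun s t => by
    simp only [c]
    split_ifs <;> positivity
  have h1 : treeSum B (fun s t => x s * x t) ≤
      treeSum B (fun s t => (c s t * x s ^ 2) / 2) + treeSum B (fun s t => (c t s * x t ^ 2) / 2) := by
    simp only [treeSum]
    rw [← Finset.sum_add_distrib]
    refine Finset.sum_le_sum fun s _ => ?_
    rw [← Finset.sum_add_distrib]
    refine Finset.sum_le_sum fun t _ => ?_
    split_ifs with h
    · have hcc : c s t * c t s = 1 := by
        rcases h with ⟨a, h⟩ | ⟨a, h⟩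
        · have h1 : ¬ t.1.length < s.1.length := by simp [h]
          have h2 : s.1.length < t.1.length := by simp [h]
          simp only [c, if_neg h1, if_pos h2]
          exact inv_mul_cancel₀ hr0.ne'
        · have h1 : t.1.length < s.1.length := by simp [h]
          have h2 : ¬ s.1.length < t.1.length := by simp [h]
          simp only [c, if_pos h1, if_neg h2]
          exact mul_inv_cancel₀ hr0.ne'
      have hs := Real.sq_sqrt (hc0 s t)
      have ht := Real.sq_sqrt (hc0 t s)
      have hst : √(c s t) * √(c t s) = 1 := by
        rw [← Real.sqrt_mul (hc0 s t), hcc, Real.sqrt_one]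
      have : x s * x t = (√(c s t) * x s) * (√(c t s) * x t) := by
        linear_combination (-(x s * x t)) * hst
      rw [this]
      nlinarith [sq_nonneg (√(c s t) * x s - √(c t s) * x t)]
    · simp
  have h2 : ∀ s, (∑ t ∈ B, if (regularTree d).Adj s t then (c s t * x s ^ 2) / 2 else 0) ≤
      r * x s ^ 2 := by
    intro s
    rw [sum_adj_eq_sum_filter_treeNbr]
    refine (Finset.sum_le_univ_sum_of_nonneg fun a => ?_).trans ?_
    · have := hc0 s (treeNbr s a)
      positivity
    · simp only [c, length_treeNbr_lt_iff]
      rw [← Finset.sum_div, ← Finset.sum_mul, sum_head_eq]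
      have h3 : (if s.1 = [] then (d : ℝ) * r⁻¹ else r + (d - 1) * r⁻¹) ≤ 2 * r := by
        have h4 : ((d : ℝ) - 1) * r⁻¹ = r := by
          rw [← hr2]
          field_simp
        split_ifs
        · have h5 : (d : ℝ) * r⁻¹ ≤ (2 * (d - 1)) * r⁻¹ := by
            gcongr
            linarith
          linarith
        · linarith
      nlinarith [sq_nonneg (x s)]
  have h3 : treeSum B (fun s t => (c s t * x s ^ 2) / 2) ≤ r * ∑ s ∈ B, x s ^ 2 := by
    rw [Finset.mul_sum]
    exact Finset.sum_le_sum fun s _ => h2 s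
  have h4 : treeSum B (fun s t => (c t s * x t ^ 2) / 2) ≤ r * ∑ s ∈ B, x s ^ 2 := by
    refine le_trans (le_of_eq ?_) h3
    rw [treeSum, Finset.sum_comm]
    simp only [(regularTree d).adj_comm, treeSum]
  linarith

open Classical in
theorem card_level_succ (k : ℕ) (hk : 1 ≤ k) :
    ((treeBall d (k + 1)).filter fun s => s.1.length = k + 1).card =
      ((treeBall d k).filter fun s => s.1.length = k).card * (d - 1) := by
  have h1 : ((treeBall d k).filter fun s => s.1.length = k).card * (d - 1) =
      (((treeBall d k).filter fun s => s.1.length = k).sigma fun s =>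
        Finset.univ.filter fun a : Fin d => s.1.head? ≠ some a).card := by
    rw [Finset.card_sigma, Finset.sum_const_nat]
    intro s hs
    obtain ⟨l, hl⟩ := s
    cases l with
    | nil =>
      simp at hs
      omega
    | cons b l =>
      have : (Finset.univ.filter fun a : Fin d => (b :: l).head? ≠ some a) =
          Finset.univ.erase b := by
        ext a
        simp [eq_comm]
      rw [this, Finset.card_erase_of_mem (Finset.mem_univ _)]
      simp
  rw [h1]
  symm
  refine Finset.card_bij (fun p _ => treeNbr p.1 p.2) ?_ ?_ ?_
  · rintro ⟨s, a⟩ h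
    simp only [Finset.mem_sigma, Finset.mem_filter, mem_treeBall, Finset.mem_univ, true_and] at h ⊢
    obtain ⟨⟨-, h1⟩, h2⟩ := h
    have : (treeNbr s a).1.length = k + 1 := by
      simp only [treeNbr, if_neg h2, List.length_cons, h1]
    exact ⟨this.le, this⟩
  · rintro ⟨s, a⟩ h ⟨t, b⟩ h' heq
    simp only [Finset.mem_sigma, Finset.mem_filter, Finset.mem_univ, true_and] at h h'
    have := congrArg Subtype.val heq
    simp only [treeNbr, if_neg h.2, if_neg h'.2, List.cons.injEq] at this
    obtain ⟨rfl, h1⟩ := this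
    have h2 : s = t := Subtype.ext h1
    subst h2
    rfl
  · rintro ⟨l, hl⟩ h
    simp only [Finset.mem_filter, mem_treeBall] at h
    cases l with
    | nil => simp at h
    | cons a l =>
      have hl' : l.IsChain (· ≠ ·) := hl.tail
      have hne : l.head? ≠ some a := by
        cases l with
        | nil => simp
        | cons b l => simpa [eq_comm] using (List.isChain_cons_cons.1 hl).1
      have hlen : l.length = k := by simpa using h.2
      refine ⟨⟨⟨l, hl'⟩, a⟩, ?_, ?_⟩
      · simp [mem_treeBall, hlen, hne]
      · apply Subtype.ext
        simp [treeNbr, hne]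

open Classical in
theorem card_level (k : ℕ) :
    ((treeBall d (k + 1)).filter fun s => s.1.length = k + 1).card = d * (d - 1) ^ k := by
  induction k with
  | zero =>
    have : ((treeBall d 1).filter fun s => s.1.length = 1) =
        Finset.univ.image fun a : Fin d => (⟨[a], List.isChain_singleton a⟩ : TreeVertex d) := by
      ext ⟨l, hl⟩
      simp only [Finset.mem_filter, mem_treeBall, Finset.mem_image, Finset.mem_univ, true_and,
        Subtype.mk.injEq]
      constructor
      · rintro ⟨-, h⟩
        obtain ⟨a, rfl⟩ := List.length_eq_one_iff.1 h
        exact ⟨a, rfl⟩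
      · rintro ⟨a, rfl⟩
        simp
    rw [zero_add, this, Finset.card_image_of_injective _ fun a b h => by simpa using h]
    simp
  | succ k ih => rw [card_level_succ _ (by omega), ih, pow_succ, mul_assoc]

open Classical in
theorem sum_treeBall_length (R : ℕ) (g : ℕ → ℝ) :
    ∑ s ∈ treeBall d R, g s.1.length =
      ∑ k ∈ Finset.range (R + 1), ((treeBall d k).filter fun s => s.1.length = k).card * g k := by
  rw [← Finset.sum_fiberwise_of_maps_to (s := treeBall d R) (t := Finset.range (R + 1))
    (g := fun s => s.1.length) fun s hs => by
      rw [Finset.mem_range]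
      have := mem_treeBall.1 hs
      omega]
  refine Finset.sum_congr rfl fun k hk => ?_
  rw [Finset.mem_range] at hk
  have : ((treeBall d R).filter fun s => s.1.length = k) =
      ((treeBall d k).filter fun s => s.1.length = k) := by
    ext s
    simp only [Finset.mem_filter, mem_treeBall]
    omega
  rw [this, Finset.sum_congr rfl fun s hs => by rw [(Finset.mem_filter.1 hs).2], Finset.sum_const,
    nsmul_eq_mul]

open Classical in
/-- The radial functions `(d - 1) ^ (- |s| / 2)`, cut off at radius `R`, are nearly optimal for the
norm of the adjacency operator: they are eigenfunctions inside the ball, and all spheres but the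
root carry the same mass. -/
theorem exists_treeSum_mul_ge (hd : 3 ≤ d) (R : ℕ) :
    ∃ x : TreeVertex d → ℝ, (∀ s, 0 ≤ x s) ∧ 0 < ∑ s ∈ treeBall d (R + 1), x s ^ 2 ∧
      2 * √((d : ℝ) - 1) * (R / (R + 2)) * ∑ s ∈ treeBall d (R + 1), x s ^ 2 ≤
        treeSum (treeBall d (R + 1)) (fun s t => x s * x t) := by
  set r := √((d : ℝ) - 1) with hr
  have hd' : (3 : ℝ) ≤ d := by exact_mod_cast hd
  have hr2 : r ^ 2 = d - 1 := Real.sq_sqrt (by linarith)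
  have hr0 : 0 < r := Real.sqrt_pos.2 (by linarith)
  let x : TreeVertex d → ℝ := fun s => r⁻¹ ^ s.1.length
  have hx0 : ∀ s, 0 ≤ x s := fun s => by positivity
  set D : ℝ := d / (d - 1) with hD
  have hD1 : 1 ≤ D := by
    rw [hD, le_div_iff₀ (by linarith)]
    linarith
  have hlevel : ∀ k : ℕ, (((treeBall d (k + 1)).filter fun s => s.1.length = k + 1).card : ℝ) *
      (r⁻¹ ^ (k + 1)) ^ 2 = D := by
    intro k
    rw [card_level, hD, ← pow_mul, mul_comm (k + 1) 2, pow_mul, inv_pow, hr2]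
    push_cast [Nat.cast_sub (show 1 ≤ d by omega)]
    have : (d : ℝ) - 1 ≠ 0 := by linarith
    rw [inv_pow, pow_succ ((d : ℝ) - 1)]
    field_simp
  have hzero : (((treeBall d 0).filter fun s => s.1.length = 0).card : ℝ) ≤ 1 := by
    have : ((treeBall d 0).filter fun s => s.1.length = 0).card ≤ 1 := by
      rw [Finset.card_le_one]
      rintro ⟨l, hl⟩ h ⟨m, hm⟩ h'
      simp [mem_treeBall] at h h'
      simp [h, h']
    exact_mod_cast this
  have hroot : treeRoot d ∈ treeBall d (R + 1) := mem_treeBall.2 (by simp [treeRoot])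
  -- Every sphere of positive radius carries mass `D`, and the eigenvalue equation holds on the spheres
  -- of radius between `1` and `R`.
  have hmass : ∑ s ∈ treeBall d (R + 1), x s ^ 2 ≤ (R + 2) * D := by
    rw [show ∑ s ∈ treeBall d (R + 1), x s ^ 2 = _ from
      sum_treeBall_length (R + 1) fun k => (r⁻¹ ^ k) ^ 2, Finset.sum_range_succ']
    simp only [hlevel, Finset.sum_const, Finset.card_range, nsmul_eq_mul, pow_zero, one_pow, mul_one]
    push_cast
    linarith
  have hinner : R * D ≤ ∑ s ∈ treeBall d (R + 1),
      if 1 ≤ s.1.length ∧ s.1.length ≤ R then x s ^ 2 else 0 := by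
    rw [show (∑ s ∈ treeBall d (R + 1), if 1 ≤ s.1.length ∧ s.1.length ≤ R then x s ^ 2 else 0) = _
      from sum_treeBall_length (R + 1) fun k => if 1 ≤ k ∧ k ≤ R then (r⁻¹ ^ k) ^ 2 else 0,
      Finset.sum_range_succ', Finset.sum_range_succ]
    have h1 : ∀ k ∈ Finset.range R,
        (((treeBall d (k + 1)).filter fun s => s.1.length = k + 1).card : ℝ) *
        (if 1 ≤ k + 1 ∧ k + 1 ≤ R then (r⁻¹ ^ (k + 1)) ^ 2 else 0) = D := by
      intro k hk
      rw [Finset.mem_range] at hk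
      rw [if_pos ⟨by omega, by omega⟩, hlevel]
    rw [Finset.sum_congr rfl h1]
    simp
  refine ⟨x, hx0, ?_, ?_⟩
  · refine Finset.sum_pos' (fun s _ => sq_nonneg _) ⟨_, hroot, ?_⟩
    positivity
  · have h1 : (∑ s ∈ treeBall d (R + 1), if 1 ≤ s.1.length ∧ s.1.length ≤ R then x s ^ 2 else 0) *
        (2 * r) ≤ treeSum (treeBall d (R + 1)) (fun s t => x s * x t) := by
      rw [Finset.sum_mul]
      refine Finset.sum_le_sum fun s hs => ?_
      split_ifs with h
      · rw [sum_adj_eq_sum_filter_treeNbr, Finset.filter_true_of_mem, ← Finset.mul_sum]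
        · have h2 : ∀ a, x (treeNbr s a) = if s.1.head? = some a then r * x s else r⁻¹ * x s := by
            intro a
            simp only [x, treeNbr]
            split_ifs with ha
            · obtain ⟨k, hk⟩ : ∃ k, s.1.length = k + 1 := ⟨s.1.length - 1, by omega⟩
              rw [List.length_tail, hk, pow_succ]
              simp only [add_tsub_cancel_right]
              field_simp
            · rw [List.length_cons, pow_succ, mul_comm]
          have hne : s.1 ≠ [] := by
            intro h0
            simp [h0] at h
          simp only [h2, sum_head_eq, if_neg hne]
          rw [← hr2]
          apply le_of_eq
          field_simp
          ring
        · intro a _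
          have h3 := length_le_of_adj (regularTree_adj_iff_exists_treeNbr.2 ⟨a, rfl⟩ :
            (regularTree d).Adj s (treeNbr s a))
          exact mem_treeBall.2 (by omega)
      · rw [zero_mul]
        refine Finset.sum_nonneg fun t _ => ?_
        split_ifs
        · exact mul_nonneg (hx0 s) (hx0 t)
        · rfl
    have h2 : (R : ℝ) / (R + 2) * ∑ s ∈ treeBall d (R + 1), x s ^ 2 ≤ R * D := by
      calc _ ≤ (R : ℝ) / (R + 2) * ((R + 2) * D) := by gcongr
        _ = R * D := by field_simp
    calc _ = 2 * r * ((R : ℝ) / (R + 2) * ∑ s ∈ treeBall d (R + 1), x s ^ 2) := by ring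
      _ ≤ 2 * r * (R * D) := by gcongr
      _ ≤ _ := by nlinarith

end TreeEnergy

/-! ### The variational constant -/

section Variational

variable {d : ℕ}

theorem ennreal_rpow_eq_mul_rpow_sub_one (x : ℝ≥0∞) {r : ℝ} (hr : 1 ≤ r) :
    x ^ r = x * x ^ (r - 1) := by
  have := ENNReal.rpow_add_of_nonneg (x := x) 1 (r - 1) zero_le_one (by linarith)
  rwa [ENNReal.rpow_one, add_sub_cancel] at this

/-- The `ℓ^{1/s}` norm increases with `s`. -/
theorem tsum_rpow_rpow_mono {ι : Type*} (a : ι → ℝ≥0∞) {s t : ℝ} (hs : 0 < s) (hst : s ≤ t) :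
    (∑' i, a i ^ (1 / s)) ^ s ≤ (∑' i, a i ^ (1 / t)) ^ t := by
  have ht : 0 < t := hs.trans_le hst
  have h0 : 1 ≤ t / s := by
    rw [le_div_iff₀ hs]
    linarith
  set S := ∑' i, a i ^ (1 / t) with hS
  have h1 : ∀ i, a i ^ (1 / s) ≤ a i ^ (1 / t) * S ^ (t / s - 1) := by
    intro i
    have : a i ^ (1 / s) = (a i ^ (1 / t)) ^ (t / s) := by
      rw [← ENNReal.rpow_mul]
      congr 1
      field_simp
    rw [this, ennreal_rpow_eq_mul_rpow_sub_one _ h0]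
    gcongr
    · exact ENNReal.le_tsum i
  calc (∑' i, a i ^ (1 / s)) ^ s ≤ (S * S ^ (t / s - 1)) ^ s := by
        gcongr
        exact (ENNReal.tsum_le_tsum h1).trans (le_of_eq ENNReal.tsum_mul_right)
    _ = S ^ t := by
        rw [← ennreal_rpow_eq_mul_rpow_sub_one _ h0, ← ENNReal.rpow_mul]
        congr 1
        field_simp

/-- The logarithm of the `ℓ^{1/s}` norm is a convex function of `s` (Hölder's inequality). -/
theorem tsum_rpow_rpow_interpolate {ι : Type*} (a : ι → ℝ≥0∞) {s₀ s₁ p q : ℝ} (h₀ : 0 < s₀)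
    (h₁ : 0 < s₁) (hp : 0 < p) (hq : 0 < q) (hpq : p + q = 1) :
    (∑' i, a i ^ (1 / (p * s₀ + q * s₁))) ^ (p * s₀ + q * s₁) ≤
      ((∑' i, a i ^ (1 / s₀)) ^ s₀) ^ p * ((∑' i, a i ^ (1 / s₁)) ^ s₁) ^ q := by
  set s := p * s₀ + q * s₁ with hs
  have hs0 : 0 < s := by positivity
  have hconj : (s / (p * s₀)).HolderConjugate (s / (q * s₁)) := by
    rw [Real.holderConjugate_iff]
    constructor
    · rw [lt_div_iff₀ (by positivity), one_mul, hs]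
      have : 0 < q * s₁ := by positivity
      linarith
    · rw [inv_div, inv_div, ← add_div, ← hs, div_self hs0.ne']
  have h1 : ∑' i, a i ^ (1 / s) ≤
      (∑' i, a i ^ (1 / s₀)) ^ (p * s₀ / s) * (∑' i, a i ^ (1 / s₁)) ^ (q * s₁ / s) := by
    rw [ENNReal.tsum_eq_iSup_sum]
    refine iSup_le fun E => ?_
    have h2 := ENNReal.inner_le_Lp_mul_Lq E (fun i => a i ^ (p / s)) (fun i => a i ^ (q / s)) hconj
    have h3 : ∀ i, a i ^ (p / s) * a i ^ (q / s) = a i ^ (1 / s) := by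
      intro i
      rw [← ENNReal.rpow_add_of_nonneg _ _ (by positivity) (by positivity), ← add_div, hpq]
    have h4 : ∀ i, (a i ^ (p / s)) ^ (s / (p * s₀)) = a i ^ (1 / s₀) := by
      intro i
      rw [← ENNReal.rpow_mul]
      congr 1
      field_simp
    have h5 : ∀ i, (a i ^ (q / s)) ^ (s / (q * s₁)) = a i ^ (1 / s₁) := by
      intro i
      rw [← ENNReal.rpow_mul]
      congr 1
      field_simp
    simp only [h3, h4, h5, one_div_div] at h2
    refine h2.trans ?_
    gcongr
    · exact ENNReal.sum_le_tsum _
    · exact ENNReal.sum_le_tsum _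
  calc (∑' i, a i ^ (1 / s)) ^ s ≤ _ := ENNReal.rpow_le_rpow h1 hs0.le
    _ = _ := by
      rw [ENNReal.mul_rpow_of_nonneg _ _ hs0.le]
      simp only [← ENNReal.rpow_mul]
      congr 2 <;> field_simp

/-- The supremum of the `ℓ^{1/s}` norms of the families `|u i * u j| ^ (1/2)`, indexed by the edges of
the tree, over all `u` with `ℓ^1` norm `1`. For `s = (α - 1) / α` it is half of `h_d(α)`. -/
noncomputable def treeNorm (d : ℕ) (s : ℝ) : ℝ≥0∞ :=
  ⨆ u ∈ {u : TreeVertex d → ℝ | HasSum (fun i => |u i|) 1}, treeEnergy d (1 / (2 * s)) u ^ s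

theorem hConstENN_eq {α : ℝ} (hα : 1 < α) :
    hConstENN d α = 2 * treeNorm d ((α - 1) / α) := by
  rw [hConstENN, treeNorm]
  have : α / (2 * (α - 1)) = 1 / (2 * ((α - 1) / α)) := by
    have : α - 1 ≠ 0 := by linarith
    field_simp
  rw [this]

theorem treeEnergy_eq_tsum_rpow (u : TreeVertex d → ℝ) {s : ℝ} (hs : 0 < s) :
    treeEnergy d (1 / (2 * s)) u =
      ∑' e : (regularTree d).edgeSet,
        ENNReal.ofReal (|(Sym2.map u e.1).mul| ^ (1 / 2 : ℝ)) ^ (1 / s) := by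
  refine tsum_congr fun e => ?_
  rw [ENNReal.ofReal_rpow_of_nonneg (by positivity) (by positivity), ← Real.rpow_mul (abs_nonneg _)]
  congr 2
  field_simp

theorem treeNorm_mono {s t : ℝ} (hs : 0 < s) (hst : s ≤ t) : treeNorm d s ≤ treeNorm d t := by
  refine iSup₂_mono fun u _ => ?_
  rw [treeEnergy_eq_tsum_rpow u hs, treeEnergy_eq_tsum_rpow u (hs.trans_le hst)]
  exact tsum_rpow_rpow_mono _ hs hst

theorem treeNorm_interpolate {s₀ s₁ p q : ℝ} (h₀ : 0 < s₀) (h₁ : 0 < s₁) (hp : 0 < p) (hq : 0 < q)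
    (hpq : p + q = 1) :
    treeNorm d (p * s₀ + q * s₁) ≤ treeNorm d s₀ ^ p * treeNorm d s₁ ^ q := by
  refine iSup₂_le fun u hu => ?_
  rw [treeEnergy_eq_tsum_rpow u (by positivity)]
  refine (tsum_rpow_rpow_interpolate _ h₀ h₁ hp hq hpq).trans ?_
  rw [← treeEnergy_eq_tsum_rpow u h₀, ← treeEnergy_eq_tsum_rpow u h₁]
  gcongr
  · exact le_iSup₂_of_le (f := fun (u : TreeVertex d → ℝ)
      (_ : u ∈ {u : TreeVertex d → ℝ | HasSum (fun i => |u i|) 1}) =>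
        treeEnergy d (1 / (2 * s₀)) u ^ s₀) u hu le_rfl
  · exact le_iSup₂_of_le (f := fun (u : TreeVertex d → ℝ)
      (_ : u ∈ {u : TreeVertex d → ℝ | HasSum (fun i => |u i|) 1}) =>
        treeEnergy d (1 / (2 * s₁)) u ^ s₁) u hu le_rfl

/-- Finitely supported test vectors, in homogeneous form. -/
theorem ofReal_treeSum_rpow_le {s : ℝ} (hs : 0 < s) (B : Finset (TreeVertex d))
    {x : TreeVertex d → ℝ} (hx : ∀ t, 0 ≤ x t) :
    ENNReal.ofReal ((treeSum B (fun r t => (x r * x t) ^ (1 / s)) / 2) ^ s) ≤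
      treeNorm d s * ENNReal.ofReal (∑ t ∈ B, x t ^ 2) := by
  classical
  set m := ∑ t ∈ B, x t ^ 2 with hm
  set T := treeSum B (fun r t => (x r * x t) ^ (1 / s)) with hT
  have hT0 : 0 ≤ T := treeSum_nonneg fun r t => Real.rpow_nonneg (mul_nonneg (hx r) (hx t)) _
  have hm0 : 0 ≤ m := Finset.sum_nonneg fun t _ => sq_nonneg _
  rcases hm0.eq_or_lt with hm0 | hm0
  · have hx0 : ∀ t ∈ B, x t = 0 := by
      intro t ht
      have := (Finset.sum_eq_zero_iff_of_nonneg fun t _ => sq_nonneg (x t)).1 hm0.symm t ht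
      exact pow_eq_zero_iff two_ne_zero |>.1 this
    have : T = 0 := by
      refine Finset.sum_eq_zero fun r hr => Finset.sum_eq_zero fun t _ => ?_
      beta_reduce
      rw [hx0 r hr, zero_mul, Real.zero_rpow (by positivity), ite_self]
    rw [this, zero_div, Real.zero_rpow hs.ne']
    simp
  let u : TreeVertex d → ℝ := fun t => if t ∈ B then x t ^ 2 / m else 0
  have hu : HasSum (fun t => |u t|) 1 := by
    have h1 : ∑ t ∈ B, |u t| = 1 := by
      have : ∀ t ∈ B, |u t| = x t ^ 2 / m := by
        intro t ht
        simp only [u, if_pos ht]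
        exact abs_of_nonneg (by positivity)
      rw [Finset.sum_congr rfl this, ← Finset.sum_div, ← hm, div_self hm0.ne']
    rw [← h1]
    refine hasSum_sum_of_ne_finset_zero fun t ht => ?_
    simp [u, ht]
  have h2 : treeSum B (fun r t => |u r * u t| ^ (1 / (2 * s))) = (m ^ (1 / s))⁻¹ * T := by
    rw [hT, ← treeSum_mul_left]
    refine treeSum_congr fun r hr t ht _ => ?_
    simp only [u, if_pos hr, if_pos ht]
    have h3 : x r ^ 2 / m * (x t ^ 2 / m) = (x r * x t / m) ^ (2 : ℝ) := by
      rw [Real.rpow_two]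
      field_simp
    have h4 : 0 ≤ x r * x t := mul_nonneg (hx r) (hx t)
    rw [abs_of_nonneg (by positivity), h3, ← Real.rpow_mul (by positivity),
      Real.div_rpow h4 hm0.le, show (2 : ℝ) * (1 / (2 * s)) = 1 / s by field_simp]
    rw [div_eq_inv_mul]
  have h3 : ENNReal.ofReal ((m ^ (1 / s))⁻¹ * T / 2) ≤ treeEnergy d (1 / (2 * s)) u := by
    have := ofReal_treeSum_le (1 / (2 * s)) u B
    rw [h2] at this
    rw [ENNReal.ofReal_div_of_pos two_pos]
    refine ENNReal.div_le_of_le_mul (this.trans (le_of_eq ?_))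
    rw [mul_comm, ENNReal.ofReal_ofNat]
  have h4 : ENNReal.ofReal ((T / 2) ^ s / m) ≤ treeNorm d s := by
    refine le_trans ?_ (le_iSup₂_of_le (f := fun (u : TreeVertex d → ℝ)
      (_ : u ∈ {u : TreeVertex d → ℝ | HasSum (fun i => |u i|) 1}) =>
        treeEnergy d (1 / (2 * s)) u ^ s) u hu le_rfl)
    refine le_trans (le_of_eq ?_) (ENNReal.rpow_le_rpow h3 hs.le)
    rw [ENNReal.ofReal_rpow_of_nonneg (by positivity) hs.le, mul_div_assoc,
      Real.mul_rpow (by positivity) (by positivity), Real.inv_rpow (by positivity),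
      ← Real.rpow_mul hm0.le, one_div_mul_cancel hs.ne', Real.rpow_one, div_eq_inv_mul]
  calc ENNReal.ofReal ((T / 2) ^ s) = ENNReal.ofReal ((T / 2) ^ s / m * m) := by
        rw [div_mul_cancel₀ _ hm0.ne']
    _ = ENNReal.ofReal ((T / 2) ^ s / m) * ENNReal.ofReal m := ENNReal.ofReal_mul (by positivity)
    _ ≤ _ := by gcongr

theorem treeSum_abs_rpow_eq {s : ℝ} (u : TreeVertex d → ℝ) (B : Finset (TreeVertex d)) :
    treeSum B (fun r t => |u r * u t| ^ (1 / (2 * s))) =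
      treeSum B (fun r t => (√|u r| * √|u t|) ^ (1 / s)) := by
  refine treeSum_congr fun r _ t _ _ => ?_
  rw [← Real.sqrt_mul (abs_nonneg _), ← abs_mul, Real.sqrt_eq_rpow, ← Real.rpow_mul (abs_nonneg _)]
  congr 1
  rw [one_div_mul_one_div]

theorem sum_sqrt_abs_sq_le {u : TreeVertex d → ℝ} (hu : HasSum (fun i => |u i|) 1)
    (B : Finset (TreeVertex d)) : ∑ t ∈ B, √|u t| ^ 2 ≤ 1 := by
  simp only [Real.sq_sqrt (abs_nonneg _)]
  exact sum_le_hasSum _ (fun _ _ => abs_nonneg _) hu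

theorem treeNorm_le_ofReal {s C : ℝ} (hs : 0 < s) (hC : 0 ≤ C)
    (h : ∀ (B : Finset (TreeVertex d)) (x : TreeVertex d → ℝ), (∀ t, 0 ≤ x t) →
      ∑ t ∈ B, x t ^ 2 ≤ 1 → (treeSum B (fun r t => (x r * x t) ^ (1 / s)) / 2) ^ s ≤ C) :
    treeNorm d s ≤ ENNReal.ofReal C := by
  refine iSup₂_le fun u hu => ?_
  have : treeEnergy d (1 / (2 * s)) u ≤ ENNReal.ofReal (C ^ (1 / s)) := by
    refine treeEnergy_le_ofReal fun B => ?_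
    rw [treeSum_abs_rpow_eq]
    have h1 := h B (fun t => √|u t|) (fun t => Real.sqrt_nonneg _) (sum_sqrt_abs_sq_le hu B)
    have h0 : 0 ≤ treeSum B (fun r t => (√|u r| * √|u t|) ^ (1 / s)) :=
      treeSum_nonneg fun r t => by positivity
    have h2 := Real.rpow_le_rpow (by positivity) h1 (show 0 ≤ 1 / s by positivity)
    rw [← Real.rpow_mul (by positivity), mul_one_div_cancel hs.ne', Real.rpow_one] at h2
    linarith
  refine (ENNReal.rpow_le_rpow this hs.le).trans (le_of_eq ?_)
  rw [ENNReal.ofReal_rpow_of_nonneg (by positivity) hs.le, ← Real.rpow_mul hC,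
    one_div_mul_cancel hs.ne', Real.rpow_one]

/-- The endpoint `α = 2`, where the tree being bipartite gives the value. -/
theorem treeNorm_half_le : treeNorm d (1 / 2) ≤ ENNReal.ofReal (1 / 2) := by
  refine treeNorm_le_ofReal (by norm_num) (by norm_num) fun B x hx hx1 => ?_
  have h1 := treeSum_mul_le_sq B (y := fun t => x t ^ 2) fun t => sq_nonneg _
  have h2 : treeSum B (fun r t => (x r * x t) ^ (1 / (1 / 2 : ℝ))) ≤ 1 / 2 := by
    refine le_trans (le_of_eq ?_) (h1.trans ?_)
    · refine treeSum_congr fun r _ t _ _ => ?_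
      rw [one_div_one_div, Real.rpow_two]
      ring
    · have : 0 ≤ ∑ t ∈ B, x t ^ 2 := Finset.sum_nonneg fun t _ => sq_nonneg _
      nlinarith
  have h0 : 0 ≤ treeSum B (fun r t => (x r * x t) ^ (1 / (1 / 2 : ℝ))) :=
    treeSum_nonneg fun r t => Real.rpow_nonneg (mul_nonneg (hx r) (hx t)) _
  rw [← Real.sqrt_eq_rpow, Real.sqrt_le_left (by norm_num)]
  linarith

/-- The endpoint `α = ∞`, where the norm of the adjacency operator enters. -/
theorem treeNorm_one_le (hd : 2 ≤ d) : treeNorm d 1 ≤ ENNReal.ofReal √((d : ℝ) - 1) := by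
  refine treeNorm_le_ofReal one_pos (Real.sqrt_nonneg _) fun B x hx hx1 => ?_
  have h1 := treeSum_mul_le_sqrt hd B x
  simp only [div_one, Real.rpow_one]
  nlinarith [Real.sqrt_nonneg ((d : ℝ) - 1)]

/-- A lower bound larger than `1/2` for `s > 1/2`, from the path with two edges with mass `1/2` at its
middle vertex and `1/4` at each end. -/
theorem ofReal_two_rpow_le_treeNorm (hd : 2 ≤ d) {s : ℝ} (hs : 0 < s) :
    ENNReal.ofReal ((2 : ℝ) ^ (s - 3 / 2)) ≤ treeNorm d s := by
  classical
  let a : TreeVertex d := ⟨[⟨0, by omega⟩], List.isChain_singleton _⟩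
  let b : TreeVertex d := ⟨[⟨1, by omega⟩], List.isChain_singleton _⟩
  have hab : a ≠ b := by simp [a, b]
  have har : treeRoot d ≠ a := by simp [a, treeRoot]
  have hbr : treeRoot d ≠ b := by simp [b, treeRoot]
  have ha : (regularTree d).Adj (treeRoot d) a := Or.inl ⟨⟨0, by omega⟩, rfl⟩
  have hb : (regularTree d).Adj (treeRoot d) b := Or.inl ⟨⟨1, by omega⟩, rfl⟩
  let x : TreeVertex d → ℝ := fun t => if t = treeRoot d then √(1 / 2) else 1 / 2
  have hx0 : ∀ t, 0 ≤ x t := fun t => by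
    simp only [x]
    split_ifs <;> positivity
  have hxr : x (treeRoot d) = √(1 / 2) := if_pos rfl
  have hxa : x a = 1 / 2 := if_neg har.symm
  have hxb : x b = 1 / 2 := if_neg hbr.symm
  let B : Finset (TreeVertex d) := {treeRoot d, a, b}
  have hm : ∑ t ∈ B, x t ^ 2 = 1 := by
    rw [Finset.sum_insert (by simp [har, hbr]), Finset.sum_pair hab, hxr, hxa, hxb,
      Real.sq_sqrt (by norm_num)]
    norm_num
  set z : ℝ := (√(1 / 2) * (1 / 2)) ^ (1 / s) with hz
  have hT : 4 * z ≤ treeSum B (fun r t => (x r * x t) ^ (1 / s)) := by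
    rw [treeSum_eq_sum_filter]
    let P : Finset (TreeVertex d × TreeVertex d) :=
      {(treeRoot d, a), (treeRoot d, b), (a, treeRoot d), (b, treeRoot d)}
    have hP : ∑ p ∈ P, (x p.1 * x p.2) ^ (1 / s) = 4 * z := by
      rw [Finset.sum_insert (by simp [har, hbr, hab]), Finset.sum_insert (by simp [har, hbr]),
        Finset.sum_pair (by simp [hab]), hxr, hxa, hxb, mul_comm (1 / 2) √(1 / 2), ← hz]
      ring
    rw [← hP]
    refine Finset.sum_le_sum_of_subset_of_nonneg ?_ fun p _ _ =>
      Real.rpow_nonneg (mul_nonneg (hx0 _) (hx0 _)) _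
    intro p hp
    simp only [P, Finset.mem_insert, Finset.mem_singleton] at hp
    rcases hp with rfl | rfl | rfl | rfl <;> simp [B, ha, hb, ha.symm, hb.symm]
  have h1 := ofReal_treeSum_rpow_le hs B hx0
  rw [hm, ENNReal.ofReal_one, mul_one] at h1
  refine le_trans (ENNReal.ofReal_le_ofReal ?_) h1
  have hz0 : 0 ≤ z := by positivity
  calc (2 : ℝ) ^ (s - 3 / 2) = (2 * z) ^ s := by
        rw [Real.mul_rpow two_pos.le hz0, hz, ← Real.rpow_mul (by positivity),
          one_div_mul_cancel hs.ne', Real.rpow_one, Real.rpow_sub two_pos, div_eq_mul_inv]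
        congr 1
        rw [show (3 / 2 : ℝ) = 1 / 2 + 1 by norm_num, Real.rpow_add two_pos, Real.rpow_one,
          ← Real.sqrt_eq_rpow, mul_inv, one_div, Real.sqrt_inv]
    _ ≤ _ := by
        apply Real.rpow_le_rpow (by positivity) _ hs.le
        linarith

theorem treeNorm_ne_top (hd : 2 ≤ d) {s : ℝ} (hs : 0 < s) (hs1 : s ≤ 1) : treeNorm d s ≠ ∞ :=
  ne_top_of_le_ne_top ENNReal.ofReal_ne_top ((treeNorm_mono hs hs1).trans (treeNorm_one_le hd))

theorem treeNorm_toReal_pos (hd : 2 ≤ d) {s : ℝ} (hs : 0 < s) (hs1 : s ≤ 1) :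
    0 < (treeNorm d s).toReal := by
  refine ENNReal.toReal_pos (ne_of_gt ?_) (treeNorm_ne_top hd hs hs1)
  refine lt_of_lt_of_le ?_ (ofReal_two_rpow_le_treeNorm hd hs)
  rw [ENNReal.ofReal_pos]
  positivity

theorem treeNorm_toReal_interpolate (hd : 2 ≤ d) {s₀ s₁ p q : ℝ} (h₀ : 0 < s₀) (h₁ : 0 < s₁)
    (h₀' : s₀ ≤ 1) (h₁' : s₁ ≤ 1) (hp : 0 < p) (hq : 0 < q) (hpq : p + q = 1) :
    (treeNorm d (p * s₀ + q * s₁)).toReal ≤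
      (treeNorm d s₀).toReal ^ p * (treeNorm d s₁).toReal ^ q := by
  rw [ENNReal.toReal_rpow, ENNReal.toReal_rpow, ← ENNReal.toReal_mul]
  refine ENNReal.toReal_mono ?_ (treeNorm_interpolate h₀ h₁ hp hq hpq)
  exact ENNReal.mul_ne_top (ENNReal.rpow_ne_top_of_nonneg hp.le (treeNorm_ne_top hd h₀ h₀'))
    (ENNReal.rpow_ne_top_of_nonneg hq.le (treeNorm_ne_top hd h₁ h₁'))

theorem convexOn_log_treeNorm (hd : 2 ≤ d) :
    ConvexOn ℝ (Set.Ioo 0 1) fun s => Real.log (treeNorm d s).toReal := by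
  rw [convexOn_iff_forall_pos]
  refine ⟨convex_Ioo 0 1, fun s₀ h₀ s₁ h₁ p q hp hq hpq => ?_⟩
  have hs0 := treeNorm_toReal_pos hd h₀.1 h₀.2.le
  have hs1 := treeNorm_toReal_pos hd h₁.1 h₁.2.le
  have hs := convex_Ioo (0 : ℝ) 1 h₀ h₁ hp.le hq.le hpq
  simp only [smul_eq_mul] at hs ⊢
  rw [← Real.log_rpow hs0, ← Real.log_rpow hs1, ← Real.log_mul (by positivity) (by positivity)]
  exact Real.log_le_log (treeNorm_toReal_pos hd hs.1 hs.2.le)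
    (treeNorm_toReal_interpolate hd h₀.1 h₁.1 h₀.2.le h₁.2.le hp hq hpq)

theorem continuousOn_treeNorm_toReal (hd : 2 ≤ d) :
    ContinuousOn (fun s => (treeNorm d s).toReal) (Set.Ioo 0 1) := by
  have h1 := ((convexOn_log_treeNorm hd).continuousOn isOpen_Ioo).rexp
  refine h1.congr fun s hs => ?_
  exact (Real.exp_log (treeNorm_toReal_pos hd hs.1 hs.2.le)).symm

theorem hConst_eq {α : ℝ} (hα : 1 < α) : hConst d α = 2 * (treeNorm d ((α - 1) / α)).toReal := by
  rw [hConst, hConstENN_eq hα, ENNReal.toReal_mul]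
  simp

theorem sub_one_div_mem_Ioo {α : ℝ} (hα : 2 < α) : (α - 1) / α ∈ Set.Ioo (1 / 2 : ℝ) 1 := by
  constructor
  · rw [lt_div_iff₀ (by linarith)]
    linarith
  · rw [div_lt_one (by linarith)]
    linarith

theorem continuousOn_hConst (hd : 2 ≤ d) : ContinuousOn (hConst d) (Set.Ioi 2) := by
  have h1 : ContinuousOn (fun α : ℝ => 2 * (treeNorm d ((α - 1) / α)).toReal) (Set.Ioi 2) := by
    refine continuousOn_const.mul ((continuousOn_treeNorm_toReal hd).comp
      (f := fun α : ℝ => (α - 1) / α) ?_ ?_)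
    · refine ContinuousOn.div (by fun_prop) (by fun_prop) fun α hα => ?_
      have : (2 : ℝ) < α := hα
      linarith
    · intro α hα
      have := sub_one_div_mem_Ioo hα
      exact ⟨by linarith [this.1], this.2⟩
  exact h1.congr fun α hα => hConst_eq (by linarith [show (2 : ℝ) < α from hα])

theorem hConstENN_ne_top (hd : 2 ≤ d) {α : ℝ} (hα : 2 < α) : hConstENN d α ≠ ∞ := by
  have := sub_one_div_mem_Ioo hα
  rw [hConstENN_eq (by linarith)]
  exact ENNReal.mul_ne_top (by norm_num) (treeNorm_ne_top hd (by linarith [this.1]) this.2.le)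

theorem one_lt_hConst (hd : 2 ≤ d) {α : ℝ} (hα : 2 < α) : 1 < hConst d α := by
  have hs := sub_one_div_mem_Ioo hα
  rw [hConst_eq (by linarith)]
  set s := (α - 1) / α
  have h1 := ENNReal.toReal_mono (treeNorm_ne_top hd (by linarith [hs.1]) hs.2.le)
    (ofReal_two_rpow_le_treeNorm hd (by linarith [hs.1] : 0 < s))
  rw [ENNReal.toReal_ofReal (by positivity)] at h1
  have h2 : (2 : ℝ) ^ (-1 : ℝ) < 2 ^ (s - 3 / 2) :=
    Real.rpow_lt_rpow_of_exponent_lt one_lt_two (by linarith [hs.1])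
  rw [Real.rpow_neg_one] at h2
  linarith

theorem tendsto_hConst_two (hd : 2 ≤ d) : Tendsto (hConst d) (𝓝[>] 2) (𝓝 1) := by
  set r := √((d : ℝ) - 1) with hr
  have hr0 : 0 < r := Real.sqrt_pos.2 (by
    have : (2 : ℝ) ≤ d := by exact_mod_cast hd
    linarith)
  have hlim : Tendsto (fun α : ℝ => 2 * ((1 / 2 : ℝ) ^ (2 / α) * r ^ (1 - 2 / α))) (𝓝[>] 2)
      (𝓝 1) := by
    have h1 : ContinuousAt (fun α : ℝ => 2 * ((1 / 2 : ℝ) ^ (2 / α) * r ^ (1 - 2 / α))) 2 := by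
      have h2 : ContinuousAt (fun α : ℝ => 2 / α) 2 :=
        continuousAt_const.div continuousAt_id two_ne_zero
      refine continuousAt_const.mul (ContinuousAt.mul ?_ ?_)
      · exact continuousAt_const.rpow h2 (Or.inl (by norm_num))
      · exact continuousAt_const.rpow (continuousAt_const.sub h2) (Or.inl hr0.ne')
    have h3 := h1.tendsto
    norm_num at h3
    refine (h3.mono_left nhdsWithin_le_nhds).congr fun α => by norm_num
  refine tendsto_of_tendsto_of_tendsto_of_le_of_le' tendsto_const_nhds hlim ?_ ?_
  · filter_upwards [self_mem_nhdsWithin] with α hα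
    exact (one_lt_hConst hd hα).le
  · filter_upwards [self_mem_nhdsWithin] with α hα
    have hα' : (2 : ℝ) < α := hα
    have hq : 0 < 1 - 2 / α := by
      rw [sub_pos, div_lt_one (by linarith)]
      exact hα'
    -- `(α - 1) / α` is the mean of `1/2` and `1` with weights `2 / α` and `1 - 2 / α`.
    have h1 := treeNorm_toReal_interpolate hd (s₀ := 1 / 2) (s₁ := 1) (p := 2 / α) (q := 1 - 2 / α)
      (by norm_num) one_pos (by norm_num) le_rfl (by positivity) hq (by ring)
    have h2 : 2 / α * (1 / 2) + (1 - 2 / α) * 1 = (α - 1) / α := by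
      field_simp
      ring
    rw [h2] at h1
    rw [hConst_eq (by linarith)]
    have h3 := ENNReal.toReal_mono ENNReal.ofReal_ne_top (treeNorm_half_le (d := d))
    have h4 := ENNReal.toReal_mono ENNReal.ofReal_ne_top (treeNorm_one_le hd)
    rw [ENNReal.toReal_ofReal (by positivity)] at h3 h4
    refine mul_le_mul_of_nonneg_left (h1.trans ?_) two_pos.le
    gcongr

theorem tendsto_hConst_atTop (hd : 3 ≤ d) :
    Tendsto (hConst d) atTop (𝓝 (2 * √((d : ℝ) - 1))) := by
  set r := √((d : ℝ) - 1) with hr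
  have hd' : (3 : ℝ) ≤ d := by exact_mod_cast hd
  have hr0 : 0 < r := Real.sqrt_pos.2 (by linarith)
  have hs : Tendsto (fun α : ℝ => (α - 1) / α) atTop (𝓝 1) := by
    have h1 : Tendsto (fun α : ℝ => 1 - α⁻¹) atTop (𝓝 (1 - 0)) :=
      tendsto_const_nhds.sub tendsto_inv_atTop_zero
    rw [sub_zero] at h1
    refine h1.congr' ?_
    filter_upwards [eventually_gt_atTop 0] with α hα
    field_simp
  rw [tendsto_order]
  constructor
  · intro c hc
    have hR : Tendsto (fun R : ℕ => 2 * r * ((R : ℝ) / (R + 2))) atTop (𝓝 (2 * r * 1)) :=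
      tendsto_const_nhds.mul (tendsto_natCast_div_add_atTop (2 : ℝ))
    rw [mul_one] at hR
    obtain ⟨R, hR⟩ := (hR.eventually_const_lt hc).exists
    obtain ⟨x, hx0, hm, hx⟩ := exists_treeSum_mul_ge hd R
    set B := treeBall d (R + 1) with hB
    set m := ∑ s ∈ B, x s ^ 2 with hm'
    have hlim : Tendsto (fun s : ℝ => (treeSum B (fun r t => (x r * x t) ^ (1 / s)) / 2) ^ s)
        (𝓝 1) (𝓝 ((treeSum B (fun r t => (x r * x t) ^ (1 / (1 : ℝ))) / 2) ^ (1 : ℝ))) := by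
      refine Tendsto.rpow ?_ tendsto_id (Or.inr one_pos)
      refine Tendsto.div_const ?_ 2
      refine tendsto_finsetSum _ fun s _ => tendsto_finsetSum _ fun t _ => ?_
      split_ifs
      · refine Tendsto.rpow tendsto_const_nhds ?_ (Or.inr (by norm_num))
        exact tendsto_const_nhds.div tendsto_id one_ne_zero
      · exact tendsto_const_nhds
    have hlt : c * m / 2 < (treeSum B (fun r t => (x r * x t) ^ (1 / (1 : ℝ))) / 2) ^ (1 : ℝ) := by
      simp only [div_one, Real.rpow_one]
      have := mul_lt_mul_of_pos_right hR hm
      linarith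
    filter_upwards [hs.eventually (hlim.eventually_const_lt hlt), eventually_gt_atTop 2]
      with α h1 hα
    have hmem := sub_one_div_mem_Ioo hα
    rw [hConst_eq (by linarith)]
    set s := (α - 1) / α
    have hs0 : 0 < s := by linarith [hmem.1]
    have h2 := ofReal_treeSum_rpow_le hs0 B hx0
    have h3 := ENNReal.toReal_mono (ENNReal.mul_ne_top (treeNorm_ne_top (by omega) hs0 hmem.2.le)
      ENNReal.ofReal_ne_top) h2
    have h0 : 0 ≤ treeSum B (fun r t => (x r * x t) ^ (1 / s)) :=
      treeSum_nonneg fun r t => Real.rpow_nonneg (mul_nonneg (hx0 r) (hx0 t)) _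
    rw [ENNReal.toReal_ofReal (by positivity), ENNReal.toReal_mul, ENNReal.toReal_ofReal hm.le]
      at h3
    have h4 : c / 2 * m < (treeNorm d s).toReal * m := by linarith
    have := lt_of_mul_lt_mul_right h4 hm.le
    linarith
  · intro c hc
    filter_upwards [eventually_gt_atTop 2] with α hα
    have hmem := sub_one_div_mem_Ioo hα
    rw [hConst_eq (by linarith)]
    have h1 := ENNReal.toReal_mono ENNReal.ofReal_ne_top
      ((treeNorm_mono (by linarith [hmem.1]) hmem.2.le).trans (treeNorm_one_le (by omega : 2 ≤ d)))
    rw [ENNReal.toReal_ofReal (by positivity)] at h1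
    linarith

end Variational

/-! ### Weighted finite trees -/

section WeightedTrees

variable {d : ℕ}

open Classical in
/-- The edges of the tree inside `B`, oriented away from the root. -/
noncomputable def outEdges (B : Finset (TreeVertex d)) : Finset (TreeVertex d × TreeVertex d) :=
  (B ×ˢ B).filter fun p => (regularTree d).Adj p.1 p.2 ∧ p.1.1.length < p.2.1.length

theorem treeSum_eq_two_mul (B : Finset (TreeVertex d)) {w : TreeVertex d → TreeVertex d → ℝ}
    (hw : ∀ s t, w s t = w t s) : treeSum B w = 2 * ∑ p ∈ outEdges B, w p.1 p.2 := by
  classical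
  rw [treeSum_eq_sum_filter, ← Finset.sum_filter_add_sum_filter_not _
    fun p => p.1.1.length < p.2.1.length, Finset.filter_filter, Finset.filter_filter, two_mul]
  congr 1
  refine Finset.sum_bij (fun p _ => p.swap) ?_ ?_ ?_ ?_
  · rintro ⟨s, t⟩ h
    simp only [Finset.mem_filter, Finset.mem_product, outEdges, Prod.swap] at h ⊢
    obtain ⟨⟨hs, ht⟩, hadj, hlt⟩ := h
    refine ⟨⟨ht, hs⟩, hadj.symm, ?_⟩
    rcases hadj with ⟨a, h⟩ | ⟨a, h⟩
    · simp [h] at hlt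
    · simp [h]
  · intro p _ q _ h
    exact Prod.swap_injective h
  · rintro ⟨s, t⟩ h
    simp only [Finset.mem_filter, Finset.mem_product, outEdges] at h
    refine ⟨(t, s), ?_, rfl⟩
    simp only [Finset.mem_filter, Finset.mem_product]
    exact ⟨⟨h.1.2, h.1.1⟩, h.2.1.symm, h.2.2.le.not_gt⟩
  · rintro ⟨s, t⟩ _
    exact hw s t

theorem sum_sq_le_sum_rpow {ι : Type*} (E : Finset ι) {w : ι → ℝ} (hw : ∀ i, 0 ≤ w i) {α : ℝ}
    (hα : 0 < α) (hα2 : α ≤ 2) : ∑ i ∈ E, w i ^ 2 ≤ (∑ i ∈ E, w i ^ α) ^ (2 / α) := by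
  set M := ∑ i ∈ E, w i ^ α with hM
  have hM0 : 0 ≤ M := Finset.sum_nonneg fun i _ => Real.rpow_nonneg (hw i) _
  have h1 : ∀ i ∈ E, w i ^ 2 ≤ w i ^ α * M ^ (2 / α - 1) := by
    intro i hi
    have h2 : w i ^ α ≤ M :=
      Finset.single_le_sum (f := fun i => w i ^ α) (fun i _ => Real.rpow_nonneg (hw i) _) hi
    rcases (hw i).eq_or_lt with h0 | h0
    · rw [← h0, Real.zero_rpow hα.ne']
      simp
    · have h3 : w i ^ 2 = w i ^ α * (w i ^ α) ^ (2 / α - 1) := by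
        rw [← Real.rpow_mul h0.le, ← Real.rpow_add h0, ← Real.rpow_two]
        congr 1
        field_simp
        ring
      rw [h3]
      gcongr
      rw [sub_nonneg, le_div_iff₀ hα]
      linarith
  rcases hM0.eq_or_lt with h0 | h0
  · rw [← h0, Real.zero_rpow (by positivity)]
    refine le_of_eq (Finset.sum_eq_zero fun i hi => ?_)
    have := (Finset.sum_eq_zero_iff_of_nonneg fun i _ => Real.rpow_nonneg (hw i) α).1 h0.symm i hi
    rw [(Real.rpow_eq_zero (hw i) hα.ne').1 this]
    norm_num
  · calc _ ≤ ∑ i ∈ E, w i ^ α * M ^ (2 / α - 1) := Finset.sum_le_sum h1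
      _ = M ^ (1 : ℝ) * M ^ (2 / α - 1) := by rw [← Finset.sum_mul, Real.rpow_one]
      _ = _ := by
        rw [← Real.rpow_add h0]
        congr 1
        ring

/-- For `α ≤ 2` the `ℓ^α` norm of the weights dominates their `ℓ^2` norm, and the inequality of Cauchy
and Schwarz reduces the bound to the bipartiteness of the tree. -/
theorem treeUpperBound_of_le_two {α : ℝ} (hα : 0 < α) (hα2 : α ≤ 2) :
    TreeUpperBound d α 1 := by
  intro B w x hw hsymm hx
  rw [treeSum_eq_two_mul B fun s t => by rw [hsymm, mul_comm (x s)],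
    treeSum_eq_two_mul B fun s t => by rw [hsymm], mul_div_cancel_left₀ _ two_ne_zero, one_mul]
  set A := ∑ p ∈ outEdges B, w p.1 p.2 ^ α with hA
  have hA0 : 0 ≤ A := Finset.sum_nonneg fun p _ => Real.rpow_nonneg (hw _ _) _
  set m := ∑ s ∈ B, x s ^ 2 with hm
  have hm0 : 0 ≤ m := Finset.sum_nonneg fun s _ => sq_nonneg _
  have h1 : (∑ p ∈ outEdges B, w p.1 p.2 * (x p.1 * x p.2)) ^ 2 ≤
      (∑ p ∈ outEdges B, w p.1 p.2 ^ 2) * ∑ p ∈ outEdges B, (x p.1 * x p.2) ^ 2 :=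
    Finset.sum_mul_sq_le_sq_mul_sq _ _ _
  have h2 : ∑ p ∈ outEdges B, w p.1 p.2 ^ 2 ≤ (A ^ (1 / α)) ^ 2 := by
    refine (sum_sq_le_sum_rpow (outEdges B) (fun p => hw p.1 p.2) hα hα2).trans (le_of_eq ?_)
    rw [← Real.rpow_two, ← Real.rpow_mul hA0]
    congr 1
    ring
  have h3 : ∑ p ∈ outEdges B, (x p.1 * x p.2) ^ 2 ≤ (m / 2) ^ 2 := by
    have h4 := treeSum_mul_le_sq B (y := fun t => x t ^ 2) fun t => sq_nonneg _
    rw [treeSum_eq_two_mul B fun s t => mul_comm _ _] at h4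
    simp only [mul_pow]
    linarith
  have h5 : ∑ p ∈ outEdges B, w p.1 p.2 * (x p.1 * x p.2) ≤ A ^ (1 / α) * (m / 2) := by
    refine abs_le_of_sq_le_sq' ?_ (by positivity) |>.2
    rw [mul_pow]
    refine h1.trans ?_
    gcongr
  linarith

/-- Hölder's inequality with the conjugate exponents `α` and `α / (α - 1)`. -/
theorem treeUpperBound_of_two_lt (hd : 2 ≤ d) {α : ℝ} (hα : 2 < α) :
    TreeUpperBound d α (hConst d α) := by
  intro B w x hw hsymm hx
  have hmem := sub_one_div_mem_Ioo hα
  rw [hConst_eq (by linarith)]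
  set s := (α - 1) / α with hs
  have hs0 : 0 < s := by linarith [hmem.1]
  have hα0 : 0 < α := by linarith
  have hm0 : 0 ≤ ∑ t ∈ B, x t ^ 2 := Finset.sum_nonneg fun s _ => sq_nonneg _
  have h1 := ENNReal.toReal_mono (ENNReal.mul_ne_top (treeNorm_ne_top hd hs0 hmem.2.le)
    ENNReal.ofReal_ne_top) (ofReal_treeSum_rpow_le hs0 B hx)
  have h0 : 0 ≤ treeSum B (fun r t => (x r * x t) ^ (1 / s)) :=
    treeSum_nonneg fun r t => Real.rpow_nonneg (mul_nonneg (hx r) (hx t)) _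
  rw [ENNReal.toReal_ofReal (by positivity), ENNReal.toReal_mul, ENNReal.toReal_ofReal hm0,
    treeSum_eq_two_mul B fun s t => by rw [mul_comm (x s)], mul_div_cancel_left₀ _ two_ne_zero] at h1
  rw [treeSum_eq_two_mul B fun s t => by rw [hsymm, mul_comm (x s)],
    treeSum_eq_two_mul B fun s t => by rw [hsymm], mul_div_cancel_left₀ _ two_ne_zero]
  have hconj : α.HolderConjugate (1 / s) := by
    rw [Real.holderConjugate_iff]
    refine ⟨by linarith, ?_⟩
    rw [one_div, inv_inv, hs]
    field_simp
    ring
  have h2 := Real.inner_le_Lp_mul_Lq_of_nonneg (outEdges B) hconj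
    (f := fun p => w p.1 p.2) (g := fun p => x p.1 * x p.2) (fun p _ => hw _ _)
    fun p _ => mul_nonneg (hx _) (hx _)
  rw [one_div_one_div] at h2
  have h3 : 0 ≤ (∑ p ∈ outEdges B, w p.1 p.2 ^ α) ^ (1 / α) :=
    Real.rpow_nonneg (Finset.sum_nonneg fun p _ => Real.rpow_nonneg (hw _ _) _) _
  have h4 := mul_le_mul_of_nonneg_left h1 h3
  linarith

/-- For `α ≤ 2` a single edge is optimal; its eigenvalue is its weight. -/
theorem treeLowerBound_of_le_two (hd : 1 ≤ d) {α : ℝ} (hα : 0 < α) : TreeLowerBound d α 1 := by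
  classical
  intro c hc0 hc1
  let a : TreeVertex d := ⟨[⟨0, hd⟩], List.isChain_singleton _⟩
  have har : treeRoot d ≠ a := by simp [a, treeRoot]
  have ha : (regularTree d).Adj (treeRoot d) a := Or.inl ⟨⟨0, hd⟩, rfl⟩
  have hT : ∀ w : ℝ, treeSum {treeRoot d, a} (fun _ _ => w) = 2 * w := by
    intro w
    rw [treeSum, Finset.sum_pair har, Finset.sum_pair har, Finset.sum_pair har]
    simp [ha, ha.symm]
    ring
  have hmid : 0 ≤ (c + 1) / 2 := by linarith
  refine ⟨{treeRoot d, a}, fun _ _ => (c + 1) / 2, fun _ => √(1 / 2), fun _ _ => hmid,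
    fun _ _ => rfl, fun _ => Real.sqrt_nonneg _, ?_, ?_, ?_⟩
  · rw [Finset.sum_pair har, Real.sq_sqrt (by norm_num)]
    norm_num
  · rw [hT, mul_div_cancel_left₀ _ two_ne_zero]
    exact Real.rpow_lt_one hmid (by linarith) hα
  · rw [hT, Real.mul_self_sqrt (by norm_num)]
    linarith

/-- Finite sets of edges of a near-optimizer `u`, with weights chosen according to the equality
case of Hölder's inequality and then decreased slightly. -/
theorem treeLowerBound_of_two_lt {α : ℝ} (hα : 2 < α) :
    TreeLowerBound d α (hConst d α) := by
  intro c hc0 hc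
  have hmem := sub_one_div_mem_Ioo hα
  rw [hConst_eq (by linarith)] at hc
  set s := (α - 1) / α with hs
  have hs0 : 0 < s := by linarith [hmem.1]
  have hα0 : 0 < α := by linarith
  have hα1 : α - 1 ≠ 0 := by linarith
  obtain ⟨B, x, hx0, hx1, hlt⟩ : ∃ (B : Finset (TreeVertex d)) (x : TreeVertex d → ℝ),
      (∀ t, 0 ≤ x t) ∧ ∑ t ∈ B, x t ^ 2 ≤ 1 ∧
        c / 2 < (treeSum B (fun r t => (x r * x t) ^ (1 / s)) / 2) ^ s := by
    by_contra! hcon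
    have h1 := treeNorm_le_ofReal (d := d) hs0 (C := c / 2) (by positivity)
      fun B x hx hx1 => hcon B x hx hx1
    have h2 := ENNReal.toReal_mono ENNReal.ofReal_ne_top h1
    rw [ENNReal.toReal_ofReal (by positivity)] at h2
    linarith
  set T := treeSum B (fun r t => (x r * x t) ^ (1 / s)) / 2 with hT
  have hT0 : 0 < T := by
    have h0 : 0 ≤ T := by
      have := treeSum_nonneg (B := B) fun r t =>
        Real.rpow_nonneg (mul_nonneg (hx0 r) (hx0 t)) (1 / s)
      positivity
    refine h0.lt_of_ne fun h => ?_
    rw [← h, Real.zero_rpow hs0.ne'] at hlt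
    linarith
  have hTs : 0 < T ^ s := by positivity
  obtain ⟨κ, hκ1, hκ2⟩ : ∃ κ, c / 2 / T ^ s < κ ∧ κ < 1 :=
    exists_between ((div_lt_one hTs).2 hlt)
  have hκ0 : 0 ≤ κ := (by positivity : 0 ≤ c / 2 / T ^ s).trans hκ1.le
  have hxx : ∀ r t, 0 ≤ x r * x t := fun r t => mul_nonneg (hx0 r) (hx0 t)
  have hβ : 0 < 1 / s - 1 := by
    rw [sub_pos, lt_div_iff₀ hs0]
    linarith [hmem.2]
  -- Equality in Hölder's inequality means that `w ^ α` is proportional to `(x r * x t) ^ (1 / s)`; the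
  -- factor `κ < 1` makes the cost strictly less than `1`.
  refine ⟨B, fun r t => κ * T ^ (-(1 / α)) * (x r * x t) ^ (1 / s - 1), x, ?_, ?_, hx0, hx1, ?_, ?_⟩
  · intro r t
    have := Real.rpow_nonneg (hxx r t) (1 / s - 1)
    positivity
  · intro r t
    beta_reduce
    rw [mul_comm (x r)]
  · have h1 : ∀ r t, (κ * T ^ (-(1 / α)) * (x r * x t) ^ (1 / s - 1)) ^ α =
        (κ ^ α * T⁻¹) * (x r * x t) ^ (1 / s) := by
      intro r t
      rw [Real.mul_rpow (by positivity) (Real.rpow_nonneg (hxx r t) _),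
        Real.mul_rpow hκ0 (by positivity), ← Real.rpow_mul hT0.le, ← Real.rpow_mul (hxx r t),
        neg_mul, one_div_mul_cancel hα0.ne', Real.rpow_neg_one]
      congr 2
      rw [hs]
      field_simp
      ring
    simp only [h1]
    rw [treeSum_mul_left, mul_div_assoc, ← hT, mul_assoc, inv_mul_cancel₀ hT0.ne', mul_one]
    exact Real.rpow_lt_one hκ0 hκ2 hα0
  · have h1 : ∀ r t, κ * T ^ (-(1 / α)) * (x r * x t) ^ (1 / s - 1) * (x r * x t) =
        (κ * T ^ (-(1 / α))) * (x r * x t) ^ (1 / s) := by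
      intro r t
      rcases (hxx r t).eq_or_lt with h0 | h0
      · rw [← h0, Real.zero_rpow hβ.ne', Real.zero_rpow (by positivity)]
        ring
      · rw [Real.rpow_sub h0, Real.rpow_one, mul_assoc, div_mul_cancel₀ _ h0.ne']
    simp only [h1]
    have h2 : treeSum B (fun r t => (x r * x t) ^ (1 / s)) = 2 * T := by
      rw [hT]
      ring
    rw [treeSum_mul_left, h2]
    have h3 : T ^ (-(1 / α)) * T = T ^ s := by
      conv_lhs => rw [← Real.rpow_one T, ← Real.rpow_mul hT0.le, one_mul]
      rw [← Real.rpow_add hT0]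
      congr 1
      rw [hs]
      field_simp
      ring
    rw [div_lt_iff₀ hTs, ← h3] at hκ1
    linarith

end WeightedTrees

/-! ### Estimates for independent Weibull weights -/

section Weights

variable {μ : Measure ℝ} {α : ℝ}

/-- Exponential moments: `exp (θ |w| ^ α)` is integrable for `θ < 1`. -/
theorem IsWeibull.exists_lintegral_exp_le [IsProbabilityMeasure μ] (hμ : IsWeibull μ α) (hα : 0 < α)
    {θ : ℝ} (hθ : 0 < θ) (hθ1 : θ < 1) :
    ∃ M : ℝ, 1 ≤ M ∧ ∫⁻ w, ENNReal.ofReal (Real.exp (θ * |w| ^ α)) ∂μ ≤ ENNReal.ofReal M := by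
  obtain ⟨C₁, C₂, hC₁, hC₂, h⟩ := hμ
  set C := max 1 C₂ with hC
  have hC0 : 0 < C := lt_max_of_lt_left one_pos
  have htail : ∀ k : ℕ, μ {w | (k : ℝ) ≤ |w| ^ α} ≤ ENNReal.ofReal (C * Real.exp (-k)) := by
    intro k
    rcases Nat.eq_zero_or_pos k with rfl | hk
    · refine prob_le_one.trans ?_
      rw [← ENNReal.ofReal_one]
      refine ENNReal.ofReal_le_ofReal ?_
      simp [hC]
    · have hk1 : (1 : ℝ) ≤ k := by exact_mod_cast hk
      set t := (k : ℝ) ^ (1 / α) with ht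
      have ht1 : 1 ≤ t := Real.one_le_rpow hk1 (by positivity)
      have htα : t ^ α = k := by
        rw [ht, ← Real.rpow_mul (by positivity), one_div_mul_cancel hα.ne', Real.rpow_one]
      have hsub : {w : ℝ | (k : ℝ) ≤ |w| ^ α} ⊆ Set.Ici t ∪ Set.Iic (-t) := by
        intro w hw
        have hw' : t ≤ |w| := by
          have hw : (k : ℝ) ≤ |w| ^ α := hw
          have := Real.rpow_le_rpow (by positivity) hw (show 0 ≤ 1 / α by positivity)
          rwa [← Real.rpow_mul (abs_nonneg _), mul_one_div_cancel hα.ne', Real.rpow_one] at this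
        rcases le_abs'.1 hw' with h | h
        · exact Or.inr h
        · exact Or.inl h
      have h1 := (h t ht1).1.2
      have h2 := (h t ht1).2.2
      rw [htα] at h1 h2
      have h3 : μ.real {w | (k : ℝ) ≤ |w| ^ α} ≤ C * Real.exp (-k) := by
        calc _ ≤ μ.real (Set.Ici t ∪ Set.Iic (-t)) := measureReal_mono hsub
          _ ≤ μ.real (Set.Ici t) + μ.real (Set.Iic (-t)) := measureReal_union_le _ _
          _ ≤ C₂ * Real.exp (-k) := by linarith
          _ ≤ C * Real.exp (-k) := by
            gcongr
            exact le_max_right _ _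
      rw [← ofReal_measureReal]
      exact ENNReal.ofReal_le_ofReal h3
  -- Summation over the integer part of `|w| ^ α` gives a geometric series with ratio `exp (θ - 1)`.
  set q := Real.exp (θ - 1) with hq
  have hq1 : q < 1 := by
    rw [hq, Real.exp_lt_one_iff]
    linarith
  have hgeom := (hasSum_geometric_of_lt_one (Real.exp_pos _).le hq1).mul_left (C * Real.exp θ)
  refine ⟨max 1 (C * Real.exp θ * (1 - q)⁻¹), le_max_left _ _, ?_⟩
  calc ∫⁻ w, ENNReal.ofReal (Real.exp (θ * |w| ^ α)) ∂μ
      ≤ ∫⁻ w, ∑' k : ℕ, Set.indicator {w : ℝ | (k : ℝ) ≤ |w| ^ α}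
          (fun _ => ENNReal.ofReal (Real.exp (θ * (k + 1)))) w ∂μ := by
        refine lintegral_mono fun w => ?_
        refine le_trans ?_ (ENNReal.le_tsum ⌊|w| ^ α⌋₊)
        have h0 : 0 ≤ |w| ^ α := by positivity
        have hmem : w ∈ {v : ℝ | (⌊|w| ^ α⌋₊ : ℝ) ≤ |v| ^ α} := Nat.floor_le h0
        rw [Set.indicator_of_mem hmem]
        refine ENNReal.ofReal_le_ofReal (Real.exp_le_exp.2 ?_)
        gcongr
        exact (Nat.lt_floor_add_one _).le
    _ = ∑' k : ℕ, ENNReal.ofReal (Real.exp (θ * (k + 1))) * μ {w : ℝ | (k : ℝ) ≤ |w| ^ α} := by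
        have hmeas : ∀ k : ℕ, MeasurableSet {w : ℝ | (k : ℝ) ≤ |w| ^ α} := fun k =>
          measurableSet_le measurable_const (by fun_prop)
        rw [lintegral_tsum fun k => (measurable_const.indicator (hmeas k)).aemeasurable]
        refine tsum_congr fun k => ?_
        rw [lintegral_indicator_const (hmeas k)]
    _ ≤ ∑' k : ℕ, ENNReal.ofReal (C * Real.exp θ * q ^ k) := by
        refine ENNReal.tsum_le_tsum fun k => ?_
        refine (mul_le_mul_right (htail k) _).trans (le_of_eq ?_)
        rw [← ENNReal.ofReal_mul (Real.exp_pos _).le, hq, ← Real.exp_nat_mul]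
        congr 1
        rw [mul_left_comm, ← Real.exp_add, mul_assoc, ← Real.exp_add]
        congr 2
        ring
    _ = ENNReal.ofReal (C * Real.exp θ * (1 - q)⁻¹) := by
        rw [← ENNReal.ofReal_tsum_of_nonneg (fun k => by positivity) hgeom.summable, hgeom.tsum_eq]
    _ ≤ _ := ENNReal.ofReal_le_ofReal (le_max_right _ _)

theorem lintegral_pi_prod_eq [IsProbabilityMeasure μ] {ι : Type*} [Fintype ι] {X : ℝ → ℝ≥0∞}
    (hX : Measurable X) (S : Finset ι) :
    ∫⁻ ω, ∏ p ∈ S, X (ω p) ∂Measure.pi (fun _ : ι => μ) = (∫⁻ w, X w ∂μ) ^ S.card := by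
  have hind : iIndepFun (fun (p : ι) (ω : ι → ℝ) => X (ω p)) (Measure.pi fun _ : ι => μ) :=
    iIndepFun_pi (X := fun _ : ι => X) fun _ => hX.aemeasurable
  have h1 := lintegral_prod_eq_prod_lintegral_of_indepFun S (fun p (ω : ι → ℝ) => X (ω p)) hind
    fun p => hX.comp (measurable_pi_apply p)
  rw [h1, ← Finset.prod_const]
  exact Finset.prod_congr rfl fun p _ =>
    (measurePreserving_eval (fun _ : ι => μ) p).lintegral_comp hX

/-- Chernoff's bound for sums of powers of independent weights. -/
theorem pi_sum_abs_rpow_ge_le [IsProbabilityMeasure μ] {ι : Type*} [Fintype ι] {θ M : ℝ}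
    (hθ : 0 < θ) (hM1 : 1 ≤ M)
    (hM : ∫⁻ w, ENNReal.ofReal (Real.exp (θ * |w| ^ α)) ∂μ ≤ ENNReal.ofReal M)
    (S : Finset ι) {m : ℕ} (hS : S.card ≤ m) (a : ℝ) :
    Measure.pi (fun _ : ι => μ) {ω | a ≤ ∑ p ∈ S, |ω p| ^ α} ≤
      ENNReal.ofReal (M ^ m * Real.exp (-(θ * a))) := by
  set ν := Measure.pi (fun _ : ι => μ) with hν
  let X : ℝ → ℝ≥0∞ := fun w => ENNReal.ofReal (Real.exp (θ * |w| ^ α))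
  have hX : Measurable X := by fun_prop
  have h1 : ∫⁻ ω, ∏ p ∈ S, X (ω p) ∂ν ≤ ENNReal.ofReal (M ^ m) := by
    rw [hν, lintegral_pi_prod_eq hX]
    calc (∫⁻ w, X w ∂μ) ^ S.card ≤ ENNReal.ofReal M ^ S.card := pow_le_pow_left' hM _
      _ = ENNReal.ofReal (M ^ S.card) := (ENNReal.ofReal_pow (by linarith) _).symm
      _ ≤ _ := ENNReal.ofReal_le_ofReal (pow_le_pow_right₀ hM1 hS)
  have hprod : ∀ ω : ι → ℝ, ∏ p ∈ S, X (ω p) =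
      ENNReal.ofReal (Real.exp (θ * ∑ p ∈ S, |ω p| ^ α)) := by
    intro ω
    rw [Finset.mul_sum, Real.exp_sum, ENNReal.ofReal_prod_of_nonneg fun p _ => (Real.exp_pos _).le]
  have hsub : {ω : ι → ℝ | a ≤ ∑ p ∈ S, |ω p| ^ α} ⊆
      {ω | ENNReal.ofReal (Real.exp (θ * a)) ≤ ∏ p ∈ S, X (ω p)} := by
    intro ω hω
    have hω : a ≤ ∑ p ∈ S, |ω p| ^ α := hω
    rw [Set.mem_ofPred_eq, hprod]
    refine ENNReal.ofReal_le_ofReal (Real.exp_le_exp.2 ?_)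
    gcongr
  have hmeas : Measurable fun ω : ι → ℝ => ∏ p ∈ S, X (ω p) :=
    Finset.measurable_fun_prod S fun p _ => hX.comp (measurable_pi_apply p)
  have h3 := mul_meas_ge_le_lintegral (μ := ν) hmeas (ENNReal.ofReal (Real.exp (θ * a)))
  have hexp : ENNReal.ofReal (Real.exp (θ * a)) ≠ 0 := by
    rw [Ne, ENNReal.ofReal_eq_zero, not_le]
    exact Real.exp_pos _
  calc ν {ω | a ≤ ∑ p ∈ S, |ω p| ^ α}
      ≤ ν {ω | ENNReal.ofReal (Real.exp (θ * a)) ≤ ∏ p ∈ S, X (ω p)} := measure_mono hsub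
    _ ≤ ENNReal.ofReal (M ^ m) / ENNReal.ofReal (Real.exp (θ * a)) := by
        rw [ENNReal.le_div_iff_mul_le (Or.inl hexp) (Or.inl ENNReal.ofReal_ne_top), mul_comm]
        exact h3.trans h1
    _ = _ := by
        rw [← ENNReal.ofReal_div_of_pos (Real.exp_pos _), Real.exp_neg, div_eq_mul_inv]

/-- The probability that all weights of a block exceed given thresholds. -/
theorem IsWeibull.exists_pi_block_ge [IsProbabilityMeasure μ] (hμ : IsWeibull μ α) :
    ∃ κ : ℝ, 0 < κ ∧ κ ≤ 1 ∧ ∀ {ι : Type} [Fintype ι] (S : Finset ι) (c : ι → ℝ) (m : ℕ) (a : ℝ),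
      S.card ≤ m → (∀ p ∈ S, 1 ≤ c p) → ∑ p ∈ S, c p ^ α ≤ a →
        κ ^ m * Real.exp (-a) ≤ (Measure.pi (fun _ : ι => μ)).real {ω | ∀ p ∈ S, c p ≤ ω p} := by
  classical
  obtain ⟨C₁, C₂, hC₁, hC₂, h⟩ := hμ
  refine ⟨min 1 (C₁ / 2), lt_min one_pos (by positivity), min_le_left _ _, ?_⟩
  set κ := min 1 (C₁ / 2) with hκ
  have hκ0 : 0 < κ := lt_min one_pos (by positivity)
  intro ι _ S c m a hS hc ha
  have h1 : {ω : ι → ℝ | ∀ p ∈ S, c p ≤ ω p} =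
      Set.univ.pi fun p => if p ∈ S then Set.Ici (c p) else Set.univ := by
    ext ω
    simp only [Set.mem_univ_pi, Set.mem_ofPred_eq]
    refine forall_congr' fun p => ?_
    split_ifs with hp <;> simp [hp]
  rw [h1, measureReal_def, Measure.pi_pi, ENNReal.toReal_prod]
  have h2 : ∀ p, (μ (if p ∈ S then Set.Ici (c p) else Set.univ)).toReal =
      if p ∈ S then μ.real (Set.Ici (c p)) else 1 := by
    intro p
    split_ifs
    · rfl
    · simp
  simp only [h2]
  rw [Finset.prod_ite_mem, Finset.univ_inter]
  calc κ ^ m * Real.exp (-a) ≤ κ ^ S.card * Real.exp (-∑ p ∈ S, c p ^ α) := by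
        exact mul_le_mul (pow_le_pow_of_le_one hκ0.le (min_le_left _ _) hS)
          (Real.exp_le_exp.2 (neg_le_neg ha)) (Real.exp_pos _).le (by positivity)
    _ = ∏ p ∈ S, κ * Real.exp (-(c p ^ α)) := by
        rw [Finset.prod_mul_distrib, Finset.prod_const, ← Finset.sum_neg_distrib, Real.exp_sum]
    _ ≤ _ := by
        refine Finset.prod_le_prod (fun p _ => by positivity) fun p hp => ?_
        refine le_trans ?_ (h (c p) (hc p hp)).1.1
        have := mul_le_mul_of_nonneg_right (min_le_right 1 (C₁ / 2)) (Real.exp_pos (-c p ^ α)).le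
        rw [hκ]
        linarith

/-- Blocks of weights on disjoint index sets are independent: the probability that no block
succeeds decays exponentially in the number of blocks. -/
theorem pi_forall_block_fails_le [IsProbabilityMeasure μ] {ι J : Type*} [Fintype ι]
    (S : J → Finset ι) (c : J → ι → ℝ) {q : ℝ} (I : Finset J)
    (hdisj : (I : Set J).PairwiseDisjoint S)
    (hq : ∀ j ∈ I, q ≤ (Measure.pi (fun _ : ι => μ)).real {ω | ∀ p ∈ S j, c j p ≤ ω p}) :
    (Measure.pi (fun _ : ι => μ)).real {ω | ∀ j ∈ I, ∃ p ∈ S j, ω p < c j p} ≤ (1 - q) ^ I.card := by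
  classical
  set ν := Measure.pi (fun _ : ι => μ) with hν
  have hind : iIndepFun (fun (p : ι) (ω : ι → ℝ) => ω p) ν :=
    iIndepFun_pi (X := fun (_ : ι) (x : ℝ) => x) fun _ => aemeasurable_id
  induction I using Finset.induction_on with
  | empty => simp
  | insert j I hj ih =>
    have ih := ih (hdisj.subset (by simp)) fun i hi => hq i (Finset.mem_insert_of_mem hi)
    have hqj := hq j (Finset.mem_insert_self _ _)
    let U : Finset ι := I.biUnion S
    have hdisjU : Disjoint (S j) U := by
      rw [Finset.disjoint_biUnion_right]
      intro i hi
      exact hdisj (by simp) (by simp [hi]) (fun h => hj (h ▸ hi))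
    have hU : ∀ {i}, i ∈ I → ∀ {p}, p ∈ S i → p ∈ U := fun hi _ hp =>
      Finset.mem_biUnion.2 ⟨_, hi, hp⟩
    have hind' := hind.indepFun_finset (S j) U hdisjU fun p => measurable_pi_apply p
    let E : Set (S j → ℝ) := ⋃ p : S j, {f | f p < c j p}
    let F : Set (U → ℝ) := ⋂ i : I, ⋃ p : S i, {f | f ⟨p, hU i.2 p.2⟩ < c i p}
    have hE : MeasurableSet E := MeasurableSet.iUnion fun p =>
      measurableSet_lt (measurable_pi_apply p) measurable_const
    have hF : MeasurableSet F := MeasurableSet.iInter fun i => MeasurableSet.iUnion fun p =>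
      measurableSet_lt (measurable_pi_apply _) measurable_const
    have h1 := hind'.measure_inter_preimage_eq_mul E F hE hF
    have hE' : (fun (a : ι → ℝ) (i : S j) => a i) ⁻¹' E = {ω | ∃ p ∈ S j, ω p < c j p} := by
      ext ω
      simp [E]
    have hF' : (fun (a : ι → ℝ) (i : U) => a i) ⁻¹' F = {ω | ∀ i ∈ I, ∃ p ∈ S i, ω p < c i p} := by
      ext ω
      simp [F]
    rw [hE', hF'] at h1
    have hset : {ω : ι → ℝ | ∀ i ∈ insert j I, ∃ p ∈ S i, ω p < c i p} =
        {ω | ∃ p ∈ S j, ω p < c j p} ∩ {ω | ∀ i ∈ I, ∃ p ∈ S i, ω p < c i p} := by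
      ext ω
      simp
    have hcompl : {ω : ι → ℝ | ∃ p ∈ S j, ω p < c j p} = {ω | ∀ p ∈ S j, c j p ≤ ω p}ᶜ := by
      ext ω
      simp
    have hmeas : MeasurableSet {ω : ι → ℝ | ∀ p ∈ S j, c j p ≤ ω p} := by
      have : {ω : ι → ℝ | ∀ p ∈ S j, c j p ≤ ω p} = ⋂ p ∈ S j, {ω | c j p ≤ ω p} := by
        ext ω
        simp
      rw [this]
      exact Finset.measurableSet_biInter _ fun p _ =>
        measurableSet_le measurable_const (measurable_pi_apply p)
    rw [hset, measureReal_def, h1, ENNReal.toReal_mul, Finset.card_insert_of_notMem hj, pow_succ']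
    have h2 : ν.real {ω | ∃ p ∈ S j, ω p < c j p} ≤ 1 - q := by
      rw [hcompl, probReal_compl_eq_one_sub hmeas]
      linarith
    exact mul_le_mul h2 ih measureReal_nonneg (measureReal_nonneg.trans h2)

end Weights

/-! ### Events of the random weighted graph -/

section Model

variable {n d : ℕ}

theorem mem_regularGraphs_iff {G : SimpleGraph (Fin n)} :
    G ∈ regularGraphs n d ↔ ∀ v, (G.neighborSet v).ncard = d := by
  classical
  refine forall_congr' fun v => ?_
  rw [← SimpleGraph.coe_neighborFinset, Set.ncard_coe_finset]
  rfl

theorem coe_regularGraphFinset :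
    ((regularGraphFinset (Fin n) d : Finset _) : Set (SimpleGraph (Fin n))) = regularGraphs n d := by
  ext G
  rw [mem_regularGraphs_iff]
  simp [regularGraphFinset]

instance : MeasurableSingletonClass (SimpleGraph (Fin n)) where
  measurableSet_singleton G := by
    have : ({G} : Set (SimpleGraph (Fin n))) = ⋂ u, ⋂ v, {H | H.Adj u v ↔ G.Adj u v} := by
      ext H
      simp only [Set.mem_singleton_iff, Set.mem_iInter, Set.mem_ofPred_eq]
      exact ⟨fun h u v => by rw [h], fun h => SimpleGraph.ext (by ext u v; exact h u v)⟩
    rw [this]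
    refine MeasurableSet.iInter fun u => MeasurableSet.iInter fun v => ?_
    have : Measurable fun H : SimpleGraph (Fin n) => (H.Adj u v ↔ G.Adj u v) := by fun_prop
    exact measurableSet_setOfPred.2 this

theorem measurableSet_simpleGraph (S : Set (SimpleGraph (Fin n))) : MeasurableSet S :=
  (Set.toFinite S).measurableSet

/-- The index set of the independent weights. -/
abbrev Pairs (n : ℕ) : Type := {p : Fin n × Fin n // p.1 < p.2}

/-- The independent entries of a symmetric matrix. -/
def upperEntries (W : Matrix (Fin n) (Fin n) ℝ) : Pairs n → ℝ := fun p => W p.1.1 p.1.2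

variable {Ω : Type*} [MeasurableSpace Ω] {P : Measure Ω} {μ : Measure ℝ}
  {A : Ω → SimpleGraph (Fin n)} {W : Ω → Matrix (Fin n) (Fin n) ℝ}

theorem IsModel.map_upperEntries (h : IsModel P n d μ A W) :
    AEMeasurable (fun ω => upperEntries (W ω)) P ∧
      P.map (fun ω => upperEntries (W ω)) = Measure.pi fun _ : Pairs n => μ := by
  have h1 : ∀ p : Pairs n, AEMeasurable (fun ω => W ω p.1.1 p.1.2) P :=
    fun p => (h.weight_law _ _ p.2).aemeasurable
  refine ⟨aemeasurable_pi_lambda _ h1, ?_⟩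
  have h2 := h.weight_indep.map_fun_eq_pi_map h1
  refine h2.trans ?_
  congr 1
  ext1 p
  exact (h.weight_law _ _ p.2).map_eq

theorem IsModel.ae_isRegular (h : IsModel P n d μ A W) :
    P (A ⁻¹' (regularGraphs n d)ᶜ) = 0 := by
  rw [← Measure.map_apply_of_aemeasurable h.graph_law.aemeasurable (measurableSet_simpleGraph _),
    h.graph_law.map_eq, uniformOn_eq_zero_iff (Set.toFinite _)]
  exact Set.inter_compl_self _

/-- Conditioning on the graph: a bound for each regular graph in `𝒢` gives the same bound for the
random graph. -/
theorem IsModel.measure_le [IsProbabilityMeasure P] (h : IsModel P n d μ A W)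
    (𝒢 : Set (SimpleGraph (Fin n)))
    (E : SimpleGraph (Fin n) → Set (Pairs n → ℝ)) (hE : ∀ G, MeasurableSet (E G)) (η : ℝ≥0∞)
    (hη : ∀ G ∈ 𝒢, (∀ v, (G.neighborSet v).ncard = d) →
      Measure.pi (fun _ : Pairs n => μ) (E G) ≤ η) :
    P {ω | A ω ∈ 𝒢 ∧ upperEntries (W ω) ∈ E (A ω)} ≤ η := by
  classical
  obtain ⟨hmeas, hlaw⟩ := h.map_upperEntries
  have hA := h.graph_law.aemeasurable
  have hsub : {ω | A ω ∈ 𝒢 ∧ upperEntries (W ω) ∈ E (A ω)} ⊆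
      ⋃ G ∈ (Finset.univ : Finset (SimpleGraph (Fin n))),
        if G ∈ 𝒢 then A ⁻¹' {G} ∩ (fun ω => upperEntries (W ω)) ⁻¹' E G else ∅ := by
    rintro ω ⟨h1, h2⟩
    simp only [Set.mem_iUnion, Finset.mem_univ]
    exact ⟨A ω, trivial, by rw [if_pos h1]; exact ⟨rfl, h2⟩⟩
  have hterm : ∀ G, P (if G ∈ 𝒢 then A ⁻¹' {G} ∩ (fun ω => upperEntries (W ω)) ⁻¹' E G else ∅) ≤
      P.map A {G} * η := by
    intro G
    split_ifs with hG
    · have hind := h.graph_weight_indep.measure_inter_preimage_eq_mul {G} (E G)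
        (measurableSet_simpleGraph _) (hE G)
      have hind' : P (A ⁻¹' {G} ∩ (fun ω => upperEntries (W ω)) ⁻¹' E G) =
          P (A ⁻¹' {G}) * P ((fun ω => upperEntries (W ω)) ⁻¹' E G) := hind
      rw [hind', ← Measure.map_apply_of_aemeasurable hA (measurableSet_simpleGraph _),
        ← Measure.map_apply_of_aemeasurable hmeas (hE G), hlaw]
      by_cases hreg : ∀ v, (G.neighborSet v).ncard = d
      · gcongr
        exact hη G hG hreg
      · have : P.map A {G} = 0 := by
          rw [Measure.map_apply_of_aemeasurable hA (measurableSet_simpleGraph _)]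
          refine measure_mono_null (Set.preimage_mono ?_) h.ae_isRegular
          rw [Set.singleton_subset_iff, Set.mem_compl_iff, mem_regularGraphs_iff]
          exact hreg
        simp [this]
    · simp
  calc _ ≤ _ := measure_mono hsub
    _ ≤ _ := measure_biUnion_finset_le _ _
    _ ≤ ∑ G, P.map A {G} * η := Finset.sum_le_sum fun G _ => hterm G
    _ = P.map A Set.univ * η := by
        rw [← Finset.sum_mul, sum_measure_singleton, Finset.coe_univ]
    _ ≤ η := by
        have : IsProbabilityMeasure (P.map A) := Measure.isProbabilityMeasure_map hA
        simp

open Classical in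
/-- The number of vertices that are not tree-like to depth `R`. -/
noncomputable def badCount (d : ℕ) (G : SimpleGraph (Fin n)) (R : ℕ) : ℕ :=
  (Finset.univ.filter fun v => ¬ IsTreeLike d G v R).card

/-- Markov's inequality for the number of vertices that are not tree-like. -/
theorem exists_measure_badCount_ge_le (hd : 2 ≤ d) (R : ℕ) :
    ∃ C : ℝ, 0 ≤ C ∧ ∃ N : ℕ, ∀ {n : ℕ} {Ω : Type*} [MeasurableSpace Ω] {P : Measure Ω}
      [IsProbabilityMeasure P] {μ : Measure ℝ} {A : Ω → SimpleGraph (Fin n)}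
      {W : Ω → Matrix (Fin n) (Fin n) ℝ}, IsModel P n d μ A W → N ≤ n → ∀ T : ℝ, 0 < T →
        P {ω | T ≤ badCount d (A ω) R} ≤ ENNReal.ofReal (C / T) := by
  classical
  refine ⟨(∑ m ∈ Finset.Icc 2 (2 * R), d ^ (m + 2) * (d + 1) ^ (3 * R) : ℕ), Nat.cast_nonneg _,
    2 * (2 * R + 1) * d + 2 * (d * d) + 1, ?_⟩
  intro n Ω _ P _ μ A W h hn T hT
  set C := ∑ m ∈ Finset.Icc 2 (2 * R), d ^ (m + 2) * (d + 1) ^ (3 * R) with hC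
  have hsum := sum_card_not_isTreeLike_le (V := Fin n) hd R (by rw [Fintype.card_fin]; omega)
  rw [← hC] at hsum
  set Reg := regularGraphFinset (Fin n) d with hReg
  let Bad : Finset (SimpleGraph (Fin n)) := Finset.univ.filter fun G => T ≤ badCount d G R
  have hlaw : P {ω | T ≤ badCount d (A ω) R} = uniformOn (Reg : Set (SimpleGraph (Fin n))) Bad := by
    rw [hReg, coe_regularGraphFinset, ← h.graph_law.map_eq,
      Measure.map_apply_of_aemeasurable h.graph_law.aemeasurable (measurableSet_simpleGraph _)]
    congr 1
    ext ω
    simp [Bad]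
  have hcard : ((Reg ∩ Bad).card : ℝ) * T ≤ Reg.card * C := by
    have h1 : ((Reg ∩ Bad).card : ℝ) * T ≤ ∑ G ∈ Reg ∩ Bad, (badCount d G R : ℝ) := by
      rw [← nsmul_eq_mul]
      refine Finset.card_nsmul_le_sum _ _ _ fun G hG => ?_
      simpa [Bad] using (Finset.mem_inter.1 hG).2
    have h2 : ∑ G ∈ Reg ∩ Bad, (badCount d G R : ℝ) ≤ ∑ G ∈ Reg, (badCount d G R : ℝ) :=
      Finset.sum_le_sum_of_subset_of_nonneg Finset.inter_subset_left fun _ _ _ => Nat.cast_nonneg _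
    have h3 : ∑ G ∈ Reg, (badCount d G R : ℝ) ≤ Reg.card * C := by exact_mod_cast hsum
    linarith
  rw [hlaw, uniformOn_apply_finset]
  rcases Nat.eq_zero_or_pos Reg.card with h0 | h0
  · have : (Reg ∩ Bad).card = 0 :=
      Nat.le_zero.1 ((Finset.card_le_card Finset.inter_subset_left).trans h0.le)
    simp [this]
  · have h0' : (0 : ℝ) < Reg.card := by exact_mod_cast h0
    rw [← ENNReal.ofReal_natCast, ← ENNReal.ofReal_natCast, ← ENNReal.ofReal_div_of_pos h0']
    refine ENNReal.ofReal_le_ofReal ?_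
    rw [div_le_div_iff₀ h0' hT]
    linarith

open Classical in
/-- The pairs that are edges of `G` inside `S`. -/
noncomputable def edgePairs (G : SimpleGraph (Fin n)) (S : Finset (Fin n)) : Finset (Pairs n) :=
  {p | G.Adj p.1.1 p.1.2 ∧ p.1.1 ∈ S ∧ p.1.2 ∈ S}

theorem card_edgePairs_le {G : SimpleGraph (Fin n)} (hG : ∀ v, (G.neighborSet v).ncard = d)
    (S : Finset (Fin n)) : (edgePairs G S).card ≤ S.card * d := by
  classical
  rw [← card_darts_from hG S]
  refine Finset.card_le_card_of_injOn Subtype.val ?_ Subtype.val_injective.injOn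
  intro p hp
  simp only [edgePairs, Finset.coe_filter, Finset.mem_univ, true_and, Set.mem_ofPred_eq] at hp ⊢
  exact ⟨hp.2.1, hp.1⟩

theorem graphPowerSum_eq_two_mul (G : SimpleGraph (Fin n)) {W : Matrix (Fin n) (Fin n) ℝ}
    (hW : W.IsSymm) (α : ℝ) (S : Finset (Fin n)) :
    graphPowerSum G W α S = 2 * ∑ p ∈ edgePairs G S, |upperEntries W p| ^ α := by
  classical
  have h1 : graphPowerSum G W α S =
      ∑ p ∈ (S ×ˢ S).filter fun p => G.Adj p.1 p.2, |W p.1 p.2| ^ α := by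
    rw [Finset.sum_filter, Finset.sum_product]
    rfl
  have h2 : ∑ p ∈ edgePairs G S, |upperEntries W p| ^ α =
      ∑ p ∈ ((S ×ˢ S).filter fun p => G.Adj p.1 p.2) with p.1 < p.2, |W p.1 p.2| ^ α := by
    refine Finset.sum_bij (fun p _ => p.1) ?_ (fun p _ q _ h => Subtype.ext h) ?_ fun p _ => rfl
    · intro p hp
      simp only [edgePairs, Finset.mem_filter_univ] at hp
      simp only [Finset.mem_filter, Finset.mem_product]
      exact ⟨⟨hp.2, hp.1⟩, p.2⟩
    · intro p hp
      simp only [Finset.mem_filter, Finset.mem_product] at hp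
      refine ⟨⟨p, hp.2⟩, ?_, rfl⟩
      simp only [edgePairs, Finset.mem_filter_univ]
      exact ⟨hp.1.2, hp.1.1⟩
  have h3 : ∑ p ∈ ((S ×ˢ S).filter fun p => G.Adj p.1 p.2) with ¬ p.1 < p.2, |W p.1 p.2| ^ α =
      ∑ p ∈ ((S ×ˢ S).filter fun p => G.Adj p.1 p.2) with p.1 < p.2, |W p.1 p.2| ^ α := by
    refine Finset.sum_bij (fun p _ => p.swap) ?_ (fun p _ q _ h => Prod.swap_injective h) ?_ ?_
    · rintro ⟨i, j⟩ hp
      simp only [Finset.mem_filter, Finset.mem_product, Prod.swap] at hp ⊢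
      exact ⟨⟨⟨hp.1.1.2, hp.1.1.1⟩, hp.1.2.symm⟩, lt_of_le_of_ne (not_lt.1 hp.2) hp.1.2.ne'⟩
    · rintro ⟨i, j⟩ hp
      simp only [Finset.mem_filter, Finset.mem_product] at hp
      refine ⟨(j, i), ?_, rfl⟩
      simp only [Finset.mem_filter, Finset.mem_product]
      exact ⟨⟨⟨hp.1.1.2, hp.1.1.1⟩, hp.1.2.symm⟩, not_lt.2 hp.2.le⟩
    · rintro ⟨i, j⟩ _
      simp only [Prod.swap]
      rw [hW.apply]
  rw [h1, ← Finset.sum_filter_add_sum_filter_not _ fun p => p.1 < p.2, h3, h2]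
  ring

/-- Disjoint balls of radius `r` around a positive fraction of the vertices in `X`. -/
theorem exists_disjoint_graphBalls {G : SimpleGraph (Fin n)}
    (hG : ∀ v, (G.neighborSet v).ncard = d) (X : Finset (Fin n)) (r : ℕ) :
    ∃ I ⊆ X, (I : Set (Fin n)).PairwiseDisjoint (fun v => graphBall G v r) ∧
      X.card ≤ I.card * (d + 1) ^ (2 * r) := by
  classical
  have hself : ∀ v : Fin n, v ∈ graphBall G v r := fun v => mem_graphBall.2 ⟨.nil, by simp⟩
  let F : Finset (Finset (Fin n)) := X.powerset.filter fun I =>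
    (I : Set (Fin n)).PairwiseDisjoint (fun v => graphBall G v r)
  have hF : F.Nonempty := ⟨∅, by simp [F]⟩
  -- A maximal disjoint family: the balls of twice the radius cover `X`.
  obtain ⟨I, hI, hmax⟩ := F.exists_max_image Finset.card hF
  simp only [F, Finset.mem_filter, Finset.mem_powerset] at hI hmax
  refine ⟨I, hI.1, hI.2, ?_⟩
  have hsub : X ⊆ I.biUnion fun i => graphBall G i (2 * r) := by
    intro x hx
    rw [Finset.mem_biUnion]
    by_contra! hcon
    have hdisj : ∀ i ∈ I, Disjoint (graphBall G x r) (graphBall G i r) := by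
      intro i hi
      rw [Finset.disjoint_left]
      intro w hw hw'
      refine hcon i hi ?_
      rw [two_mul]
      exact graphBall_trans hw' (mem_graphBall_comm.1 hw)
    have hxI : x ∉ I := fun h => Finset.disjoint_left.1 (hdisj x h) (hself x) (hself x)
    have := hmax (insert x I) ⟨Finset.insert_subset hx hI.1, by
      rw [Finset.coe_insert]
      exact hI.2.insert fun i hi _ => hdisj i hi⟩
    rw [Finset.card_insert_of_notMem hxI] at this
    omega
  exact (Finset.card_le_card hsub).trans
    (Finset.card_biUnion_le_card_mul _ _ _ fun i _ => card_graphBall_le hG i _)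

end Model

/-! ### Upper and lower tails of the largest eigenvalue -/

section Tails

variable {n d : ℕ} {Ω : Type*} [MeasurableSpace Ω] {P : Measure Ω} {μ : Measure ℝ}
  {A : Ω → SimpleGraph (Fin n)} {W : Ω → Matrix (Fin n) (Fin n) ℝ}

theorem measurableSet_le_sum_abs_rpow {ι : Type*} [Fintype ι] (S : Finset ι) (α a : ℝ) :
    MeasurableSet {w : ι → ℝ | a ≤ ∑ p ∈ S, |w p| ^ α} :=
  measurableSet_le measurable_const (by fun_prop)

/-- The upper tail. The sum of the powers of the weights in a ball exceeds `S` for some centre with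
small probability, and it exceeds the smaller level `τ ^ α` for one of the few centres that are not
tree-like with small probability. -/
theorem IsModel.measure_lt_largestEigenvalue_le [IsProbabilityMeasure P] [IsProbabilityMeasure μ]
    (h : IsModel P n d μ A W) (hn : 0 < n) {α τ S H T θ M θ' M' : ℝ} {K : ℕ} (hα : 0 < α)
    (hH : 0 ≤ H) (hτ : 0 ≤ τ) (hS : 0 ≤ S) (hbound : TreeUpperBound d α H) (hK1 : 1 ≤ K)
    (hK : 2 * S < K * τ ^ α) (hT : 0 ≤ T)
    (hθ : 0 < θ) (hM1 : 1 ≤ M)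
    (hM : ∫⁻ w, ENNReal.ofReal (Real.exp (θ * |w| ^ α)) ∂μ ≤ ENNReal.ofReal M)
    (hθ' : 0 < θ') (hM1' : 1 ≤ M')
    (hM' : ∫⁻ w, ENNReal.ofReal (Real.exp (θ' * |w| ^ α)) ∂μ ≤ ENNReal.ofReal M') :
    P {ω | d * τ + H * S ^ (1 / α) < largestEigenvalue (weightedMatrix (A ω) (W ω))} ≤
      P {ω | T ≤ badCount d (A ω) (K + 1)} +
        (ENNReal.ofReal (n * (M ^ ((d + 1) ^ K * d) * Real.exp (-(θ * S)))) +
          ENNReal.ofReal (T * (M' ^ ((d + 1) ^ K * d) * Real.exp (-(θ' * τ ^ α))))) := by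
  classical
  set m := (d + 1) ^ K * d with hm
  let F : SimpleGraph (Fin n) → Fin n → ℝ → Set (Pairs n → ℝ) := fun G v a =>
    {w | a ≤ ∑ p ∈ edgePairs G (graphBall G v K), |w p| ^ α}
  have hF : ∀ G v a, MeasurableSet (F G v a) := fun G v a => measurableSet_le_sum_abs_rpow _ _ _
  let E₁ : SimpleGraph (Fin n) → Set (Pairs n → ℝ) := fun G => ⋃ v ∈ (Finset.univ : Finset (Fin n)),
    F G v S
  let E₂ : SimpleGraph (Fin n) → Set (Pairs n → ℝ) := fun G =>
    ⋃ v ∈ (Finset.univ : Finset (Fin n)).filter fun v => ¬ IsTreeLike d G v (K + 1), F G v (τ ^ α)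
  have hcard : ∀ G : SimpleGraph (Fin n), (∀ v, (G.neighborSet v).ncard = d) → ∀ v,
      (edgePairs G (graphBall G v K)).card ≤ m := fun G hG v =>
    (card_edgePairs_le hG _).trans (Nat.mul_le_mul_right _ (card_graphBall_le hG v K))
  have h₁ := h.measure_le Set.univ E₁ (fun G => Finset.measurableSet_biUnion _ fun v _ => hF _ _ _)
    (ENNReal.ofReal (n * (M ^ m * Real.exp (-(θ * S))))) fun G _ hG => by
      refine (measure_biUnion_finset_le _ _).trans ?_
      refine (Finset.sum_le_card_nsmul _ _ _ fun v _ =>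
        pi_sum_abs_rpow_ge_le hθ hM1 hM _ (hcard G hG v) S).trans (le_of_eq ?_)
      rw [Finset.card_univ, Fintype.card_fin, nsmul_eq_mul, ENNReal.ofReal_mul (Nat.cast_nonneg _),
        ENNReal.ofReal_natCast]
  have h₂ := h.measure_le {G | (badCount d G (K + 1) : ℝ) < T} E₂
    (fun G => Finset.measurableSet_biUnion _ fun v _ => hF _ _ _)
    (ENNReal.ofReal (T * (M' ^ m * Real.exp (-(θ' * τ ^ α))))) fun G hbad hG => by
      refine (measure_biUnion_finset_le _ _).trans ?_
      refine (Finset.sum_le_card_nsmul _ _ _ fun v _ =>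
        pi_sum_abs_rpow_ge_le hθ' hM1' hM' _ (hcard G hG v) (τ ^ α)).trans ?_
      rw [nsmul_eq_mul, ENNReal.ofReal_mul hT]
      gcongr
      rw [← ENNReal.ofReal_natCast]
      exact ENNReal.ofReal_le_ofReal (le_of_lt hbad)
  have hsub : {ω | d * τ + H * S ^ (1 / α) < largestEigenvalue (weightedMatrix (A ω) (W ω))} ⊆
      A ⁻¹' (regularGraphs n d)ᶜ ∪ ({ω | T ≤ badCount d (A ω) (K + 1)} ∪
        ({ω | A ω ∈ Set.univ ∧ upperEntries (W ω) ∈ E₁ (A ω)} ∪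
          {ω | A ω ∈ {G | (badCount d G (K + 1) : ℝ) < T} ∧ upperEntries (W ω) ∈ E₂ (A ω)})) := by
    intro ω hω
    by_contra hcon
    simp only [Set.mem_union, not_or, Set.mem_preimage, Set.mem_compl_iff, not_not,
      Set.mem_ofPred_eq, Set.mem_univ, true_and, not_le, not_and] at hcon hω
    obtain ⟨hreg, hbad, hE₁, hE₂⟩ := hcon
    have hE₂ := hE₂ hbad
    rw [mem_regularGraphs_iff] at hreg
    simp only [E₁, E₂, F, Set.mem_iUnion, Finset.mem_univ, Finset.mem_filter, Set.mem_ofPred_eq,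
      exists_prop, true_and, not_exists, not_and, not_le] at hE₁ hE₂
    refine absurd hω (not_lt.2 ?_)
    refine largestEigenvalue_weightedMatrix_le hn hreg (h.weight_symm ω) hα hH hτ hS hbound
      (fun v => ?_) hK fun v hv j hvj => ?_
    · rw [graphPowerSum_eq_two_mul _ (h.weight_symm ω)]
      linarith [hE₁ v]
    · have h3 : graphPowerSum (A ω) (W ω) α (graphBall (A ω) v K) < 2 * τ ^ α := by
        rw [graphPowerSum_eq_two_mul _ (h.weight_symm ω)]
        linarith [hE₂ v hv]
      rw [graphPowerSum_eq_two_mul _ (h.weight_symm ω)] at h3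
      have hvb : v ∈ graphBall (A ω) v K := mem_graphBall.2 ⟨.nil, by simp⟩
      have hjb : j ∈ graphBall (A ω) v K :=
        mem_graphBall.2 ⟨.cons hvj .nil, by simpa using hK1⟩
      have h4 : ∀ p ∈ edgePairs (A ω) (graphBall (A ω) v K), |upperEntries (W ω) p| ^ α < τ ^ α := by
        intro p hp
        have := Finset.single_le_sum (f := fun p => |upperEntries (W ω) p| ^ α)
          (fun p _ => by positivity) hp
        linarith
      have h5 : |W ω v j| ^ α < τ ^ α := by
        rcases lt_or_gt_of_ne hvj.ne with hlt | hlt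
        · exact h4 ⟨(v, j), hlt⟩ (by simp [edgePairs, hvj, hvb, hjb])
        · rw [← (h.weight_symm ω).apply]
          exact h4 ⟨(j, v), hlt⟩ (by simp [edgePairs, hvj.symm, hvb, hjb])
      exact not_lt.1 fun hlt => absurd h5 (not_lt.2 (Real.rpow_le_rpow hτ hlt.le hα.le))
  calc _ ≤ _ := measure_mono hsub
    _ ≤ P (A ⁻¹' (regularGraphs n d)ᶜ) + _ := measure_union_le _ _
    _ ≤ _ := by
      rw [h.ae_isRegular, zero_add]
      refine (measure_union_le _ _).trans ?_
      gcongr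
      refine (measure_union_le _ _).trans ?_
      gcongr

/-- Given a graph with many tree-like vertices, disjoint balls provide independent attempts to
realize a prescribed weighted tree; if one of them succeeds, the largest eigenvalue is large. -/
theorem exists_measurableSet_largestEigenvalue_ge [IsProbabilityMeasure μ] {α κ L c : ℝ}
    (hκ0 : 0 < κ) (hκ1 : κ ≤ 1)
    (hκ : ∀ (S : Finset (Pairs n)) (c : Pairs n → ℝ) (m : ℕ) (a : ℝ),
      S.card ≤ m → (∀ p ∈ S, 1 ≤ c p) → ∑ p ∈ S, c p ^ α ≤ a →
        κ ^ m * Real.exp (-a) ≤ (Measure.pi (fun _ : Pairs n => μ)).real {ω | ∀ p ∈ S, c p ≤ ω p})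
    (hL : 0 < L) (hc : 0 ≤ c) {B : Finset (TreeVertex d)} {R : ℕ} (hB : ∀ s ∈ B, s.1.length ≤ R)
    {w : TreeVertex d → TreeVertex d → ℝ} {x : TreeVertex d → ℝ} (hw : ∀ s t, 0 ≤ w s t)
    (hwsymm : ∀ s t, w s t = w t s) (hx : ∀ s, 0 ≤ x s) (hx1 : ∑ s ∈ B, x s ^ 2 ≤ 1)
    (hcx : c < treeSum B (fun s t => w s t * (x s * x t)))
    {G : SimpleGraph (Fin n)} (hG : ∀ v, (G.neighborSet v).ncard = d)
    (hbad : (badCount d G (R + 1) : ℝ) < n / 2) :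
    ∃ E : Set (Pairs n → ℝ), MeasurableSet E ∧
      Measure.pi (fun _ : Pairs n => μ) E ≤ ENNReal.ofReal (Real.exp (-(κ ^ (outEdges B).card *
        Real.exp (-((outEdges B).card + L ^ α * (treeSum B (fun s t => w s t ^ α) / 2))) *
          (n / (2 * (d + 1) ^ (2 * R)))))) ∧
      ∀ W : Matrix (Fin n) (Fin n) ℝ, W.IsSymm → upperEntries W ∉ E →
        c * L ≤ largestEigenvalue (weightedMatrix G W) := by
  classical
  set m := (outEdges B).card with hm
  set a := m + L ^ α * (treeSum B (fun s t => w s t ^ α) / 2) with ha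
  set q := κ ^ m * Real.exp (-a) with hq
  have hφ : ∀ v, ∃ φ : TreeVertex d → Fin n, IsTreeLike d G v (R + 1) →
      IsCovering G φ ∧ φ (treeRoot d) = v ∧ Set.InjOn φ {s | s.1.length ≤ R + 1} := by
    intro v
    by_cases hv : IsTreeLike d G v (R + 1)
    · obtain ⟨φ, h⟩ := hv
      exact ⟨φ, fun _ => h⟩
    · exact ⟨fun _ => v, fun h => absurd h hv⟩
  choose φ hφ using hφ
  -- `S v` is the image of the edges of the prescribed tree under the covering based at `v`, and
  -- `e v` recovers the edge of the tree.
  let S : Fin n → Finset (Pairs n) := fun v => Finset.univ.filter fun p =>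
    ∃ e ∈ outEdges B, s(φ v e.1, φ v e.2) = s(p.1.1, p.1.2)
  have he : ∀ (v : Fin n) (p : Pairs n), ∃ e : TreeVertex d × TreeVertex d,
      p ∈ S v → e ∈ outEdges B ∧ s(φ v e.1, φ v e.2) = s(p.1.1, p.1.2) := by
    intro v p
    by_cases hp : p ∈ S v
    · obtain ⟨e, h⟩ := (Finset.mem_filter.1 hp).2
      exact ⟨e, fun _ => h⟩
    · exact ⟨(treeRoot d, treeRoot d), fun h => absurd h hp⟩
  choose e he using he
  have heinj : ∀ v, Set.InjOn (e v) (S v) := by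
    intro v p hp p' hp' heq
    have h1 := (he v p hp).2
    have h2 := (he v p' hp').2
    rw [heq, h2, Sym2.eq_iff] at h1
    rcases h1 with ⟨h3, h4⟩ | ⟨h3, h4⟩
    · exact Subtype.ext (Prod.ext h3.symm h4.symm)
    · have := p.2
      have := p'.2
      omega
  -- The thresholds are raised to `1`, since the lower tail bound of the weights holds only from there;
  -- this adds at most `1` per edge to the cost.
  let cc : Fin n → Pairs n → ℝ := fun v p => max 1 (L * w (e v p).1 (e v p).2)
  have himage : ∀ v, (S v).image (e v) ⊆ outEdges B := by
    intro v f hf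
    obtain ⟨p, hp, rfl⟩ := Finset.mem_image.1 hf
    exact (he v p hp).1
  have hScard : ∀ v, (S v).card ≤ m := fun v => by
    rw [← Finset.card_image_of_injOn (heinj v)]
    exact Finset.card_le_card (himage v)
  have hcost : ∀ v, ∑ p ∈ S v, cc v p ^ α ≤ a := by
    intro v
    let g : TreeVertex d × TreeVertex d → ℝ := fun f => max 1 (L * w f.1 f.2) ^ α
    have h1 : ∑ p ∈ S v, cc v p ^ α = ∑ f ∈ (S v).image (e v), g f :=
      (Finset.sum_image (f := g) (heinj v)).symm
    have h2 : ∀ f, g f ≤ 1 + L ^ α * w f.1 f.2 ^ α := by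
      intro f
      have h0 : 0 ≤ L * w f.1 f.2 := mul_nonneg hL.le (hw _ _)
      rw [← Real.mul_rpow hL.le (hw _ _)]
      have h3 : 0 ≤ (L * w f.1 f.2) ^ α := Real.rpow_nonneg h0 _
      rcases le_total 1 (L * w f.1 f.2) with h | h
      · simp only [g, max_eq_right h]
        linarith
      · simp only [g, max_eq_left h, Real.one_rpow]
        linarith
    rw [h1]
    calc ∑ f ∈ (S v).image (e v), g f ≤ ∑ f ∈ outEdges B, g f :=
          Finset.sum_le_sum_of_subset_of_nonneg (himage v) fun f _ _ => by positivity
      _ ≤ ∑ f ∈ outEdges B, (1 + L ^ α * w f.1 f.2 ^ α) := Finset.sum_le_sum fun f _ => h2 f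
      _ = a := by
          rw [Finset.sum_add_distrib, ← Finset.mul_sum, ha,
            treeSum_eq_two_mul B fun s t => by rw [hwsymm]]
          simp [hm]
  let X : Finset (Fin n) := Finset.univ.filter fun v => IsTreeLike d G v (R + 1)
  obtain ⟨I, hIX, hIdisj, hIcard⟩ := exists_disjoint_graphBalls hG X R
  have hSball : ∀ v ∈ X, ∀ p ∈ S v, p.1.1 ∈ graphBall G v R := by
    intro v hv p hp
    obtain ⟨hcov, hroot, -⟩ := hφ v (Finset.mem_filter.1 hv).2
    obtain ⟨h1, h2⟩ := he v p hp
    simp only [outEdges, Finset.mem_filter, Finset.mem_product] at h1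
    rw [Sym2.eq_iff] at h2
    have h3 : ∀ s ∈ B, φ v s ∈ graphBall G v R := by
      intro s hs
      have := hcov.mem_graphBall (hB s hs)
      rwa [hroot] at this
    rcases h2 with ⟨h2, -⟩ | ⟨-, h2⟩
    · exact h2 ▸ h3 _ h1.1.1
    · exact h2 ▸ h3 _ h1.1.2
  have hdisj : (I : Set (Fin n)).PairwiseDisjoint S := by
    intro v hv v' hv' hne
    rw [Function.onFun, Finset.disjoint_left]
    intro p hp hp'
    exact Finset.disjoint_left.1 (hIdisj hv hv' hne) (hSball v (hIX hv) p hp)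
      (hSball v' (hIX hv') p hp')
  -- The exceptional event: each attempt misses one of its thresholds.
  refine ⟨{ω | ∀ v ∈ I, ∃ p ∈ S v, ω p < cc v p}, ?_, ?_, ?_⟩
  · have : {ω : Pairs n → ℝ | ∀ v ∈ I, ∃ p ∈ S v, ω p < cc v p} =
        ⋂ v ∈ I, ⋃ p ∈ S v, {ω | ω p < cc v p} := by
      ext ω
      simp
    rw [this]
    exact Finset.measurableSet_biInter _ fun v _ => Finset.measurableSet_biUnion _ fun p _ =>
      measurableSet_lt (measurable_pi_apply p) measurable_const
  · have h1 := pi_forall_block_fails_le (μ := μ) S cc (q := q) I hdisj fun v _ =>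
      hκ (S v) (cc v) m a (hScard v) (fun p _ => le_max_left _ _) (hcost v)
    rw [← ofReal_measureReal]
    refine ENNReal.ofReal_le_ofReal (h1.trans ?_)
    have hq0 : 0 ≤ q := by positivity
    have ha0 : 0 ≤ a := by
      have : 0 ≤ treeSum B (fun s t => w s t ^ α) :=
        treeSum_nonneg fun s t => Real.rpow_nonneg (hw s t) _
      positivity
    have hq1 : q ≤ 1 := by
      have h2 : Real.exp (-a) ≤ 1 := Real.exp_le_one_iff.2 (by linarith)
      calc q ≤ 1 * 1 := mul_le_mul (pow_le_one₀ hκ0.le hκ1) h2 (Real.exp_pos _).le zero_le_one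
        _ = 1 := one_mul 1
    have hcount : (n : ℝ) / (2 * (d + 1) ^ (2 * R)) ≤ I.card := by
      have h2 : (X.card : ℝ) ≤ I.card * (d + 1) ^ (2 * R) := by exact_mod_cast hIcard
      have h3 : X.card + badCount d G (R + 1) = n := by
        have := Finset.card_filter_add_card_filter_not (s := (Finset.univ : Finset (Fin n)))
          fun v => IsTreeLike d G v (R + 1)
        rw [Finset.card_univ, Fintype.card_fin] at this
        exact this
      have h4 : (X.card : ℝ) + badCount d G (R + 1) = n := by exact_mod_cast h3
      rw [div_le_iff₀ (by positivity)]
      linarith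
    calc (1 - q) ^ I.card ≤ Real.exp (-q) ^ I.card :=
          pow_le_pow_left₀ (by linarith) (Real.one_sub_le_exp_neg q) _
      _ = Real.exp (-(q * I.card)) := by
          rw [← Real.exp_nat_mul]
          congr 1
          ring
      _ ≤ _ := by
          refine Real.exp_le_exp.2 (neg_le_neg ?_)
          gcongr
  · intro W hW hE
    simp only [Set.mem_ofPred_eq, not_forall, not_exists, not_and, not_lt] at hE
    obtain ⟨v, hv, hE⟩ := hE
    obtain ⟨hcov, hroot, hinj⟩ := hφ v (Finset.mem_filter.1 (hIX hv)).2
    refine le_largestEigenvalue_weightedMatrix hW hcov hinj hB hx hx1 hc hcx hL ?_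
    have key : ∀ f ∈ outEdges B, w f.1 f.2 * L ≤ W (φ v f.1) (φ v f.2) := by
      rintro ⟨s, t⟩ hf
      have hf' := hf
      simp only [outEdges, Finset.mem_filter, Finset.mem_product] at hf'
      have hadj := hcov.adj hf'.2.1
      obtain ⟨p, hp⟩ : ∃ p : Pairs n, s(φ v s, φ v t) = s(p.1.1, p.1.2) := by
        rcases lt_or_gt_of_ne hadj.ne with hlt | hlt
        · exact ⟨⟨(φ v s, φ v t), hlt⟩, rfl⟩
        · exact ⟨⟨(φ v t, φ v s), hlt⟩, Sym2.eq_swap⟩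
      have hpS : p ∈ S v := Finset.mem_filter.2 ⟨Finset.mem_univ _, ⟨(s, t), hf, hp⟩⟩
      obtain ⟨h1, h2⟩ := he v p hpS
      simp only [outEdges, Finset.mem_filter, Finset.mem_product] at h1
      have hBinj : Set.InjOn (φ v) B := hinj.mono fun s hs => (hB s hs).trans (Nat.le_succ R)
      have h3 : w (e v p).1 (e v p).2 = w s t := by
        rw [← hp, Sym2.eq_iff] at h2
        rcases h2 with ⟨h2, h2'⟩ | ⟨h2, h2'⟩
        · rw [hBinj h1.1.1 hf'.1.1 h2, hBinj h1.1.2 hf'.1.2 h2']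
        · rw [hBinj h1.1.1 hf'.1.2 h2, hBinj h1.1.2 hf'.1.1 h2', hwsymm]
      have h4 : L * w s t ≤ upperEntries W p := by
        refine le_trans ?_ (hE p hpS)
        simp only [cc, h3]
        exact le_max_right _ _
      have h5 : upperEntries W p = W (φ v s) (φ v t) := by
        rw [Sym2.eq_iff] at hp
        rcases hp with ⟨h, h'⟩ | ⟨h, h'⟩
        · rw [h, h']
          rfl
        · rw [h, h', hW.apply]
          rfl
      rw [h5] at h4
      simp only
      linarith
    intro s hs t ht hadj
    rcases hadj with ⟨b, hb⟩ | ⟨b, hb⟩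
    · refine key (s, t) ?_
      simp only [outEdges, Finset.mem_filter, Finset.mem_product]
      exact ⟨⟨hs, ht⟩, Or.inl ⟨b, hb⟩, by simp [hb]⟩
    · have := key (t, s) (by
        simp only [outEdges, Finset.mem_filter, Finset.mem_product]
        exact ⟨⟨ht, hs⟩, Or.inl ⟨b, hb⟩, by simp [hb]⟩)
      rw [hwsymm, ← hW.apply]
      exact this

/-- The lower tail. Unless half of the vertices fail to be tree-like, one of the independent attempts
to realize the prescribed weighted tree succeeds with high probability. -/
theorem IsModel.measure_largestEigenvalue_lt_le [IsProbabilityMeasure P] [IsProbabilityMeasure μ]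
    (h : IsModel P n d μ A W) {α κ L c : ℝ}
    (hκ0 : 0 < κ) (hκ1 : κ ≤ 1)
    (hκ : ∀ (S : Finset (Pairs n)) (c : Pairs n → ℝ) (m : ℕ) (a : ℝ),
      S.card ≤ m → (∀ p ∈ S, 1 ≤ c p) → ∑ p ∈ S, c p ^ α ≤ a →
        κ ^ m * Real.exp (-a) ≤ (Measure.pi (fun _ : Pairs n => μ)).real {ω | ∀ p ∈ S, c p ≤ ω p})
    (hL : 0 < L) (hc : 0 ≤ c) {B : Finset (TreeVertex d)} {R : ℕ} (hB : ∀ s ∈ B, s.1.length ≤ R)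
    {w : TreeVertex d → TreeVertex d → ℝ} {x : TreeVertex d → ℝ} (hw : ∀ s t, 0 ≤ w s t)
    (hwsymm : ∀ s t, w s t = w t s) (hx : ∀ s, 0 ≤ x s) (hx1 : ∑ s ∈ B, x s ^ 2 ≤ 1)
    (hcx : c < treeSum B (fun s t => w s t * (x s * x t))) :
    P {ω | largestEigenvalue (weightedMatrix (A ω) (W ω)) < c * L} ≤
      P {ω | (n : ℝ) / 2 ≤ badCount d (A ω) (R + 1)} +
        ENNReal.ofReal (Real.exp (-(κ ^ (outEdges B).card *
          Real.exp (-((outEdges B).card + L ^ α * (treeSum B (fun s t => w s t ^ α) / 2))) *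
            (n / (2 * (d + 1) ^ (2 * R)))))) := by
  classical
  set η := ENNReal.ofReal (Real.exp (-(κ ^ (outEdges B).card *
    Real.exp (-((outEdges B).card + L ^ α * (treeSum B (fun s t => w s t ^ α) / 2))) *
      (n / (2 * (d + 1) ^ (2 * R)))))) with hη
  have hE : ∀ G : SimpleGraph (Fin n), ∃ E : Set (Pairs n → ℝ), MeasurableSet E ∧
      ((∀ v, (G.neighborSet v).ncard = d) → (badCount d G (R + 1) : ℝ) < n / 2 →
        Measure.pi (fun _ : Pairs n => μ) E ≤ η ∧
        ∀ W : Matrix (Fin n) (Fin n) ℝ, W.IsSymm → upperEntries W ∉ E →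
          c * L ≤ largestEigenvalue (weightedMatrix G W)) := by
    intro G
    by_cases hcond : (∀ v, (G.neighborSet v).ncard = d) ∧ (badCount d G (R + 1) : ℝ) < n / 2
    · obtain ⟨E, h1, h2, h3⟩ := exists_measurableSet_largestEigenvalue_ge hκ0 hκ1 hκ hL hc hB hw
        hwsymm hx hx1 hcx hcond.1 hcond.2
      exact ⟨E, h1, fun _ _ => ⟨h2, h3⟩⟩
    · exact ⟨∅, MeasurableSet.empty, fun h1 h2 => absurd ⟨h1, h2⟩ hcond⟩
  choose E hEmeas hE using hE
  have h₁ := h.measure_le {G | (badCount d G (R + 1) : ℝ) < n / 2} E hEmeas η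
    fun G hG hreg => (hE G hreg hG).1
  have hsub : {ω | largestEigenvalue (weightedMatrix (A ω) (W ω)) < c * L} ⊆
      A ⁻¹' (regularGraphs n d)ᶜ ∪ ({ω | (n : ℝ) / 2 ≤ badCount d (A ω) (R + 1)} ∪
        {ω | A ω ∈ {G | (badCount d G (R + 1) : ℝ) < n / 2} ∧ upperEntries (W ω) ∈ E (A ω)}) := by
    intro ω hω
    by_contra hcon
    simp only [Set.mem_union, not_or, Set.mem_preimage, Set.mem_compl_iff, not_not,
      Set.mem_ofPred_eq, not_le, not_and] at hcon hω
    obtain ⟨hreg, hbad, hEω⟩ := hcon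
    rw [mem_regularGraphs_iff] at hreg
    exact absurd hω (not_lt.2 ((hE (A ω) hreg hbad).2 _ (h.weight_symm ω) (hEω hbad)))
  calc _ ≤ _ := measure_mono hsub
    _ ≤ P (A ⁻¹' (regularGraphs n d)ᶜ) + _ := measure_union_le _ _
    _ ≤ _ := by
      rw [h.ae_isRegular, zero_add]
      refine (measure_union_le _ _).trans ?_
      gcongr

end Tails

/-! ### Convergence in probability -/

section Limit

theorem tendsto_ofReal_mul_natCast_rpow_neg (C : ℝ) {y : ℝ} (hy : 0 < y) :
    Tendsto (fun n : ℕ => ENNReal.ofReal (C * (n : ℝ) ^ (-y))) atTop (𝓝 0) := by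
  have h1 : Tendsto (fun n : ℕ => C * (n : ℝ) ^ (-y)) atTop (𝓝 (C * 0)) :=
    ((tendsto_rpow_neg_atTop hy).comp tendsto_natCast_atTop_atTop).const_mul C
  rw [mul_zero] at h1
  simpa using ENNReal.tendsto_ofReal h1

theorem exp_neg_mul_log {n : ℕ} (hn : 0 < n) (y : ℝ) :
    Real.exp (-(y * Real.log n)) = (n : ℝ) ^ (-y) := by
  rw [Real.rpow_def_of_pos (by exact_mod_cast hn)]
  congr 1
  ring

variable {d : ℕ} {α : ℝ} {μ : Measure ℝ} [IsProbabilityMeasure μ] {Ω : ℕ → Type*}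
  [∀ n, MeasurableSpace (Ω n)] {P : ∀ n, Measure (Ω n)} [∀ n, IsProbabilityMeasure (P n)]
  {A : ∀ n, Ω n → SimpleGraph (Fin n)} {W : ∀ n, Ω n → Matrix (Fin n) (Fin n) ℝ}

/-- The upper half of the convergence in probability: any constant `H` in the deterministic upper
bound on the tree is asymptotically an upper bound for `λ₁ / (log n) ^ (1 / α)`. -/
theorem tendsto_measure_le_largestEigenvalue (hd : 2 ≤ d) (hα : 0 < α) (hμ : IsWeibull μ α)
    (hmodel : ∀ n ∈ admissible d, IsModel (P n) n d μ (A n) (W n)) {H : ℝ} (hH : 0 ≤ H)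
    (hbound : TreeUpperBound d α H) {ε : ℝ} (hε : 0 < ε) :
    Tendsto (fun n => P n {ω | (H + ε) * (Real.log n) ^ (1 / α) ≤
      largestEigenvalue (weightedMatrix (A n ω) (W n ω))}) (atTop ⊓ 𝓟 (admissible d)) (𝓝 0) := by
  have hd0 : (0 : ℝ) < d := by exact_mod_cast (by omega : 0 < d)
  -- Heavy components may carry total cost up to `(1 + δ) log n`.
  obtain ⟨δ, hδ, hδ0⟩ : ∃ δ : ℝ, H * (1 + δ) ^ (1 / α) < H + ε / 2 ∧ 0 < δ := by
    have h1 : ContinuousAt (fun δ : ℝ => H * (1 + δ) ^ (1 / α)) 0 :=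
      continuousAt_const.mul ((continuousAt_const.add continuousAt_id).rpow_const
        (Or.inl (by norm_num)))
    have h2 : H * (1 + 0) ^ (1 / α) < H + ε / 2 := by
      rw [add_zero, Real.one_rpow]
      linarith
    have h3 := h1.eventually_lt_const h2
    exact ((h3.filter_mono nhdsWithin_le_nhds).and self_mem_nhdsWithin).exists (f := 𝓝[>] (0 : ℝ))
  -- Edges of weight at most `ρ (log n) ^ (1 / α)` shift the eigenvalue by at most
  -- `ε / 4 * (log n) ^ (1 / α)`.
  set ρ := ε / (4 * d) with hρ
  have hρ0 : 0 < ρ := by positivity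
  have hdρ : d * ρ = ε / 4 := by
    rw [hρ]
    field_simp
  set a := ρ ^ α with ha
  have ha0 : 0 < a := by positivity
  have hθ1 : (1 + δ / 2) / (1 + δ) < 1 := by
    rw [div_lt_one (by linarith)]
    linarith
  obtain ⟨M, hM1, hM⟩ := hμ.exists_lintegral_exp_le hα
    (by positivity : 0 < (1 + δ / 2) / (1 + δ)) hθ1
  obtain ⟨M', hM1', hM'⟩ := hμ.exists_lintegral_exp_le hα (θ := 1 / 2) (by norm_num) (by norm_num)
  -- Each heavy edge costs at least `a log n`, so that a connected set of `K` of them costs more than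
  -- `2 (1 + δ) log n`.
  obtain ⟨K₀, hK₀⟩ := exists_nat_gt (2 * (1 + δ) / a)
  set K := K₀ + 1 with hKdef
  have hK : 2 * (1 + δ) < K * a := by
    rw [div_lt_iff₀ ha0] at hK₀
    push_cast [hKdef]
    linarith
  obtain ⟨C, hC0, N, hC⟩ := exists_measure_badCount_ge_le hd (K + 1)
  set m := (d + 1) ^ K * d with hm
  have hlim : Tendsto (fun n : ℕ => ENNReal.ofReal (C * (n : ℝ) ^ (-(a / 4))) +
      (ENNReal.ofReal (M ^ m * (n : ℝ) ^ (-(δ / 2))) +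
        ENNReal.ofReal (M' ^ m * (n : ℝ) ^ (-(a / 4))))) atTop (𝓝 0) := by
    have := (tendsto_ofReal_mul_natCast_rpow_neg C (by positivity : 0 < a / 4)).add
      ((tendsto_ofReal_mul_natCast_rpow_neg (M ^ m) (by positivity : 0 < δ / 2)).add
        (tendsto_ofReal_mul_natCast_rpow_neg (M' ^ m) (by positivity : 0 < a / 4)))
    simpa using this
  refine tendsto_of_tendsto_of_tendsto_of_le_of_le' tendsto_const_nhds
    (hlim.mono_left inf_le_left) (Eventually.of_forall fun _ => zero_le) ?_
  rw [eventually_inf_principal]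
  filter_upwards [eventually_ge_atTop N, eventually_ge_atTop 2] with n hnN hn2 hadm
  have hn0 : 0 < n := by omega
  have hnpos : (0 : ℝ) < n := by exact_mod_cast hn0
  have hlog : 0 < Real.log n := Real.log_pos (by exact_mod_cast hn2)
  set l := Real.log n with hl
  set L := l ^ (1 / α) with hL
  have hL0 : 0 < L := by positivity
  have hLα : L ^ α = l := by
    rw [hL, ← Real.rpow_mul hlog.le, one_div_mul_cancel hα.ne', Real.rpow_one]
  have hτ : (ρ * L) ^ α = a * l := by rw [Real.mul_rpow hρ0.le hL0.le, hLα]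
  have hS : ((1 + δ) * l) ^ (1 / α) = (1 + δ) ^ (1 / α) * L :=
    Real.mul_rpow (by positivity) hlog.le
  -- At most `n ^ (a / 4)` bad vertices are allowed: this beats their bounded expected number, and
  -- leaves a heavy edge near one of them improbable.
  have h1 := (hmodel n hadm).measure_lt_largestEigenvalue_le hn0 (τ := ρ * L) (S := (1 + δ) * l)
    (T := (n : ℝ) ^ (a / 4)) (K := K) hα hH (by positivity) (by positivity) hbound
    (by omega) (by rw [hτ]; nlinarith) (by positivity) (by positivity) hM1 hM (by norm_num) hM1' hM'
  rw [hτ, hS, ← hm] at h1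
  have hsub : {ω | (H + ε) * L ≤ largestEigenvalue (weightedMatrix (A n ω) (W n ω))} ⊆
      {ω | d * (ρ * L) + H * ((1 + δ) ^ (1 / α) * L) <
        largestEigenvalue (weightedMatrix (A n ω) (W n ω))} := by
    intro ω hω
    rw [Set.mem_ofPred_eq] at hω ⊢
    refine lt_of_lt_of_le ?_ hω
    have := mul_lt_mul_of_pos_right hδ hL0
    have h2 : d * (ρ * L) = ε / 4 * L := by rw [← hdρ]; ring
    have h3 : 0 < ε * L := by positivity
    linarith
  refine (measure_mono hsub).trans (h1.trans ?_)
  have h2 := hC (hmodel n hadm) hnN ((n : ℝ) ^ (a / 4)) (by positivity)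
  refine add_le_add (h2.trans (le_of_eq ?_)) (add_le_add (le_of_eq ?_) (le_of_eq ?_))
  · rw [Real.rpow_neg hnpos.le, div_eq_mul_inv]
  · congr 1
    have h3 : (1 + δ / 2) / (1 + δ) * ((1 + δ) * l) = (1 + δ / 2) * l := by
      field_simp
    rw [h3, hl, exp_neg_mul_log hn0, mul_left_comm]
    congr 1
    rw [show -(δ / 2) = 1 + -(1 + δ / 2) by ring, Real.rpow_add hnpos, Real.rpow_one]
  · congr 1
    rw [← mul_assoc (1 / 2 : ℝ), hl, exp_neg_mul_log hn0, mul_left_comm, ← Real.rpow_add hnpos]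
    congr 2
    ring

/-- The lower half of the convergence in probability: a weighted finite subtree of cost `σ < 1`
occurs around a given tree-like vertex with probability about `n ^ (-σ)`, and there are order `n`
independent attempts. -/
theorem tendsto_measure_largestEigenvalue_le (hd : 2 ≤ d) (hα : 0 < α) (hμ : IsWeibull μ α)
    (hmodel : ∀ n ∈ admissible d, IsModel (P n) n d μ (A n) (W n)) {H : ℝ} (hH : 0 < H)
    (hbound : TreeLowerBound d α H) {ε : ℝ} (hε : 0 < ε) :
    Tendsto (fun n => P n {ω | largestEigenvalue (weightedMatrix (A n ω) (W n ω)) ≤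
      (H - ε) * (Real.log n) ^ (1 / α)}) (atTop ⊓ 𝓟 (admissible d)) (𝓝 0) := by
  set c := max 0 (H - ε / 2) with hc
  obtain ⟨B, w, x, hw, hwsymm, hx, hx1, hσ, hcx⟩ :=
    hbound c (le_max_left _ _) (max_lt hH (by linarith))
  set σ := treeSum B (fun s t => w s t ^ α) / 2 with hσdef
  set R := B.sup fun s => s.1.length with hR
  have hB : ∀ s ∈ B, s.1.length ≤ R := fun s hs => Finset.le_sup (f := fun s => s.1.length) hs
  obtain ⟨κ, hκ0, hκ1, hκ⟩ := hμ.exists_pi_block_ge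
  obtain ⟨C, hC0, N, hC⟩ := exists_measure_badCount_ge_le hd (R + 1)
  set m := (outEdges B).card with hm
  set b := κ ^ m * Real.exp (-m) / (2 * (d + 1) ^ (2 * R)) with hb
  have hb0 : 0 < b := by positivity
  have hlim : Tendsto (fun n : ℕ => ENNReal.ofReal (2 * C * (n : ℝ) ^ (-1 : ℝ)) +
      ENNReal.ofReal (Real.exp (-(b * (n : ℝ) ^ (1 - σ))))) atTop (𝓝 0) := by
    have h1 : Tendsto (fun n : ℕ => b * (n : ℝ) ^ (1 - σ)) atTop atTop :=
      ((tendsto_rpow_atTop (by linarith : 0 < 1 - σ)).comp tendsto_natCast_atTop_atTop).const_mul_atTop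
        hb0
    have h2 := ENNReal.tendsto_ofReal (Real.tendsto_exp_neg_atTop_nhds_zero.comp h1)
    have := (tendsto_ofReal_mul_natCast_rpow_neg (2 * C) one_pos).add h2
    simpa using this
  refine tendsto_of_tendsto_of_tendsto_of_le_of_le' tendsto_const_nhds
    (hlim.mono_left inf_le_left) (Eventually.of_forall fun _ => zero_le) ?_
  rw [eventually_inf_principal]
  filter_upwards [eventually_ge_atTop N, eventually_ge_atTop 2] with n hnN hn2 hadm
  have hn0 : 0 < n := by omega
  have hnpos : (0 : ℝ) < n := by exact_mod_cast hn0
  have hlog : 0 < Real.log n := Real.log_pos (by exact_mod_cast hn2)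
  set l := Real.log n with hl
  set L := l ^ (1 / α) with hL
  have hL0 : 0 < L := by positivity
  have hLα : L ^ α = l := by
    rw [hL, ← Real.rpow_mul hlog.le, one_div_mul_cancel hα.ne', Real.rpow_one]
  have h1 := (hmodel n hadm).measure_largestEigenvalue_lt_le hκ0 hκ1
    (fun S c m a => hκ S c m a) hL0 (le_max_left _ _) hB hw hwsymm hx hx1 hcx
  rw [hLα, ← hm, ← hσdef] at h1
  have hsub : {ω | largestEigenvalue (weightedMatrix (A n ω) (W n ω)) ≤ (H - ε) * L} ⊆
      {ω | largestEigenvalue (weightedMatrix (A n ω) (W n ω)) < c * L} := by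
    intro ω hω
    rw [Set.mem_ofPred_eq] at hω ⊢
    refine lt_of_le_of_lt hω (mul_lt_mul_of_pos_right ?_ hL0)
    exact lt_of_lt_of_le (by linarith) (le_max_right _ _)
  refine (measure_mono hsub).trans (h1.trans ?_)
  have h2 := hC (hmodel n hadm) hnN ((n : ℝ) / 2) (by positivity)
  refine add_le_add (h2.trans (le_of_eq ?_)) (le_of_eq ?_)
  · congr 1
    rw [Real.rpow_neg_one]
    field_simp
  · congr 3
    rw [neg_add, Real.exp_add, mul_comm l, hl, exp_neg_mul_log hn0, hb, sub_eq_add_neg,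
      Real.rpow_add hnpos, Real.rpow_one]
    field_simp

theorem tendsto_measure_abs_largestEigenvalue_div_sub (hd : 2 ≤ d) (hα : 0 < α)
    (hμ : IsWeibull μ α) (hmodel : ∀ n ∈ admissible d, IsModel (P n) n d μ (A n) (W n)) {H : ℝ}
    (hH : 0 < H) (hupper : TreeUpperBound d α H) (hlower : TreeLowerBound d α H) {ε : ℝ}
    (hε : 0 < ε) :
    Tendsto (fun n => P n {ω | ε ≤ |largestEigenvalue (weightedMatrix (A n ω) (W n ω)) /
      (Real.log n) ^ (1 / α) - H|}) (atTop ⊓ 𝓟 (admissible d)) (𝓝 0) := by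
  have h1 := (tendsto_measure_le_largestEigenvalue hd hα hμ hmodel hH.le hupper hε).add
    (tendsto_measure_largestEigenvalue_le hd hα hμ hmodel hH hlower hε)
  rw [add_zero] at h1
  refine tendsto_of_tendsto_of_tendsto_of_le_of_le' tendsto_const_nhds h1
    (Eventually.of_forall fun _ => zero_le) ?_
  refine Eventually.filter_mono inf_le_left ?_
  filter_upwards [eventually_ge_atTop 2] with n hn2
  have hlog : 0 < Real.log n := Real.log_pos (by exact_mod_cast hn2)
  have hL0 : 0 < (Real.log n) ^ (1 / α) := by positivity
  refine (measure_mono ?_).trans (measure_union_le _ _)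
  intro ω hω
  rcases le_abs'.1 (show ε ≤ |_| from hω) with h | h
  · right
    rw [Set.mem_ofPred_eq, ← div_le_iff₀ hL0]
    linarith
  · left
    rw [Set.mem_ofPred_eq, ← le_div_iff₀ hL0]
    linarith

end Limit

end WeightedRegularGraph

open WeightedRegularGraph
theorem theorem1 (d : ℕ) (hd : 3 ≤ d) :
    ContinuousOn (hConst d) (Set.Ioi 2) ∧
    (∀ α : ℝ, 2 < α → hConstENN d α ≠ ∞ ∧ 1 < hConst d α) ∧
    Tendsto (hConst d) (𝓝[>] 2) (𝓝 1) ∧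
    Tendsto (hConst d) atTop (𝓝 (2 * √((d : ℝ) - 1))) ∧
    ∀ (α : ℝ), 0 < α → ∀ (μ : Measure ℝ) [IsProbabilityMeasure μ], IsWeibull μ α →
      ∀ (Ω : ℕ → Type*) [∀ n, MeasurableSpace (Ω n)] (P : ∀ n, Measure (Ω n))
        [∀ n, IsProbabilityMeasure (P n)]
        (A : ∀ n, Ω n → SimpleGraph (Fin n)) (W : ∀ n, Ω n → Matrix (Fin n) (Fin n) ℝ),
        (∀ n ∈ admissible d, IsModel (P n) n d μ (A n) (W n)) →
        ∀ ε : ℝ, 0 < ε →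
          Tendsto
            (fun n => P n {ω | ε ≤ |largestEigenvalue (weightedMatrix (A n ω) (W n ω)) /
              (Real.log n) ^ (1 / α) - (if α ≤ 2 then 1 else hConst d α)|})
            (atTop ⊓ 𝓟 (admissible d)) (𝓝 0) := by
  have hd2 : 2 ≤ d := by omega
  refine ⟨continuousOn_hConst hd2, fun α hα => ⟨hConstENN_ne_top hd2 hα, one_lt_hConst hd2 hα⟩,
    tendsto_hConst_two hd2, tendsto_hConst_atTop hd, ?_⟩
  intro α hα μ _ hμ Ω _ P _ A W hmodel ε hε
  split_ifs with hα2
  · exact tendsto_measure_abs_largestEigenvalue_div_sub hd2 hα hμ hmodel one_pos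
      (treeUpperBound_of_le_two hα hα2) (treeLowerBound_of_le_two (by omega) hα) hε
  · push Not at hα2
    exact tendsto_measure_abs_largestEigenvalue_div_sub hd2 hα hμ hmodel
      (one_pos.trans (one_lt_hConst hd2 hα2)) (treeUpperBound_of_two_lt hd2 hα2)
      (treeLowerBound_of_two_lt hα2) hε
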